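/- Let $\overline\Sigma$ be a compact connected Riemann surface, $P\subset\overline\Sigma$ a finite set of punctures, $\Sigma=\overline\Sigma\setminus P$ with universal cover $\pi:\tilde\Sigma\to\Sigma$, and let $q$ be a meromorphic quadratic differential on $\overline\Sigma$, holomorphic on $\Sigma$, with a pole of order at least $3$ at every point of $P$. Let $\tilde\sigma:\tilde\Sigma\to\mathrm{AdS}_3$ be a complete, conformal, space-like maximal embedding, equivariant under the deck group of $\pi$ (each deck transformation acts on the image through an isometry of $\mathrm{AdS}_3$), with second fundamental form $II=\mathrm{Re}(2\pi^*q)$. Let $p\in P$ be a pole of order $n$, and let $w$ be a local holomorphic coordinate centred at $p$, defined on a disc $\{|w|<r\}$ with $V=\{0<|w|<r\}$ contained in $\Sigma$ and free of zeros of $q$, in which $q=w^{-n}dw^2$ if $n$ is odd, and $q=\left(w^{-n/2}+A w^{-1}\right)^2dw^2$ for some $A\in\mathbb C$ if $n$ is even. Let $\mathbb H^2=\{\omega\in\mathbb C:\mathrm{Im}\,\omega>0\}$ and let $\Phi:\mathbb H^2\to V$ be a natural coordinate on a standard half-plane, that is, an injective holomorphic map with $\Phi^*q=d\omega^2$. Let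 $v:\mathbb H^2\to\mathbb R$ be the function such that the metric induced by $\tilde\sigma$, read in the coordinate $\omega$ through a lift of $\Phi$ to $\tilde\Sigma$, equals $2e^{2v}|d\omega|^2$. Then $$v(\omega)=O\!\left(\frac{e^{-2\sqrt2\,|\omega|}}{\sqrt{|\omega|}}\right)\qquad\text{as }|\omega|\to+\infty,\ \omega\in\mathbb H^2 ,$$ uniformly in the half-plane: there are $C,R>0$ with $|v(\omega)|\le C e^{-2\sqrt2|\omega|}/\sqrt{|\omega|}$ for all $\omega\in\mathbb H^2$ with $|\omega|\ge R$. -/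

import Mathlib

open Set Filter Topology Asymptotics MeasureTheory
open scoped Manifold ContDiff

noncomputable section

/-! ### Anti-de Sitter space -/

/-- The bilinear form of signature `(2,2)` on `ℝ⁴`. -/
def adsForm (x y : Fin 4 → ℝ) : ℝ :=
  x 0 * y 0 + x 1 * y 1 - x 2 * y 2 - x 3 * y 3

/-- The quadric `⟨x, x⟩ = -1`, double cover of anti-de Sitter space. -/
def HatAdS : Type := {x : Fin 4 → ℝ // adsForm x x = -1}

instance : TopologicalSpace HatAdS :=
  inferInstanceAs (TopologicalSpace {x : Fin 4 → ℝ // adsForm x x = -1})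

/-- Two points of the quadric span the same line iff they agree up to sign. -/
instance hatAdSSetoid : Setoid HatAdS where
  r x y := x.1 = y.1 ∨ x.1 = -y.1
  iseqv :=
    { refl := fun _ => Or.inl rfl
      symm := by
        rintro x y (h | h)
        · exact Or.inl h.symm
        · exact Or.inr (by rw [h, neg_neg])
      trans := by
        rintro x y z (h | h) (k | k)
        · exact Or.inl (h.trans k)
        · exact Or.inr (h.trans k)
        · exact Or.inr (by rw [h, k])
        · exact Or.inl (by rw [h, k, neg_neg]) }

/-- Anti-de Sitter space: the time-like lines of `ℝ⁴`, i.e. the quadric modulo sign, with the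
quotient topology. -/
def AdS3 : Type := Quotient hatAdSSetoid

instance : TopologicalSpace AdS3 := inferInstanceAs (TopologicalSpace (Quotient hatAdSSetoid))

/-- The projection from the quadric to anti-de Sitter space. -/
def AdS3.mk (x : Fin 4 → ℝ) (hx : adsForm x x = -1) : AdS3 :=
  Quotient.mk hatAdSSetoid ⟨x, hx⟩

/-! ### Quadratic differentials -/

section QuadraticDifferential

variable (X : Type*) [TopologicalSpace X] [ChartedSpace ℂ X]

/-- A field of complex quadratic forms on the tangent lines of `X`: a section, with no regularity
yet, of the square of the cotangent bundle. -/
structure QuadDiff where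
  toFun : ∀ x : X, TangentSpace 𝓘(ℂ) x → ℂ
  map_smul : ∀ (x : X) (c : ℂ) (ξ : TangentSpace 𝓘(ℂ) x), toFun x (c • ξ) = c ^ 2 * toFun x ξ

variable {X}

/-- The function `f` with `Φ^* q = f(z) dz²`, for a holomorphic map `Φ` from (an open subset of)
`ℂ` to `X`. -/
def QuadDiff.pullback (q : QuadDiff X) (Φ : ℂ → X) (z : ℂ) : ℂ :=
  q.toFun (Φ z) (mfderiv 𝓘(ℂ) 𝓘(ℂ) Φ z (1 : ℂ))

/-- The coefficient of `q` in the preferred chart at `x`. -/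
def QuadDiff.coeffAt (q : QuadDiff X) (x : X) : ℂ → ℂ :=
  q.pullback (chartAt ℂ x).symm

/-- `q` is a meromorphic quadratic differential on `X` which is holomorphic off the finite set `P`
and has a pole of order at least `3` at every point of `P`. -/
structure QuadDiff.IsMeromorphicWithPoles (q : QuadDiff X) (P : Finset X) : Prop where
  holomorphic : ∀ x ∉ P, AnalyticAt ℂ (q.coeffAt x) (chartAt ℂ x x)
  meromorphic : ∀ p ∈ P, MeromorphicAt (q.coeffAt p) (chartAt ℂ p p)
  pole : ∀ p ∈ P, ∃ n : ℕ, 3 ≤ n ∧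
    meromorphicOrderAt (q.coeffAt p) (chartAt ℂ p p) = ((-(n : ℤ) : ℤ) : WithTop ℤ)

/-- `w = e` is a holomorphic coordinate centred at `p`, covering the disc `|w| < r`, in which `q`
has the normal form `w⁻ⁿ dw²` (`n` odd) or `(w^(-n/2) + A w⁻¹)² dw²` (`n` even), where `n ≥ 3` is
the order of the pole `p`. The punctured disc contains neither punctures nor zeros of `q`. -/
structure IsAdaptedCoordinate (q : QuadDiff X) (P : Finset X) (p : X) (n : ℕ)
    (e : OpenPartialHomeomorph X ℂ) (r : ℝ) : Prop where
  three_le : 3 ≤ n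
  holomorphic : e ∈ IsManifold.maximalAtlas 𝓘(ℂ) ω X
  mem_source : p ∈ e.source
  map_p : e p = 0
  r_pos : 0 < r
  ball_subset : Metric.ball (0 : ℂ) r ⊆ e.target
  not_puncture : ∀ w : ℂ, 0 < ‖w‖ → ‖w‖ < r → e.symm w ∉ P
  ne_zero : ∀ w : ℂ, 0 < ‖w‖ → ‖w‖ < r → q.pullback e.symm w ≠ 0
  normal_form_odd : Odd n →
    ∀ w : ℂ, 0 < ‖w‖ → ‖w‖ < r → q.pullback e.symm w = 1 / w ^ n
  normal_form_even : Even n → ∃ A : ℂ,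
    ∀ w : ℂ, 0 < ‖w‖ → ‖w‖ < r → q.pullback e.symm w = (1 / w ^ (n / 2) + A / w) ^ 2

/-- The open upper half-plane, as a subset of `ℂ`. -/
def upperHalf : Set ℂ := {z : ℂ | 0 < z.im}

/-- `Φ` parametrises a standard half-plane of `q` at `p` by a natural coordinate: it is an injective
holomorphic map from the upper half-plane into a punctured disc `V = {0 < |w| < r}` of an adapted
coordinate at `p`, and `Φ^* q = dω²`. -/
structure IsStandardHalfPlane (q : QuadDiff X) (P : Finset X) (p : X) (Φ : ℂ → X) : Prop where
  holomorphic : MDifferentiableOn 𝓘(ℂ) 𝓘(ℂ) Φ upperHalf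
  injective : InjOn Φ upperHalf
  maps_to : ∃ (n : ℕ) (e : OpenPartialHomeomorph X ℂ) (r : ℝ), IsAdaptedCoordinate q P p n e r ∧
    ∀ z ∈ upperHalf, Φ z ∈ e.source ∧ 0 < ‖e (Φ z)‖ ∧ ‖e (Φ z)‖ < r
  pullback_eq : ∀ z ∈ upperHalf, q.pullback Φ z = 1

end QuadraticDifferential

/-! ### Maximal surfaces -/

section Surface

variable {Y : Type*} [TopologicalSpace Y] [ChartedSpace ℂ Y]

/-- The differential at `y` of a map `f : Y → ℝ⁴`; `T_y Y` is identified with `ℂ` by the preferred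
chart at `y`, compatibly with the complex structure. -/
def surfaceDeriv (f : Y → Fin 4 → ℝ) (y : Y) (ξ : ℂ) : Fin 4 → ℝ :=
  mfderiv 𝓘(ℝ, ℂ) 𝓘(ℝ, Fin 4 → ℝ) f y ξ

/-- The metric induced by `s : Y → ℝ⁴` from the form of signature `(2,2)`. -/
def inducedMetric (s : Y → Fin 4 → ℝ) (y : Y) (ξ η : ℂ) : ℝ :=
  adsForm (surfaceDeriv s y ξ) (surfaceDeriv s y η)

/-- The second fundamental form `II(ξ, η) = ⟨dN ξ, ds η⟩` of `s` with unit normal `N`. -/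
def secondFundamentalForm (s N : Y → Fin 4 → ℝ) (y : Y) (ξ η : ℂ) : ℝ :=
  adsForm (surfaceDeriv N y ξ) (surfaceDeriv s y η)

/-- The induced metric is complete: every `C¹` path that leaves all compact sets has infinite
length. -/
def InducedMetricComplete (s : Y → Fin 4 → ℝ) : Prop :=
  ∀ γ : ℝ → Y, ContMDiffOn 𝓘(ℝ, ℝ) 𝓘(ℝ, ℂ) 1 γ (Ici 0) → Tendsto γ atTop (cocompact Y) →
    ∫⁻ t in Ioi (0 : ℝ),
      ENNReal.ofReal (Real.sqrt (adsForm (deriv (s ∘ γ) t) (deriv (s ∘ γ) t))) = ⊤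

/-- A complete, conformal, equivariant maximal embedding of `Y` (the universal cover of the surface,
with covering map `π : Y → X`) into anti-de Sitter space with second fundamental form `Re (2 π^*q)`.
It is recorded by a lift `s` to the quadric `⟨x, x⟩ = -1` in `ℝ⁴` and a unit normal field `N`. -/
structure EquivariantMaximalEmbedding {X : Type*} [TopologicalSpace X] [ChartedSpace ℂ X]
    (π : Y → X) (q : QuadDiff X) where
  s : Y → Fin 4 → ℝ
  N : Y → Fin 4 → ℝ
  smooth_s : ContMDiff 𝓘(ℝ, ℂ) 𝓘(ℝ, Fin 4 → ℝ) ∞ s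
  smooth_N : ContMDiff 𝓘(ℝ, ℂ) 𝓘(ℝ, Fin 4 → ℝ) ∞ N
  mem_quadric : ∀ y, adsForm (s y) (s y) = -1
  embedding : IsEmbedding (fun y => AdS3.mk (s y) (mem_quadric y))
  spacelike : ∀ (y : Y) (ξ : ℂ), ξ ≠ 0 → 0 < inducedMetric s y ξ ξ
  conformal : ∀ (y : Y) (c ξ : ℂ),
    inducedMetric s y (c * ξ) (c * ξ) = ‖c‖ ^ 2 * inducedMetric s y ξ ξ
  complete : InducedMetricComplete s
  normal_unit : ∀ y, adsForm (N y) (N y) = -1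
  normal_position : ∀ y, adsForm (N y) (s y) = 0
  normal_tangent : ∀ (y : Y) (ξ : ℂ), adsForm (N y) (surfaceDeriv s y ξ) = 0
  /- The trace of `II` with respect to the (conformal) induced metric vanishes. -/
  maximal : ∀ (y : Y) (ξ : ℂ),
    secondFundamentalForm s N y ξ ξ +
      secondFundamentalForm s N y (Complex.I * ξ) (Complex.I * ξ) = 0
  secondForm_eq : ∀ (y : Y) (ξ : ℂ),
    secondFundamentalForm s N y ξ ξ =
      (2 * q.toFun (π y) (mfderiv 𝓘(ℂ) 𝓘(ℂ) π y ξ)).re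
  /- Every deck transformation acts on the image through an isometry `±A` of anti-de Sitter
  space. -/
  equivariant : ∀ γ : Y ≃ₜ Y, (∀ y, π (γ y) = π y) →
    ∃ A : (Fin 4 → ℝ) ≃ₗ[ℝ] (Fin 4 → ℝ), (∀ x x', adsForm (A x) (A x') = adsForm x x') ∧
      ∀ y, s (γ y) = A (s y) ∨ s (γ y) = -A (s y)

end Surface

end

noncomputable section

namespace MaximalSurface

open scoped Laplacian

/-! ### The Laplacian in the plane -/

section Laplacian

/-! In a natural coordinate `ω` the Gauss equation of the maximal surface becomes the sinh-Gordon
equation `Δ v = 4 sinh (2 v)` (`gauss_equation`, `isSinhGordon_of_gauss`). Its linearisation `Δ v =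
8 v` explains the rate `√8 = 2√2`, and the decaying radial solutions of that equation behave like
`e^{-√8 r} / √r`.

The difficulty is uniformity up to the edge of the half-plane. It is met by leaving the half-plane:
in a logarithmic coordinate `ξ` at the pole, suitably normalised, `ω` is `exp ξ + a ξ + b`
(`exists_normalized`), and the surface lifts along a whole half-plane `ℓ < Re ξ`, which winds around
the puncture. The solution therefore continues past both edges of the standard half-plane, and far
out the latter occupies only arguments `|Im ξ| ≤ 4`.

Three comparisons with explicit supersolutions then bound a solution from above; since `-V` is again
a solution, they bound `|V|`. (1) A barrier that is infinite on the boundary of a flat unit disc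
bounds every solution by a universal constant (`IsSinhGordon.le_log_three`). (2) A growing radial
barrier centred at a point whose `ω` has modulus `r`, used up to flat distance `r - R`, gives the
right exponential rate with a factor `1 + r` (`exists_rough_decay`). (3) In a sector around the ray
through the point, `r^{-1/2} e^{-κ r}` is corrected by a term that vanishes on the ray but dominates
the rough bound on the sides of the sector (`exists_sharp_decay_le`). On the ray itself only the
sharp rate remains. -/

lemma laplacian_eq_fderiv_fderiv (f : ℂ → ℝ) (z : ℂ) :
    Δ f z = fderiv ℝ (fderiv ℝ f) z 1 1 + fderiv ℝ (fderiv ℝ f) z Complex.I Complex.I := by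
  rw [InnerProductSpace.laplacian_eq_iteratedFDeriv_complexPlane]
  simp [iteratedFDeriv_two_apply]

lemma differentiableAt_fderiv {f : ℂ → ℝ} {z : ℂ} (hf : ContDiffAt ℝ 2 f z) :
    DifferentiableAt ℝ (fderiv ℝ f) z :=
  (hf.fderiv_right (m := 1) (by norm_num)).differentiableAt (by norm_num)

/-- The trace of a bilinear form over a conformal basis of the plane. -/
lemma bilin_conformal_trace (B : ℂ →L[ℝ] ℂ →L[ℝ] ℝ) (c : ℂ) :
    B c c + B (c * Complex.I) (c * Complex.I) =
      ‖c‖ ^ 2 * (B 1 1 + B Complex.I Complex.I) := by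
  have h1 : c = c.re • (1 : ℂ) + c.im • Complex.I := by
    apply Complex.ext <;> simp
  have h2 : c * Complex.I = (-c.im) • (1 : ℂ) + c.re • Complex.I := by
    apply Complex.ext <;> simp
  have h3 : ‖c‖ ^ 2 = c.re ^ 2 + c.im ^ 2 := by
    rw [← Complex.normSq_eq_norm_sq, Complex.normSq_apply]; ring
  rw [h2, h3]
  conv_lhs => enter [1]; rw [h1]
  simp only [map_add, map_smul, add_apply, smul_apply, smul_eq_mul]
  ring

lemma hasFDerivAt_real_of_hasDerivAt {P : ℂ → ℂ} {c z : ℂ} (h : HasDerivAt P c z) :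
    HasFDerivAt P (ContinuousLinearMap.mul ℝ ℂ c) z :=
  (h.hasFDerivAt.restrictScalars ℝ).congr_fderiv (by ext <;> simp [mul_comm])

/-- Conformal covariance of the Laplacian. -/
lemma laplacian_comp_holomorphic {f : ℂ → ℝ} {P : ℂ → ℂ} {z : ℂ}
    (hP : AnalyticAt ℂ P z) (hf : ContDiffAt ℝ 2 f (P z)) :
    Δ (fun w => f (P w)) z = ‖deriv P z‖ ^ 2 * Δ f (P z) := by
  have hD : (fderiv ℝ fun w => f (P w)) =ᶠ[𝓝 z]
      fun w => (fderiv ℝ f (P w)).comp ((ContinuousLinearMap.mul ℝ ℂ) (deriv P w)) := by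
    have h1 : ∀ᶠ w in 𝓝 z, ContDiffAt ℝ 2 f (P w) :=
      hP.continuousAt.eventually (hf.eventually (by simp))
    filter_upwards [h1, hP.eventually_analyticAt] with w hw1 hw2
    have h2 := hasFDerivAt_real_of_hasDerivAt hw2.differentiableAt.hasDerivAt
    exact ((hw1.differentiableAt (by norm_num)).hasFDerivAt.comp w h2).fderiv
  have hPd := hasFDerivAt_real_of_hasDerivAt hP.differentiableAt.hasDerivAt
  have hP2 := hasFDerivAt_real_of_hasDerivAt hP.deriv.differentiableAt.hasDerivAt
  have hA : HasFDerivAt (fun w => fderiv ℝ f (P w))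
      ((fderiv ℝ (fderiv ℝ f) (P z)).comp ((ContinuousLinearMap.mul ℝ ℂ) (deriv P z))) z :=
    (differentiableAt_fderiv hf).hasFDerivAt.comp z hPd
  have hB : HasFDerivAt (fun w => (ContinuousLinearMap.mul ℝ ℂ) (deriv P w))
      ((ContinuousLinearMap.mul ℝ ℂ).comp ((ContinuousLinearMap.mul ℝ ℂ) (deriv (deriv P) z))) z :=
    (ContinuousLinearMap.mul ℝ ℂ).hasFDerivAt.comp z hP2
  have hC := (hA.clm_comp hB).fderiv
  rw [laplacian_eq_fderiv_fderiv, hD.fderiv_eq, hC, laplacian_eq_fderiv_fderiv,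
    ← bilin_conformal_trace]
  -- The terms containing the second derivative of `P` cancel in the trace, because `1 ^ 2 + I ^ 2 =
  -- 0`.
  simp [mul_assoc]
  ring

lemma deriv_deriv_line {h : ℂ → ℝ} {x : ℂ} (hh : ContDiffAt ℝ 2 h x) (v : ℂ) :
    deriv (deriv fun t : ℝ => h (x + t • v)) 0 = fderiv ℝ (fderiv ℝ h) x v v := by
  have hl : ∀ t : ℝ, HasDerivAt (fun t : ℝ => x + t • v) v t := fun t => by
    simpa using ((hasDerivAt_id t).smul_const v).const_add x
  have hc : Tendsto (fun t : ℝ => x + t • v) (𝓝 0) (𝓝 x) := by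
    have := (hl 0).continuousAt.tendsto
    simpa using this
  have h1 : deriv (fun t : ℝ => h (x + t • v)) =ᶠ[𝓝 0] fun t => fderiv ℝ h (x + t • v) v := by
    filter_upwards [hc.eventually (hh.eventually (by simp))] with t ht
    exact ((ht.differentiableAt (by norm_num)).hasFDerivAt.comp_hasDerivAt t (hl t)).deriv
  rw [h1.deriv_eq]
  have h2 : HasFDerivAt (fderiv ℝ h) (fderiv ℝ (fderiv ℝ h) x) (x + (0 : ℝ) • v) := by
    simpa using (differentiableAt_fderiv hh).hasFDerivAt
  have h3 : HasDerivAt (fun t : ℝ => fderiv ℝ h (x + t • v)) (fderiv ℝ (fderiv ℝ h) x v) 0 :=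
    h2.comp_hasDerivAt (0 : ℝ) (hl 0)
  have h4 := h3.hasFDerivAt.clm_apply (hasFDerivAt_const v (0 : ℝ))
  simpa using h4.hasDerivAt.deriv

/-- Were the second derivative along a line positive, the restriction would have a local minimum as
well as a local maximum at `0`, so it would be constant nearby and its second derivative would
vanish. -/
lemma secondDeriv_nonpos_of_isLocalMax {h : ℂ → ℝ} {x : ℂ} (hh : ContDiffAt ℝ 2 h x)
    (hm : IsLocalMax h x) (v : ℂ) : fderiv ℝ (fderiv ℝ h) x v v ≤ 0 := by
  by_contra! hpos
  rw [← deriv_deriv_line hh v] at hpos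
  have hcont : ContinuousAt (fun t : ℝ => x + t • v) 0 := by fun_prop
  have hm' : IsLocalMax (fun t : ℝ => h (x + t • v)) 0 := by
    have : IsLocalMax h (x + (0 : ℝ) • v) := by simpa using hm
    exact IsLocalMax.comp_continuous (f := h) (g := fun t : ℝ => x + t • v) this hcont
  have hc : ContinuousAt (fun t : ℝ => h (x + t • v)) 0 := by
    apply ContinuousAt.comp _ hcont
    simpa using hh.continuousAt
  have hmin := isLocalMin_of_deriv_deriv_pos hpos hm'.deriv_eq_zero hc
  have hconst : (fun t : ℝ => h (x + t • v)) =ᶠ[𝓝 0] fun _ => h (x + (0 : ℝ) • v) := by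
    filter_upwards [hm', hmin] with t h1 h2
    exact le_antisymm h1 h2
  have : deriv (deriv fun t : ℝ => h (x + t • v)) 0 = 0 := by
    rw [hconst.deriv.deriv_eq]; simp
  linarith

lemma laplacian_nonpos_of_isLocalMax {h : ℂ → ℝ} {x : ℂ} (hh : ContDiffAt ℝ 2 h x)
    (hm : IsLocalMax h x) : Δ h x ≤ 0 := by
  rw [laplacian_eq_fderiv_fderiv]
  linarith [secondDeriv_nonpos_of_isLocalMax hh hm 1,
    secondDeriv_nonpos_of_isLocalMax hh hm Complex.I]

/-- Comparison principle. -/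
lemma le_of_laplacian_lt {K : Set ℂ} (hK : IsCompact K) {V B : ℂ → ℝ} (hV : ContinuousOn V K)
    (hB : ContinuousOn B K)
    (H : ∀ x ∈ K, B x < V x →
      K ∈ 𝓝 x ∧ ContDiffAt ℝ 2 V x ∧ ContDiffAt ℝ 2 B x ∧ Δ B x < Δ V x) :
    ∀ x ∈ K, V x ≤ B x := by
  intro x hx
  by_contra! hlt
  obtain ⟨y, hy, hmax⟩ := hK.exists_isMaxOn ⟨x, hx⟩ (hV.sub hB)
  have hxy : V x - B x ≤ V y - B y := hmax hx
  -- The hypothesis `H` also encodes the boundary condition: where `B < V` the point must be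
  -- interior to `K`, so the maximum of `V - B` is an interior one.
  obtain ⟨h1, h2, h3, h4⟩ := H y hy (by linarith)
  have hm : IsLocalMax (V - B) y := by
    filter_upwards [h1] with z hz using hmax hz
  have h5 : ContDiffAt ℝ 2 (V - B) y := h2.sub h3
  have := laplacian_nonpos_of_isLocalMax h5 hm
  rw [h2.laplacian_sub h3] at this
  linarith

/-- The Laplacian of a product of a function of `Re z` and a function of `Im z`. -/
lemma laplacian_re_mul_im {a a' b b' : ℝ → ℝ} {a'' b'' : ℝ} {z : ℂ}
    (ha : ∀ᶠ x in 𝓝 z.re, HasDerivAt a (a' x) x) (ha' : HasDerivAt a' a'' z.re)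
    (hb : ∀ᶠ x in 𝓝 z.im, HasDerivAt b (b' x) x) (hb' : HasDerivAt b' b'' z.im) :
    Δ (fun w : ℂ => a w.re * b w.im) z = a'' * b z.im + a z.re * b'' := by
  have hD : (fderiv ℝ fun w : ℂ => a w.re * b w.im) =ᶠ[𝓝 z] fun w =>
      (a w.re * b' w.im) • Complex.imCLM + (b w.im * a' w.re) • Complex.reCLM := by
    filter_upwards [Complex.continuous_re.continuousAt.eventually ha,
      Complex.continuous_im.continuousAt.eventually hb] with w hw1 hw2
    have h1 : HasFDerivAt (fun w : ℂ => a w.re) (a' w.re • Complex.reCLM) w :=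
      hw1.comp_hasFDerivAt w Complex.reCLM.hasFDerivAt
    have h2 : HasFDerivAt (fun w : ℂ => b w.im) (b' w.im • Complex.imCLM) w :=
      hw2.comp_hasFDerivAt w Complex.imCLM.hasFDerivAt
    rw [(h1.fun_mul h2).fderiv, smul_smul, smul_smul]
  have h1 : HasFDerivAt (fun w : ℂ => a w.re) (a' z.re • Complex.reCLM) z :=
    ha.self_of_nhds.comp_hasFDerivAt z Complex.reCLM.hasFDerivAt
  have h2 : HasFDerivAt (fun w : ℂ => b w.im) (b' z.im • Complex.imCLM) z :=
    hb.self_of_nhds.comp_hasFDerivAt z Complex.imCLM.hasFDerivAt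
  have h1' : HasFDerivAt (fun w : ℂ => a' w.re) (a'' • Complex.reCLM) z :=
    ha'.comp_hasFDerivAt z Complex.reCLM.hasFDerivAt
  have h2' : HasFDerivAt (fun w : ℂ => b' w.im) (b'' • Complex.imCLM) z :=
    hb'.comp_hasFDerivAt z Complex.imCLM.hasFDerivAt
  have h3 := (((h1.fun_mul h2').smul_const Complex.imCLM).fun_add
    ((h2.fun_mul h1').smul_const Complex.reCLM)).fderiv
  rw [laplacian_eq_fderiv_fderiv, hD.fderiv_eq, h3]
  simp
  ring

/-- The Laplacian of a radial function. -/
lemma laplacian_radial {φ φ' : ℝ → ℝ} {φ'' : ℝ} {z c : ℂ}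
    (h : ∀ᶠ x in 𝓝 (‖z - c‖ ^ 2), HasDerivAt φ (φ' x) x)
    (h' : HasDerivAt φ' φ'' (‖z - c‖ ^ 2)) :
    Δ (fun w : ℂ => φ (‖w - c‖ ^ 2)) z =
      4 * ‖z - c‖ ^ 2 * φ'' + 4 * φ' (‖z - c‖ ^ 2) := by
  have hn : ∀ w : ℂ, HasFDerivAt (fun w : ℂ => ‖w - c‖ ^ 2)
      ((2 : ℝ) • innerSL ℝ (w - c)) w := fun w =>
    (HasFDerivAt.comp (g := fun x : ℂ => ‖x‖ ^ 2) (f := fun w : ℂ => w - c) w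
      (hasStrictFDerivAt_norm_sq (w - c)).hasFDerivAt
      ((hasFDerivAt_id w).sub_const c)).congr_fderiv (by ext <;> simp)
  have hcont : ContinuousAt (fun w : ℂ => ‖w - c‖ ^ 2) z := by fun_prop
  have hD : (fderiv ℝ fun w : ℂ => φ (‖w - c‖ ^ 2)) =ᶠ[𝓝 z] fun w =>
      φ' (‖w - c‖ ^ 2) • ((2 : ℝ) • innerSL ℝ (w - c)) := by
    filter_upwards [hcont.eventually h] with w hw
    exact (hw.comp_hasFDerivAt w (hn w)).fderiv
  have h1 : HasFDerivAt (fun w : ℂ => φ' (‖w - c‖ ^ 2)) (φ'' • (2 : ℝ) • innerSL ℝ (z - c)) z :=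
    h'.comp_hasFDerivAt z (hn z)
  have h2 : HasFDerivAt (fun w : ℂ => (2 : ℝ) • innerSL ℝ (w - c)) ((2 : ℝ) • innerSL ℝ) z :=
    (((innerSL ℝ (E := ℂ)).hasFDerivAt.comp z
      ((hasFDerivAt_id z).sub_const c)).const_smul (2 : ℝ)).congr_fderiv (by ext <;> simp)
  rw [laplacian_eq_fderiv_fderiv, hD.fderiv_eq, (h1.fun_smul h2).fderiv]
  have h3 : ‖z - c‖ ^ 2 = (z - c).re ^ 2 + (z - c).im ^ 2 := by
    rw [← Complex.normSq_eq_norm_sq, Complex.normSq_apply]; ring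
  have h4 : innerSL ℝ (1 : ℂ) 1 = 1 := by simp [innerSL_apply_apply]
  have h5 : innerSL ℝ Complex.I Complex.I = 1 := by simp [innerSL_apply_apply]
  simp [Complex.inner, h4, h5]
  rw [h3]
  simp
  ring

end Laplacian

/-! ### Barriers -/

section Barriers

/-- The decay rate `2√2`. -/
def rate : ℝ := 2 * Real.sqrt 2

lemma rate_sq : rate ^ 2 = 8 := by
  rw [rate, mul_pow, Real.sq_sqrt (by norm_num)]; norm_num

lemma rate_pos : 0 < rate := by unfold rate; positivity

lemma rate_bounds : 2.8 ≤ rate ∧ rate ≤ 2.83 := by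
  have := rate_sq
  have := rate_pos
  constructor <;> nlinarith

/-- A barrier on the unit disc which is infinite on the boundary. -/
def blowUp (t : ℝ) : ℝ := Real.log 3 / 2 - Real.log (1 - t)

lemma hasDerivAt_blowUp {t : ℝ} (ht : t < 1) : HasDerivAt blowUp (1 / (1 - t)) t := by
  have h1 : HasDerivAt (fun t : ℝ => 1 - t) (-1) t := by
    simpa using (hasDerivAt_id t).const_sub 1
  have h2 := (h1.log (by linarith)).const_sub (Real.log 3 / 2)
  refine h2.congr_deriv ?_
  ring

lemma hasDerivAt_blowUp' {t : ℝ} (ht : t < 1) :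
    HasDerivAt (fun t : ℝ => 1 / (1 - t)) (1 / (1 - t) ^ 2) t := by
  have h1 : HasDerivAt (fun t : ℝ => 1 - t) (-1) t := by
    simpa using (hasDerivAt_id t).const_sub 1
  have h2 := h1.fun_inv (by linarith)
  simp only [one_div]
  refine h2.congr_deriv ?_
  simp [div_eq_mul_inv]

/-- With `e^{2 b} = c / (1 - t)^2` the value `c = 2` solves the Liouville equation `Δ b = 2 e^{2 b}`
exactly; the larger `c = 3` leaves room to absorb the term `-2 e^{-2 b}` of `4 sinh (2 b)`. -/
lemma laplacian_blowUp_lt {z c : ℂ} (h : ‖z - c‖ ^ 2 < 1) :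
    Δ (fun w : ℂ => blowUp (‖w - c‖ ^ 2)) z < 4 * Real.sinh (2 * blowUp (‖z - c‖ ^ 2)) := by
  have hev : ∀ᶠ x in 𝓝 (‖z - c‖ ^ 2), HasDerivAt blowUp (1 / (1 - x)) x := by
    filter_upwards [Iio_mem_nhds h] with x hx using hasDerivAt_blowUp hx
  rw [laplacian_radial hev (hasDerivAt_blowUp' h)]
  set t := ‖z - c‖ ^ 2 with ht
  have ht0 : 0 ≤ t := by positivity
  have hs : 0 < 1 - t := by linarith
  have he : Real.exp (2 * blowUp t) = 3 / (1 - t) ^ 2 := by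
    rw [blowUp, show 2 * (Real.log 3 / 2 - Real.log (1 - t)) =
      Real.log 3 - (Real.log (1 - t) + Real.log (1 - t)) by ring, Real.exp_sub, Real.exp_add,
      Real.exp_log (by norm_num), Real.exp_log hs, sq]
  rw [Real.sinh_eq, Real.exp_neg, he]
  have hs1 : (1 - t) ^ 2 ≤ 1 := by nlinarith
  have hs2 : 0 < (1 - t) ^ 2 := by positivity
  have h1 : 4 * t * (1 / (1 - t) ^ 2) + 4 * (1 / (1 - t)) = 4 * (1 / (1 - t) ^ 2) := by
    field_simp; ring
  have h2 : 4 * ((3 / (1 - t) ^ 2 - (3 / (1 - t) ^ 2)⁻¹) / 2) =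
      6 * (1 / (1 - t) ^ 2) - 2 * (1 - t) ^ 2 / 3 := by
    field_simp; ring
  rw [h1, h2]
  have h3 : 1 ≤ 1 / (1 - t) ^ 2 := by rw [le_div_iff₀ hs2]; linarith
  linarith

/-- A radial supersolution `e^{κ ρ} / ρ` with `ρ = √(1 + t)`, `t` the square of the radius. -/
def radialBarrier (t : ℝ) : ℝ := Real.exp (rate * Real.sqrt (1 + t)) / Real.sqrt (1 + t)

lemma hasDerivAt_sqrt_one_add {t : ℝ} (ht : -1 < t) :
    HasDerivAt (fun t : ℝ => Real.sqrt (1 + t)) (1 / (2 * Real.sqrt (1 + t))) t := by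
  simpa using ((hasDerivAt_id t).const_add 1).sqrt (by simp; linarith)

lemma hasDerivAt_radialBarrier {t : ℝ} (ht : -1 < t) :
    HasDerivAt radialBarrier (Real.exp (rate * Real.sqrt (1 + t)) *
      (rate / (2 * Real.sqrt (1 + t) ^ 2) - 1 / (2 * Real.sqrt (1 + t) ^ 3))) t := by
  have h := hasDerivAt_sqrt_one_add ht
  have hp : 0 < Real.sqrt (1 + t) := Real.sqrt_pos.2 (by linarith)
  refine (((h.const_mul rate).exp).fun_div h hp.ne').congr_deriv ?_
  field_simp

lemma hasDerivAt_radialBarrier' {t : ℝ} (ht : -1 < t) :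
    HasDerivAt (fun t => Real.exp (rate * Real.sqrt (1 + t)) *
      (rate / (2 * Real.sqrt (1 + t) ^ 2) - 1 / (2 * Real.sqrt (1 + t) ^ 3)))
      (Real.exp (rate * Real.sqrt (1 + t)) *
      (rate ^ 2 / (4 * Real.sqrt (1 + t) ^ 3) - 3 * rate / (4 * Real.sqrt (1 + t) ^ 4)
        + 3 / (4 * Real.sqrt (1 + t) ^ 5))) t := by
  have h := hasDerivAt_sqrt_one_add ht
  have hp : 0 < Real.sqrt (1 + t) := Real.sqrt_pos.2 (by linarith)
  refine (((h.const_mul rate).exp).fun_mul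
    (((hasDerivAt_const t rate).fun_div ((h.fun_pow 2).const_mul 2) (by positivity)).fun_sub
    ((hasDerivAt_const t (1 : ℝ)).fun_div ((h.fun_pow 3).const_mul 2)
      (by positivity)))).congr_deriv ?_
  field_simp
  ring

/-- Radial solutions of `Δ f = 8 f` grow like `e^{κ ρ} / √ρ`. Dividing by `ρ` instead creates a
deficit of relative order `κ / ρ` at large radius, and `ρ = √(1 + t)` keeps the function smooth at
the centre. -/
lemma laplacian_radialBarrier_le (z c : ℂ) :
    Δ (fun w : ℂ => radialBarrier (‖w - c‖ ^ 2)) z ≤ 8 * radialBarrier (‖z - c‖ ^ 2) := by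
  have h0 : -1 < ‖z - c‖ ^ 2 := by linarith [sq_nonneg ‖z - c‖]
  have hev := (eventually_gt_nhds h0).mono fun x hx => hasDerivAt_radialBarrier hx
  rw [laplacian_radial hev (hasDerivAt_radialBarrier' h0), radialBarrier]
  have ht0 : 0 ≤ ‖z - c‖ ^ 2 := by positivity
  set t := ‖z - c‖ ^ 2 with ht
  have hp : 1 ≤ Real.sqrt (1 + t) := Real.one_le_sqrt.2 (by linarith)
  have hq : t = Real.sqrt (1 + t) ^ 2 - 1 := by rw [Real.sq_sqrt (by linarith)]; ring
  set p := Real.sqrt (1 + t) with hpd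
  rw [hq]
  have hE := Real.exp_pos (rate * p)
  set E := Real.exp (rate * p)
  have hp0 : 0 < p := by linarith
  have key : 8 * (E / p) - (4 * (p ^ 2 - 1) * (E * (rate ^ 2 / (4 * p ^ 3) - 3 * rate / (4 * p ^ 4)
        + 3 / (4 * p ^ 5))) + 4 * (E * (rate / (2 * p ^ 2) - 1 / (2 * p ^ 3)))) =
      E / p ^ 5 * (7 * p ^ 2 - 3 * rate * p + rate * p ^ 3 + 3) := by
    field_simp
    linear_combination -(2 * (p ^ 2 - 1) * p ^ 2) * rate_sq
  have h2 : 0 ≤ 7 * p ^ 2 - 3 * rate * p + rate * p ^ 3 + 3 := by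
    obtain ⟨h3, h4⟩ := rate_bounds
    have h5 : 2.8 * (p ^ 2 * p) ≤ rate * (p ^ 2 * p) := by gcongr
    have h6 : rate * p ≤ 2.83 * p := by gcongr
    nlinarith [sq_nonneg (p - 1)]
  have h7 : 0 ≤ E / p ^ 5 * (7 * p ^ 2 - 3 * rate * p + rate * p ^ 3 + 3) := by positivity
  linarith

/-- The functions `r ^ α e^{-κ r}` in the variable `log r`. -/
def decay (α x : ℝ) : ℝ := Real.exp (-(rate * Real.exp x) + α * x)

lemma hasDerivAt_decay (α x : ℝ) :
    HasDerivAt (decay α) ((α - rate * Real.exp x) * decay α x) x := by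
  refine ((((Real.hasDerivAt_exp x).const_mul rate).fun_neg.fun_add
    ((hasDerivAt_id x).const_mul α)).exp).congr_deriv ?_
  simp [decay]; ring

/-- The coefficient `2 α + 1` vanishes exactly at `α = -1/2`; this is the origin of the factor `1 /
√r`. Its sign makes `α = 1` a supersolution, and `α = -3/2` one after a change of sign. -/
lemma hasDerivAt_decay' (α x : ℝ) :
    HasDerivAt (fun x => (α - rate * Real.exp x) * decay α x)
      ((8 * Real.exp x ^ 2 - (2 * α + 1) * rate * Real.exp x + α ^ 2) * decay α x) x := by
  refine ((((Real.hasDerivAt_exp x).const_mul rate).const_sub α).fun_mul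
    (hasDerivAt_decay α x)).congr_deriv ?_
  rw [← rate_sq]; ring

/-- A supersolution near a ray, in the variable `log r + i θ`. -/
def rayBarrier (θ : ℝ) (z : ℂ) : ℝ :=
  decay (-1 / 2) z.re * 1 + decay 1 z.re * (z.im - θ) ^ 6 - 20 * (decay (-3 / 2) z.re * 1)

lemma contDiff_decay (α : ℝ) : ContDiff ℝ 2 (decay α) := by unfold decay; fun_prop

lemma contDiff_decay_re (α : ℝ) : ContDiff ℝ 2 fun z : ℂ => decay α z.re :=
  (contDiff_decay α).comp Complex.reCLM.contDiff

lemma contDiff_im_sub_pow (θ : ℝ) : ContDiff ℝ 2 fun z : ℂ => (z.im - θ) ^ 6 :=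
  (Complex.imCLM.contDiff.sub contDiff_const).pow 6

lemma contDiff_rayBarrier (θ : ℝ) : ContDiff ℝ 2 (rayBarrier θ) := by
  unfold rayBarrier
  exact (((contDiff_decay_re _).mul contDiff_const).add
    ((contDiff_decay_re _).mul (contDiff_im_sub_pow θ))).sub
    (contDiff_const.mul ((contDiff_decay_re _).mul contDiff_const))

/-- Write `r = exp z.re`, `y = (z.im - θ)^2` and divide by `r^{-3/2} e^{-κ r}`. The harmful terms
are `r / 4`, from the leading term, and `30 r^{5/2} y^2`, from the angular derivatives. With `w = r
y` the latter is `30 √r w^2 ≤ √r (7 w^3 + 90)`: the cubic part is absorbed by the gain at `α = 1`,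
the constant part by the gain of order `r` at `α = -3/2`. A fourth power of the angle would leave an
error of order `r^{3/2}`, too large for that gain. -/
lemma laplacian_rayBarrier_le (θ : ℝ) {z : ℂ} (hz : 0 ≤ z.re) :
    Δ (rayBarrier θ) z ≤ 8 * Real.exp z.re ^ 2 * rayBarrier θ z := by
  have hone : ∀ᶠ x in 𝓝 z.im, HasDerivAt (fun _ : ℝ => (1 : ℝ)) ((fun _ => 0) x) x :=
    Eventually.of_forall fun x => hasDerivAt_const x 1
  have e1 := laplacian_re_mul_im (z := z)
    (Eventually.of_forall fun x => hasDerivAt_decay (-1 / 2) x) (hasDerivAt_decay' _ _)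
    hone (hasDerivAt_const _ _)
  have e3 := laplacian_re_mul_im (z := z)
    (Eventually.of_forall fun x => hasDerivAt_decay (-3 / 2) x) (hasDerivAt_decay' _ _)
    hone (hasDerivAt_const _ _)
  have hpow : ∀ x : ℝ, HasDerivAt (fun x : ℝ => (x - θ) ^ 6) (6 * (x - θ) ^ 5) x := fun x => by
    simpa using ((hasDerivAt_id x).sub_const θ).fun_pow 6
  have hpow' : HasDerivAt (fun x : ℝ => 6 * (x - θ) ^ 5) (6 * (5 * (z.im - θ) ^ 4)) z.im := by
    simpa using (((hasDerivAt_id z.im).sub_const θ).fun_pow 5).const_mul 6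
  have e2 := laplacian_re_mul_im (z := z)
    (Eventually.of_forall fun x => hasDerivAt_decay 1 x) (hasDerivAt_decay' _ _)
    (Eventually.of_forall hpow) hpow'
  have c1 : ContDiffAt ℝ 2 (fun z : ℂ => decay (-1 / 2) z.re * 1) z :=
    ((contDiff_decay_re _).mul contDiff_const).contDiffAt
  have c2 : ContDiffAt ℝ 2 (fun z : ℂ => decay 1 z.re * (z.im - θ) ^ 6) z :=
    ((contDiff_decay_re _).mul (contDiff_im_sub_pow θ)).contDiffAt
  have c3 : ContDiffAt ℝ 2 (fun z : ℂ => decay (-3 / 2) z.re * 1) z :=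
    ((contDiff_decay_re _).mul contDiff_const).contDiffAt
  have c12 : ContDiffAt ℝ 2 ((fun z : ℂ => decay (-1 / 2) z.re * 1) +
      fun z : ℂ => decay 1 z.re * (z.im - θ) ^ 6) z := c1.add c2
  have c320 : ContDiffAt ℝ 2 ((20 : ℝ) • fun z : ℂ => decay (-3 / 2) z.re * 1) z :=
    c3.const_smul (20 : ℝ)
  have hsum : Δ (rayBarrier θ) z = _ :=
    calc Δ (rayBarrier θ) z
        = Δ (((fun z : ℂ => decay (-1 / 2) z.re * 1) +
            fun z : ℂ => decay 1 z.re * (z.im - θ) ^ 6) -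
            (20 : ℝ) • fun z : ℂ => decay (-3 / 2) z.re * 1) z := rfl
      _ = _ := by
        rw [ContDiffAt.laplacian_sub c12 c320, c1.laplacian_add c2,
          InnerProductSpace.laplacian_smul _ c3, e1, e2, e3]
  rw [hsum, rayBarrier]
  set u := Real.exp (z.re / 2) with hu
  have hu1 : 1 ≤ u := Real.one_le_exp (by linarith)
  have hr : Real.exp z.re = u ^ 2 := by rw [hu, ← Real.exp_nat_mul]; congr 1; push_cast; ring
  have d1 : decay (-1 / 2) z.re = decay (-3 / 2) z.re * u ^ 2 := by
    rw [← hr, decay, decay, ← Real.exp_add]; congr 1; ring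
  have d2 : decay 1 z.re = decay (-3 / 2) z.re * u ^ 5 := by
    rw [hu, ← Real.exp_nat_mul, decay, decay, ← Real.exp_add]; congr 1; push_cast; ring
  rw [d1, d2, hr]
  have hD : 0 < decay (-3 / 2) z.re := Real.exp_pos _
  set D := decay (-3 / 2) z.re
  set y := (z.im - θ) ^ 2 with hy
  have hy0 : 0 ≤ y := sq_nonneg _
  have y6 : (z.im - θ) ^ 6 = y ^ 3 := by rw [hy]; ring
  have y4 : (z.im - θ) ^ 4 = y ^ 2 := by rw [hy]; ring
  rw [y6, y4]
  obtain ⟨k1, k2⟩ := rate_bounds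
  set w := u ^ 2 * y with hw
  have hw0 : 0 ≤ w := by positivity
  have hkey : 30 * w ^ 2 ≤ 7 * w ^ 3 + 90 := by
    nlinarith [mul_nonneg hw0 (sq_nonneg (w - 3)), sq_nonneg (w - 3)]
  have hu2 : u ≤ u ^ 2 := le_self_pow₀ hu1 two_ne_zero
  have h1 : 30 * u ^ 5 * y ^ 2 = u * (30 * w ^ 2) := by rw [hw]; ring
  have h2 : 7 * u ^ 7 * y ^ 3 = u * (7 * w ^ 3) := by rw [hw]; ring
  have h3 : 30 * u ^ 5 * y ^ 2 ≤ 7 * u ^ 7 * y ^ 3 + 90 * u ^ 2 := by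
    have := mul_le_mul_of_nonneg_left hkey (by linarith : (0 : ℝ) ≤ u)
    rw [mul_add] at this
    rw [h1, h2]; linarith
  have h5 : 2.8 * u ^ 2 ≤ rate * u ^ 2 := by gcongr
  have hu3 : 1 ≤ u ^ 2 := hu1.trans hu2
  have h4 : 7 * u ^ 7 * y ^ 3 ≤ (3 * rate * u ^ 2 - 1) * (u ^ 5 * y ^ 3) := by
    have : 7 * u ^ 2 ≤ 3 * rate * u ^ 2 - 1 := by
      rw [mul_assoc 3]; linarith
    calc 7 * u ^ 7 * y ^ 3 = 7 * u ^ 2 * (u ^ 5 * y ^ 3) := by ring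
      _ ≤ _ := by gcongr
  have h6 : u ^ 2 / 4 + 30 * u ^ 5 * y ^ 2 ≤ (3 * rate * u ^ 2 - 1) * (u ^ 5 * y ^ 3)
      + 20 * (2 * rate * u ^ 2 + 9 / 4) := by
    have h8 : 20 * (2 * rate * u ^ 2 + 9 / 4) = 40 * (rate * u ^ 2) + 45 := by ring
    linarith [sq_nonneg u]
  have h7 := mul_le_mul_of_nonneg_left h6 hD.le
  simp only [smul_eq_mul]
  linear_combination h7

end Barriers

/-! ### Solutions of the sinh-Gordon equation near infinity -/

section SinhGordon

/-- The natural coordinate near a pole, on a logarithmic covering. -/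
def endMap (a b ξ : ℂ) : ℂ := Complex.exp ξ + a * ξ + b

lemma hasDerivAt_endMap (a b ξ : ℂ) : HasDerivAt (endMap a b) (Complex.exp ξ + a) ξ := by
  have h := ((Complex.hasDerivAt_exp ξ).fun_add ((hasDerivAt_id ξ).const_mul a)).fun_add
    (hasDerivAt_const ξ b)
  exact h.congr_deriv (by simp)

lemma differentiable_endMap (a b : ℂ) : Differentiable ℂ (endMap a b) :=
  fun ξ => (hasDerivAt_endMap a b ξ).differentiableAt

lemma continuous_endMap (a b : ℂ) : Continuous (endMap a b) :=
  (differentiable_endMap a b).continuous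

lemma analyticAt_endMap (a b ξ : ℂ) : AnalyticAt ℂ (endMap a b) ξ :=
  (differentiable_endMap a b).analyticAt ξ

/-- `V` solves `Δ V = 4 sinh (2 V)` with respect to the flat metric `|d (endMap a b)|²` on the
half-plane `ℓ < Re ξ`. -/
structure IsSinhGordon (a : ℂ) (ℓ : ℝ) (V : ℂ → ℝ) : Prop where
  contDiffAt : ∀ ξ : ℂ, ℓ < ξ.re → ContDiffAt ℝ 2 V ξ
  laplacian_eq : ∀ ξ : ℂ, ℓ < ξ.re →
    Δ V ξ = ‖Complex.exp ξ + a‖ ^ 2 * (4 * Real.sinh (2 * V ξ))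

lemma IsSinhGordon.neg {a : ℂ} {ℓ : ℝ} {V : ℂ → ℝ} (h : IsSinhGordon a ℓ V) :
    IsSinhGordon a ℓ (-V) where
  contDiffAt ξ hξ := (h.contDiffAt ξ hξ).neg
  laplacian_eq ξ hξ := by
    rw [InnerProductSpace.laplacian_neg, Pi.neg_apply, h.laplacian_eq ξ hξ]
    simp [Real.sinh_neg]

lemma norm_exp_add_pos {a ξ : ℂ} (h : ‖a‖ < Real.exp ξ.re) : 0 < ‖Complex.exp ξ + a‖ := by
  rw [norm_pos_iff]
  intro h0
  rw [add_eq_zero_iff_eq_neg] at h0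
  rw [← Complex.norm_exp, h0, norm_neg] at h
  exact lt_irrefl _ h

/-- The Keller–Osserman bound. -/
lemma IsSinhGordon.le_log_three {a : ℂ} {ℓ : ℝ} {V : ℂ → ℝ} (h : IsSinhGordon a ℓ V) (b : ℂ)
    {ξ₀ : ℂ} (h1 : ℓ + 1 ≤ ξ₀.re) (h2 : 8 + 4 * ‖a‖ ≤ Real.exp ξ₀.re) :
    V ξ₀ ≤ Real.log 3 / 2 := by
  have hre : ∀ x ∈ Metric.closedBall ξ₀ (1 / 2), ξ₀.re - 1 / 2 ≤ x.re := fun x hx => by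
    have h3 := (Complex.abs_re_le_norm (x - ξ₀)).trans (mem_closedBall_iff_norm.1 hx)
    rw [Complex.sub_re] at h3
    linarith [(abs_le.1 h3).1]
  have hcV : ContinuousOn V (Metric.closedBall ξ₀ (1 / 2)) := fun x hx =>
    (h.contDiffAt x (by linarith [hre x hx])).continuousAt.continuousWithinAt
  obtain ⟨m₀, hm₀⟩ := (isCompact_closedBall ξ₀ (1 / 2)).bddAbove_image hcV
  set m := max m₀ 1 with hm
  have hVm : ∀ x ∈ Metric.closedBall ξ₀ (1 / 2), V x ≤ m := fun x hx =>
    (hm₀ (mem_image_of_mem V hx)).trans (le_max_left _ _)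
  set P := endMap a b with hP
  -- With this `s < 1` the barrier equals `log 3 / 2 + m` on the edge `‖P x - P ξ₀‖ ^ 2 = s`, which
  -- exceeds the bound `m` for `V`, while the comparison stays where the barrier is finite.
  set s := 1 - Real.exp (-m) with hs
  have hs1 : s < 1 := by have := Real.exp_pos (-m); linarith
  have hs0 : 0 < s := by
    have : Real.exp (-m) < 1 := by
      rw [Real.exp_lt_one_iff]; linarith [le_max_right m₀ 1]
    linarith
  -- The map `P` expands so strongly here that the coordinate circle of radius `1/2` lies outside
  -- the flat unit disc. The region `K` therefore never meets that circle.
  have hfar : ∀ x, ‖x - ξ₀‖ = 1 / 2 → 1 ≤ ‖P x - P ξ₀‖ ^ 2 := by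
    intro x hx
    have e1 : P x - P ξ₀ = Complex.exp ξ₀ * (Complex.exp (x - ξ₀) - 1) + a * (x - ξ₀) := by
      rw [mul_sub, ← Complex.exp_add, hP, endMap, endMap]; ring_nf
    have e2 : 1 / 4 ≤ ‖Complex.exp (x - ξ₀) - 1‖ := by
      have e3 := Complex.norm_exp_sub_one_sub_id_le (x := x - ξ₀) (by rw [hx]; norm_num)
      have e4 := norm_sub_norm_le (x - ξ₀) (-(Complex.exp (x - ξ₀) - 1 - (x - ξ₀)))
      rw [norm_neg] at e4
      have e5 : x - ξ₀ - -(Complex.exp (x - ξ₀) - 1 - (x - ξ₀)) = Complex.exp (x - ξ₀) - 1 := by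
        ring
      rw [e5] at e4
      rw [hx] at e3 e4
      norm_num at e3 e4 ⊢
      linarith
    have e6 : 1 ≤ ‖P x - P ξ₀‖ := by
      have e7 := norm_sub_norm_le (Complex.exp ξ₀ * (Complex.exp (x - ξ₀) - 1)) (-(a * (x - ξ₀)))
      rw [sub_neg_eq_add, ← e1, norm_neg, norm_mul, norm_mul, hx, Complex.norm_exp] at e7
      have e8 : Real.exp ξ₀.re * (1 / 4) ≤ Real.exp ξ₀.re * ‖Complex.exp (x - ξ₀) - 1‖ := by
        gcongr
      linarith [norm_nonneg a]
    nlinarith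
  set K := {x | x ∈ Metric.closedBall ξ₀ (1 / 2) ∧ ‖P x - P ξ₀‖ ^ 2 ≤ s} with hK
  have hPc : Continuous P := continuous_endMap a b
  have hKc : IsCompact K := (isCompact_closedBall ξ₀ (1 / 2)).inter_right
    (isClosed_le (f := fun x => ‖P x - P ξ₀‖ ^ 2) (by fun_prop) continuous_const)
  have hBc : ∀ x, ‖P x - P ξ₀‖ ^ 2 < 1 → ContDiffAt ℝ 2 (fun w => blowUp (‖w - P ξ₀‖ ^ 2)) (P x) := by
    intro x hx
    unfold blowUp
    refine contDiffAt_const.sub (ContDiffAt.log (contDiffAt_const.sub ?_) (by linarith))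
    exact (contDiffAt_id.sub contDiffAt_const).norm_sq ℝ
  have hPr : ∀ x, ContDiffAt ℝ 2 P x := fun x =>
    (analyticAt_endMap a b x).contDiffAt.restrict_scalars ℝ
  have hBc' : ∀ x ∈ K, ContDiffAt ℝ 2 (fun x => blowUp (‖P x - P ξ₀‖ ^ 2)) x := fun x hx =>
    (hBc x (hx.2.trans_lt hs1)).comp x (hPr x)
  have := le_of_laplacian_lt hKc (hcV.mono fun x hx => hx.1)
    (fun x hx => (hBc' x hx).continuousAt.continuousWithinAt)
    (B := fun x => blowUp (‖P x - P ξ₀‖ ^ 2)) ?_ ξ₀ ⟨by simp, by simpa using hs0.le⟩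
  · simpa [blowUp] using this
  intro x hx hlt
  have hlt2 : ‖P x - P ξ₀‖ ^ 2 < s := by
    refine lt_of_le_of_ne hx.2 fun heq => ?_
    rw [heq, blowUp, hs, sub_sub_cancel, Real.log_exp] at hlt
    have := hVm x hx.1
    have : 0 < Real.log 3 := Real.log_pos (by norm_num)
    linarith
  have hlt1 : ‖x - ξ₀‖ < 1 / 2 := by
    refine lt_of_le_of_ne (mem_closedBall_iff_norm.1 hx.1) fun heq => ?_
    linarith [hfar x heq]
  refine ⟨?_, h.contDiffAt x (by linarith [hre x hx.1]), hBc' x hx, ?_⟩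
  · have o1 : ∀ᶠ y in 𝓝 x, ‖y - ξ₀‖ < 1 / 2 :=
      (by fun_prop : Continuous fun y => ‖y - ξ₀‖).continuousAt.eventually_lt
        continuousAt_const hlt1
    have o2 : ∀ᶠ y in 𝓝 x, ‖P y - P ξ₀‖ ^ 2 < s :=
      (by fun_prop : Continuous fun y => ‖P y - P ξ₀‖ ^ 2).continuousAt.eventually_lt
        continuousAt_const hlt2
    filter_upwards [o1, o2] with y hy1 hy2
    exact ⟨mem_closedBall_iff_norm.2 hy1.le, hy2.le⟩
  · rw [laplacian_comp_holomorphic (f := fun w => blowUp (‖w - P ξ₀‖ ^ 2))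
      (analyticAt_endMap a b x) (hBc x (hx.2.trans_lt hs1)), (hasDerivAt_endMap a b x).deriv,
      h.laplacian_eq x (by linarith [hre x hx.1])]
    have hpos : 0 < ‖Complex.exp x + a‖ := by
      apply norm_exp_add_pos
      have e1 : Real.exp (ξ₀.re - 1 / 2) ≤ Real.exp x.re := Real.exp_le_exp.2 (hre x hx.1)
      have e2 : Real.exp ξ₀.re = Real.exp (ξ₀.re - 1 / 2) * Real.exp (1 / 2) := by
        rw [← Real.exp_add]; ring_nf
      have e3 : Real.exp (1 / 2) ≤ 2 := by
        have : Real.exp (1 / 2) ^ 2 ≤ 2 ^ 2 := by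
          rw [← Real.exp_nat_mul]
          norm_num
          linarith [Real.exp_one_lt_d9]
        nlinarith [Real.exp_pos (1 / 2)]
      have e4 : Real.exp (ξ₀.re - 1 / 2) * Real.exp (1 / 2) ≤ Real.exp (ξ₀.re - 1 / 2) * 2 := by
        gcongr
      linarith [norm_nonneg a]
    have := laplacian_blowUp_lt (hx.2.trans_lt hs1)
    have h3 : Real.sinh (2 * blowUp (‖P x - P ξ₀‖ ^ 2)) < Real.sinh (2 * V x) :=
      Real.sinh_lt_sinh.2 (by linarith)
    have h4 : 0 < ‖Complex.exp x + a‖ ^ 2 := by positivity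
    refine mul_lt_mul_of_pos_left ?_ h4
    change Δ (fun w => blowUp (‖w - P ξ₀‖ ^ 2)) (P x) < _
    linarith

/-- A positive supersolution of the linearised equation lies strictly below in Laplacian. -/
lemma IsSinhGordon.lt_laplacian {a : ℂ} {ℓ : ℝ} {V : ℂ → ℝ} (h : IsSinhGordon a ℓ V) {x : ℂ}
    (hx : ℓ < x.re) (ha : ‖a‖ < Real.exp x.re) {B : ℝ} (hB : 0 ≤ B) (hBV : B < V x) :
    ‖Complex.exp x + a‖ ^ 2 * (8 * B) < Δ V x := by
  rw [h.laplacian_eq x hx]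
  have h1 := norm_exp_add_pos ha
  have h2 : 2 * V x ≤ Real.sinh (2 * V x) := Real.self_le_sinh_iff.2 (by linarith)
  have h3 : 0 < ‖Complex.exp x + a‖ ^ 2 := by positivity
  exact mul_lt_mul_of_pos_left (by linarith) h3

/-- The relative error of the approximation `endMap a b ξ ∼ exp ξ`. -/
def endError (a b ξ : ℂ) : ℂ := (a * ξ + b) * Complex.exp (-ξ)

lemma endMap_eq (a b ξ : ℂ) : endMap a b ξ = Complex.exp ξ * (1 + endError a b ξ) := by
  rw [endMap, endError, mul_add, mul_left_comm, ← Complex.exp_add]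
  simp [add_assoc]

/-- In a strip of bounded height `a ξ + b` grows linearly in `Re ξ` and `exp (-ξ)` decays
exponentially; without a bound on `Im ξ` the first factor would be uncontrolled. -/
lemma exists_norm_endError_le (a b : ℂ) {δ : ℝ} (hδ : 0 < δ) (Y : ℝ) :
    ∃ K : ℝ, ∀ ξ : ℂ, K ≤ ξ.re → |ξ.im| ≤ Y → ‖endError a b ξ‖ ≤ δ := by
  have h1 : Tendsto (fun x : ℝ => x ^ 1 * Real.exp (-x)) atTop (𝓝 0) :=
    Real.tendsto_pow_mul_exp_neg_atTop_nhds_zero 1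
  have h2 : Tendsto (fun x : ℝ => Real.exp (-x)) atTop (𝓝 0) :=
    Real.tendsto_exp_neg_atTop_nhds_zero
  have h3 : Tendsto (fun x : ℝ => ‖a‖ * (x ^ 1 * Real.exp (-x)) +
      (‖a‖ * Y + ‖b‖) * Real.exp (-x)) atTop (𝓝 0) := by
    simpa using (h1.const_mul ‖a‖).add (h2.const_mul (‖a‖ * Y + ‖b‖))
  obtain ⟨K, hK⟩ := eventually_atTop.1 (h3.eventually (gt_mem_nhds hδ))
  refine ⟨max K 0, fun ξ h4 h5 => ?_⟩
  have h6 := hK ξ.re ((le_max_left _ _).trans h4)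
  have h7 : 0 ≤ ξ.re := (le_max_right _ _).trans h4
  refine le_trans ?_ h6.le
  rw [endError, norm_mul, Complex.norm_exp, Complex.neg_re]
  have h8 : ‖ξ‖ ≤ ξ.re + Y := by
    refine (Complex.norm_le_abs_re_add_abs_im ξ).trans ?_
    rw [abs_of_nonneg h7]; linarith
  have h9 : ‖a * ξ + b‖ ≤ ‖a‖ * (ξ.re + Y) + ‖b‖ := by
    refine (norm_add_le _ _).trans ?_
    rw [norm_mul]
    gcongr
  calc ‖a * ξ + b‖ * Real.exp (-ξ.re) ≤ (‖a‖ * (ξ.re + Y) + ‖b‖) * Real.exp (-ξ.re) := by gcongr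
    _ = _ := by ring

lemma norm_endMap_bounds {a b ξ : ℂ} (h : ‖endError a b ξ‖ ≤ 1 / 10) :
    9 / 10 * Real.exp ξ.re ≤ ‖endMap a b ξ‖ ∧ ‖endMap a b ξ‖ ≤ 11 / 10 * Real.exp ξ.re := by
  rw [endMap_eq, norm_mul, Complex.norm_exp]
  have h1 : ‖1 + endError a b ξ‖ ≤ 1 + 1 / 10 := by
    refine (norm_add_le _ _).trans ?_
    rw [norm_one]; linarith
  have h2 : 1 - 1 / 10 ≤ ‖1 + endError a b ξ‖ := by
    have := norm_sub_norm_le (1 : ℂ) (-endError a b ξ)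
    rw [norm_neg, norm_one, sub_neg_eq_add] at this
    linarith
  have := Real.exp_pos ξ.re
  constructor <;> nlinarith

/-- Points at opposite arguments are further apart than the distance to the origin. -/
lemma norm_le_norm_sub_endMap {a b ξ ξ₀ : ℂ} (h : ‖endError a b ξ‖ ≤ 1 / 10)
    (h₀ : ‖endError a b ξ₀‖ ≤ 1 / 10) (him : |ξ.im - ξ₀.im| = Real.pi) :
    ‖endMap a b ξ₀‖ ≤ ‖endMap a b ξ - endMap a b ξ₀‖ := by
  set s := Real.exp (ξ.re - ξ₀.re) with hs
  have hs0 : 0 < s := Real.exp_pos _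
  have hexp : Complex.exp ξ = -(s * Complex.exp ξ₀) := by
    have h1 : ξ = ξ₀ + ((ξ.re - ξ₀.re : ℝ) + (ξ.im - ξ₀.im : ℝ) * Complex.I) := by
      apply Complex.ext <;> simp
    have h2 : Complex.exp ((ξ.im - ξ₀.im : ℝ) * Complex.I) = -1 := by
      rcases (abs_eq Real.pi_pos.le).1 him with h | h
      · rw [h, Complex.exp_pi_mul_I]
      · rw [h, Complex.ofReal_neg, neg_mul, Complex.exp_neg, Complex.exp_pi_mul_I]; norm_num
    rw [h1, Complex.exp_add, Complex.exp_add, h2, ← Complex.ofReal_exp]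
    ring
  rw [endMap_eq, endMap_eq, hexp, show -(s * Complex.exp ξ₀) * (1 + endError a b ξ) -
    Complex.exp ξ₀ * (1 + endError a b ξ₀) =
    -(Complex.exp ξ₀ * (s * (1 + endError a b ξ) + (1 + endError a b ξ₀))) by ring,
    norm_neg, norm_mul, norm_mul]
  gcongr
  set u := endError a b ξ
  set v := endError a b ξ₀
  have hu1 := abs_le.1 ((Complex.abs_re_le_norm u).trans h)
  have hu2 := abs_le.1 ((Complex.abs_im_le_norm u).trans h)
  have hv1 := abs_le.1 ((Complex.abs_re_le_norm v).trans h₀)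
  have hv2 := abs_le.1 ((Complex.abs_im_le_norm v).trans h₀)
  -- Both factors `1 + u` and `1 + v` are close to `1`, so their real inner product is nonnegative,
  -- and adding `s (1 + u)` to `1 + v` cannot shorten it.
  have hin : 0 ≤ (1 + u.re) * (1 + v.re) + u.im * v.im := by
    have : (9 / 10) * (9 / 10) ≤ (1 + u.re) * (1 + v.re) := by
      apply mul_le_mul <;> linarith
    have : |u.im * v.im| ≤ 1 / 10 * (1 / 10) := by
      rw [abs_mul]
      exact mul_le_mul (abs_le.2 hu2) (abs_le.2 hv2) (abs_nonneg _) (by norm_num)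
    linarith [(abs_le.1 this).1]
  refine le_of_sq_le_sq ?_ (norm_nonneg _)
  rw [← Complex.normSq_eq_norm_sq, ← Complex.normSq_eq_norm_sq, Complex.normSq_apply,
    Complex.normSq_apply]
  simp only [Complex.add_re, Complex.add_im, Complex.mul_re, Complex.mul_im, Complex.ofReal_re,
    Complex.ofReal_im, Complex.one_re, Complex.one_im, zero_mul, sub_zero, add_zero, zero_add]
  nlinarith [mul_nonneg hs0.le hin, sq_nonneg (s * (1 + u.re)), sq_nonneg (s * u.im)]

end SinhGordon

section Decay

lemma contDiff_radialBarrier_norm (c : ℂ) :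
    ContDiff ℝ 2 fun w : ℂ => radialBarrier (‖w - c‖ ^ 2) := by
  have h1 : ContDiff ℝ 2 fun w : ℂ => 1 + ‖w - c‖ ^ 2 :=
    contDiff_const.add ((contDiff_id.sub contDiff_const).norm_sq ℝ)
  have h2 : ∀ w : ℂ, 1 + ‖w - c‖ ^ 2 ≠ 0 := fun w => by positivity
  have h3 := h1.sqrt h2
  exact (contDiff_const.mul h3).exp.div h3 fun w => (Real.sqrt_pos.2 (by positivity)).ne'

lemma radialBarrier_pos {t : ℝ} (ht : -1 < t) : 0 < radialBarrier t :=
  div_pos (Real.exp_pos _) (Real.sqrt_pos.2 (by linarith))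

/-- Up to a constant this is the ratio of the radial barrier at its centre to its value at distance
`d`, hence the decay gained from a disc of radius `d`. -/
lemma one_div_radialBarrier_le {d : ℝ} (hd : 0 ≤ d) :
    1 / radialBarrier (d ^ 2) ≤ (1 + d) * Real.exp (-(rate * d)) := by
  have h1 : d ≤ Real.sqrt (1 + d ^ 2) := Real.le_sqrt_of_sq_le (by linarith)
  have h2 : Real.sqrt (1 + d ^ 2) ≤ 1 + d := Real.sqrt_le_iff.2 ⟨by linarith, by nlinarith⟩
  rw [radialBarrier, one_div_div, div_eq_mul_inv, ← Real.exp_neg]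
  have := rate_pos
  gcongr

lemma laplacian_mul_comp_holomorphic_add {f : ℂ → ℝ} {P : ℂ → ℂ} {z : ℂ} (c δ : ℝ)
    (hP : AnalyticAt ℂ P z) (hf : ContDiffAt ℝ 2 f (P z)) :
    Δ (fun w => c * f (P w) + δ) z = c * (‖deriv P z‖ ^ 2 * Δ f (P z)) := by
  have h1 : ContDiffAt ℝ 2 (fun w => f (P w)) z :=
    hf.comp z (hP.contDiffAt.restrict_scalars ℝ)
  have h2 : ContDiffAt ℝ 2 (c • fun w => f (P w)) z := h1.const_smul c
  have h3 := h2.laplacian_add (contDiffAt_const (c := δ))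
  rw [InnerProductSpace.laplacian_smul c h1, InnerProductSpace.laplacian_const,
    laplacian_comp_holomorphic hP hf, Pi.zero_apply, add_zero] at h3
  exact h3

lemma contDiff_real_endMap (a b : ℂ) : ContDiff ℝ 2 (endMap a b) :=
  contDiff_iff_contDiffAt.2 fun x => (analyticAt_endMap a b x).contDiffAt.restrict_scalars ℝ

/-- Exponential decay with a rough polynomial factor. -/
lemma exists_rough_decay (a b : ℂ) (ℓ : ℝ) : ∃ K C : ℝ, 0 < C ∧ ℓ < K ∧ ‖a‖ < Real.exp K ∧
    ∀ V : ℂ → ℝ, IsSinhGordon a ℓ V → ∀ ξ : ℂ, K ≤ ξ.re →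
    (V ξ ≤ Real.log 3 / 2) ∧ (|ξ.im| ≤ 13 / 2 →
    V ξ ≤ C * (1 + ‖endMap a b ξ‖) * Real.exp (-(rate * ‖endMap a b ξ‖))) := by
  -- The comparison region reaches heights up to `13/2 + π < 10`.
  obtain ⟨K₁, hK₁⟩ := exists_norm_endError_le a b (δ := 1 / 10) (by norm_num) 10
  set K := max (max K₁ (ℓ + 1)) (Real.log (8 + 4 * ‖a‖)) with hK
  have hKexp : 8 + 4 * ‖a‖ ≤ Real.exp K := by
    rw [← Real.log_le_iff_le_exp (by positivity)]; exact le_max_right _ _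
  have hKl : ℓ + 1 ≤ K := (le_max_right _ _).trans (le_max_left _ _)
  have hK1 : K₁ ≤ K := (le_max_left _ _).trans (le_max_left _ _)
  have hM : 0 < Real.log 3 / 2 := by
    have : 0 < Real.log 3 := Real.log_pos (by norm_num)
    linarith
  set M := Real.log 3 / 2
  set R := 11 / 10 * Real.exp K with hR
  have hR0 : 0 < R := by positivity
  refine ⟨K, M * Real.exp rate * Real.exp (rate * R), by positivity, by linarith,
    by linarith [norm_nonneg a], fun V hV => ?_⟩
  have hVM : ∀ ξ : ℂ, K ≤ ξ.re → V ξ ≤ M := fun ξ hξ =>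
    hV.le_log_three b (by linarith) (hKexp.trans (Real.exp_le_exp.2 hξ))
  intro ξ₀ hξ₀
  refine ⟨hVM ξ₀ hξ₀, fun him => ?_⟩
  set P := endMap a b with hP
  set r := ‖P ξ₀‖ with hr
  have hr0 : 0 ≤ r := norm_nonneg _
  have hk := rate_pos
  -- At bounded distance the constant bound suffices, since the factor `exp (rate * R)` compensates
  -- the decay.
  rcases le_or_gt r R with hrR | hrR
  · have h1 : 1 ≤ Real.exp rate := Real.one_le_exp hk.le
    have h2 : 1 ≤ Real.exp (rate * R) * Real.exp (-(rate * r)) := by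
      rw [← Real.exp_add]; apply Real.one_le_exp; nlinarith
    calc V ξ₀ ≤ M * 1 * 1 * 1 := by simpa using hVM ξ₀ hξ₀
      _ ≤ M * Real.exp rate * (Real.exp (rate * R) * Real.exp (-(rate * r))) * (1 + r) := by
          gcongr; linarith
      _ = _ := by ring
  set d := r - R with hd
  have hd0 : 0 < d := by linarith
  have hFd := radialBarrier_pos (t := d ^ 2) (by nlinarith)
  -- The barrier is scaled to equal the universal bound `M` at flat distance `d` from the centre.
  set B : ℂ → ℝ := fun x => M / radialBarrier (d ^ 2) * radialBarrier (‖P x - P ξ₀‖ ^ 2) with hB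
  have hfac : 0 < M / radialBarrier (d ^ 2) := by positivity
  have hPc : Continuous P := continuous_endMap a b
  set T := max (Real.log (10 / 9 * (2 * r)) + 1) (ξ₀.re + 1) with hT
  have hrpos : 0 < r := by linarith
  have hTexp : 10 / 9 * (2 * r) < Real.exp T := by
    rw [← Real.log_lt_iff_lt_exp (by positivity)]
    linarith [le_max_left (Real.log (10 / 9 * (2 * r)) + 1) (ξ₀.re + 1)]
  -- The comparison is made upstairs in `ξ`, so `P` need not be injective. At distance `d` the
  -- barrier is `M`. The other edges are never met at distance less than `d`: on `Re x = K` one has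
  -- `‖P x‖ ≤ R`, so the distance is at least `r - R = d`; at angular distance `π` it is at least
  -- `r`; and `Re x = T`, present only for compactness, forces `‖P x‖ > 2 r`.
  set S := {x : ℂ | K ≤ x.re ∧ x.re ≤ T ∧ |x.im - ξ₀.im| ≤ Real.pi ∧ ‖P x - P ξ₀‖ ≤ d} with hS
  have hSc : IsCompact S := by
    refine Metric.isCompact_of_isClosed_isBounded ?_ ?_
    · exact (isClosed_le continuous_const Complex.continuous_re).inter
        ((isClosed_le Complex.continuous_re continuous_const).inter
        ((isClosed_le (f := fun x : ℂ => |x.im - ξ₀.im|)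
          (continuous_abs.comp (Complex.continuous_im.sub continuous_const)) continuous_const).inter
        (isClosed_le (f := fun x => ‖P x - P ξ₀‖) (by fun_prop) continuous_const)))
    · refine (Metric.isBounded_Icc K T |>.reProdIm
        (Metric.isBounded_Icc (ξ₀.im - Real.pi) (ξ₀.im + Real.pi))).subset fun x hx => ?_
      have h3 := abs_le.1 hx.2.2.1
      exact ⟨⟨hx.1, hx.2.1⟩, ⟨by linarith, by linarith⟩⟩
  have hpi := Real.pi_lt_d2
  have herr : ∀ x ∈ S, ‖endError a b x‖ ≤ 1 / 10 := fun x hx => by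
    refine hK₁ x (hK1.trans hx.1) ?_
    have h3 := abs_le.1 hx.2.2.1
    have h4 := abs_le.1 him
    exact abs_le.2 ⟨by linarith, by linarith⟩
  have herr₀ : ‖endError a b ξ₀‖ ≤ 1 / 10 := hK₁ ξ₀ (hK1.trans hξ₀) (by linarith)
  have hBcd : ContDiff ℝ 2 B :=
    contDiff_const.mul ((contDiff_radialBarrier_norm (P ξ₀)).comp (contDiff_real_endMap a b))
  have hVcd : ∀ x ∈ S, ContDiffAt ℝ 2 V x := fun x hx => hV.contDiffAt x (by linarith [hx.1])
  have hmem : ξ₀ ∈ S := ⟨hξ₀, by linarith [le_max_right (Real.log (10 / 9 * (2 * r)) + 1) (ξ₀.re + 1)],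
    by simpa using Real.pi_pos.le, by simpa using hd0.le⟩
  have hmain := le_of_laplacian_lt hSc
    (fun x hx => (hVcd x hx).continuousAt.continuousWithinAt) hBcd.continuous.continuousOn
    (B := B) ?_ ξ₀ hmem
  · refine hmain.trans ?_
    have e1 : B ξ₀ = M * Real.exp rate * (1 / radialBarrier (d ^ 2)) := by
      have h0 : radialBarrier 0 = Real.exp rate := by simp [radialBarrier]
      simp only [hB, sub_self, norm_zero, zero_pow two_ne_zero, h0]
      ring
    rw [e1]
    calc M * Real.exp rate * (1 / radialBarrier (d ^ 2))
        ≤ M * Real.exp rate * ((1 + d) * Real.exp (-(rate * d))) := by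
          gcongr; exact one_div_radialBarrier_le hd0.le
      _ ≤ M * Real.exp rate * ((1 + r) * Real.exp (-(rate * d))) := by
          gcongr; linarith
      _ = _ := by
          rw [hd, show -(rate * (r - R)) = rate * R + -(rate * r) by ring, Real.exp_add]; ring
  intro x hx hlt
  have hdist : ‖P x - P ξ₀‖ < d := by
    refine lt_of_le_of_ne hx.2.2.2 fun heq => ?_
    have : B x = M := by
      simp only [hB, heq]
      exact div_mul_cancel₀ _ hFd.ne'
    linarith [hVM x hx.1]
  have hre : K < x.re := by
    refine lt_of_le_of_ne hx.1 fun heq => ?_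
    have h1 := (norm_endMap_bounds (herr x hx)).2
    rw [← heq] at h1
    have h2 := norm_sub_norm_le (P ξ₀) (P x)
    rw [norm_sub_rev] at h2
    linarith
  have him' : |x.im - ξ₀.im| < Real.pi := by
    refine lt_of_le_of_ne hx.2.2.1 fun heq => ?_
    have := norm_le_norm_sub_endMap (herr x hx) herr₀ heq
    linarith
  have hreT : x.re < T := by
    refine lt_of_le_of_ne hx.2.1 fun heq => ?_
    have h1 := (norm_endMap_bounds (herr x hx)).1
    rw [heq] at h1
    have h2 := norm_sub_norm_le (P x) (P ξ₀)
    linarith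
  have hBx : 0 < B x := mul_pos hfac (radialBarrier_pos (by nlinarith [norm_nonneg (P x - P ξ₀)]))
  refine ⟨?_, hVcd x hx, hBcd.contDiffAt, ?_⟩
  · have o1 : ∀ᶠ y : ℂ in 𝓝 x, K < y.re :=
      continuousAt_const.eventually_lt Complex.continuous_re.continuousAt hre
    have o2 : ∀ᶠ y : ℂ in 𝓝 x, y.re < T :=
      Complex.continuous_re.continuousAt.eventually_lt continuousAt_const hreT
    have o3 : ∀ᶠ y : ℂ in 𝓝 x, |y.im - ξ₀.im| < Real.pi :=
      (continuous_abs.comp (Complex.continuous_im.sub continuous_const)).continuousAt.eventually_lt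
        continuousAt_const him'
    have o4 : ∀ᶠ y : ℂ in 𝓝 x, ‖P y - P ξ₀‖ < d :=
      (by fun_prop : Continuous fun y => ‖P y - P ξ₀‖).continuousAt.eventually_lt
        continuousAt_const hdist
    filter_upwards [o1, o2, o3, o4] with y h1 h2 h3 h4
    exact ⟨h1.le, h2.le, h3.le, h4.le⟩
  · have hlapB : Δ B x = M / radialBarrier (d ^ 2) * (‖Complex.exp x + a‖ ^ 2 *
        Δ (fun w => radialBarrier (‖w - P ξ₀‖ ^ 2)) (P x)) := by
      have h1 := laplacian_mul_comp_holomorphic_add (M / radialBarrier (d ^ 2)) 0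
        (analyticAt_endMap a b x) (contDiff_radialBarrier_norm (P ξ₀)).contDiffAt
      simp only [add_zero, (hasDerivAt_endMap a b x).deriv] at h1
      exact h1
    refine lt_of_le_of_lt ?_ (hV.lt_laplacian (by linarith [hx.1]) ?_ hBx.le hlt)
    · rw [hlapB]
      refine (mul_le_mul_of_nonneg_left (mul_le_mul_of_nonneg_left
        (laplacian_radialBarrier_le _ _) (sq_nonneg _)) hfac.le).trans_eq ?_
      simp only [hB]
      ring
    · have := Real.exp_le_exp.2 hx.1
      linarith [norm_nonneg a]

/-- A logarithm of `endMap`. -/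
def endLog (a b ξ : ℂ) : ℂ := ξ + Complex.log (1 + endError a b ξ)

lemma one_add_mem_slitPlane {u : ℂ} (h : ‖u‖ ≤ 1 / 10) : 1 + u ∈ Complex.slitPlane := by
  left
  have := abs_le.1 ((Complex.abs_re_le_norm u).trans h)
  simp only [Complex.add_re, Complex.one_re]
  linarith

lemma exp_endLog {a b ξ : ℂ} (h : ‖endError a b ξ‖ ≤ 1 / 10) :
    Complex.exp (endLog a b ξ) = endMap a b ξ := by
  rw [endLog, Complex.exp_add, Complex.exp_log (Complex.slitPlane_ne_zero
    (one_add_mem_slitPlane h)), endMap_eq]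

lemma exp_endLog_re {a b ξ : ℂ} (h : ‖endError a b ξ‖ ≤ 1 / 10) :
    Real.exp (endLog a b ξ).re = ‖endMap a b ξ‖ := by
  rw [← Complex.norm_exp, exp_endLog h]

lemma norm_endLog_sub_le {a b ξ : ℂ} (h : ‖endError a b ξ‖ ≤ 1 / 10) :
    ‖endLog a b ξ - ξ‖ ≤ 1 / 5 := by
  rw [endLog, add_sub_cancel_left]
  refine (Complex.norm_log_one_add_le (by linarith)).trans ?_
  have h0 := norm_nonneg (endError a b ξ)
  have h1 : (1 - ‖endError a b ξ‖)⁻¹ ≤ 2 := by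
    rw [inv_le_comm₀ (by linarith) (by norm_num)]; linarith
  have h2 : ‖endError a b ξ‖ ^ 2 * (1 - ‖endError a b ξ‖)⁻¹ ≤ (1 / 10) ^ 2 * 2 := by
    have : 0 < 1 - ‖endError a b ξ‖ := by linarith
    gcongr
  linarith

lemma analyticAt_endError (a b ξ : ℂ) : AnalyticAt ℂ (endError a b) ξ := by
  have : Differentiable ℂ (endError a b) := by unfold endError; fun_prop
  exact this.analyticAt ξ

lemma analyticAt_endLog {a b ξ : ℂ} (h : ‖endError a b ξ‖ ≤ 1 / 10) :
    AnalyticAt ℂ (endLog a b) ξ :=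
  analyticAt_id.add ((analyticAt_const.add (analyticAt_endError a b ξ)).clog
    (one_add_mem_slitPlane h))

/-- Differentiating `exp (endLog a b) = endMap a b` gives this. It matches the weight `‖exp ξ + a‖ ^
2` of the sinh-Gordon equation with the weight `r ^ 2` of the ray barrier. The strict bound makes
the identity valid near `ξ`. -/
lemma norm_deriv_endLog_mul {a b ξ : ℂ} (h : ‖endError a b ξ‖ < 1 / 10) :
    ‖deriv (endLog a b) ξ‖ * ‖endMap a b ξ‖ = ‖Complex.exp ξ + a‖ := by
  have h1 : (fun w => Complex.exp (endLog a b w)) =ᶠ[𝓝 ξ] endMap a b := by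
    have := (analyticAt_endError a b ξ).continuousAt.norm.eventually_lt continuousAt_const h
    filter_upwards [this] with w hw using exp_endLog hw.le
  have h2 := (analyticAt_endLog h.le).differentiableAt.hasDerivAt.cexp
  have h3 := h2.deriv
  rw [h1.deriv_eq, (hasDerivAt_endMap a b ξ).deriv, exp_endLog h.le] at h3
  rw [h3, norm_mul, mul_comm]

end Decay

/-! ### Comparison along a ray: the factor `1 / √r`. -/

section SharpDecay

lemma decay_add (α β x : ℝ) : decay (α + β) x = decay α x * Real.exp (β * x) := by
  rw [decay, decay, ← Real.exp_add]; ring_nf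

lemma decay_pos (α x : ℝ) : 0 < decay α x := Real.exp_pos _

/-- Once `r ≥ 40`, the subtracted term `20 r^{-3/2} e^{-κ r}` is at most half of the leading term.
-/
lemma le_rayBarrier (θ : ℝ) {z : ℂ} (hz : 40 ≤ Real.exp z.re) :
    1 / 2 * decay (-1 / 2) z.re + decay 1 z.re * (z.im - θ) ^ 6 ≤ rayBarrier θ z := by
  have h1 : decay (-1 / 2) z.re = decay (-3 / 2) z.re * Real.exp z.re := by
    rw [show (-1 / 2 : ℝ) = -3 / 2 + 1 by norm_num, decay_add, one_mul]
  have h2 := mul_le_mul_of_nonneg_left hz (decay_pos (-3 / 2) z.re).le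
  rw [rayBarrier]
  linarith

lemma rayBarrier_self_le (z : ℂ) : rayBarrier z.im z ≤ decay (-1 / 2) z.re := by
  have := decay_pos (-3 / 2) z.re
  rw [rayBarrier, sub_self]
  linarith [zero_pow (M₀ := ℝ) (n := 6) (by norm_num)]

lemma tendsto_one_add_mul_exp_neg :
    Tendsto (fun r : ℝ => (1 + r) * Real.exp (-(rate * r))) atTop (𝓝 0) := by
  have h0 : Tendsto (fun r : ℝ => rate * r) atTop atTop := tendsto_id.const_mul_atTop rate_pos
  have h1 := (Real.tendsto_exp_neg_atTop_nhds_zero).comp h0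
  have h2 := ((Real.tendsto_pow_mul_exp_neg_atTop_nhds_zero 1).comp h0).const_mul rate⁻¹
  have h3 := h1.add h2
  simp only [add_zero, mul_zero] at h3
  refine h3.congr fun r => ?_
  have := rate_pos.ne'
  simp only [Function.comp_apply, pow_one]
  field_simp

/-- Sharp decay, one-sided. -/
lemma exists_sharp_decay_le (a b : ℂ) (ℓ : ℝ) : ∃ K C : ℝ, 0 < C ∧ ∀ V : ℂ → ℝ,
    IsSinhGordon a ℓ V → ∀ ξ : ℂ, K ≤ ξ.re → |ξ.im| ≤ 4 →
    V ξ ≤ C * (Real.exp (-(rate * ‖endMap a b ξ‖)) / Real.sqrt ‖endMap a b ξ‖) := by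
  obtain ⟨K₂, C₁, hC₁, hK₂, haK₂, hrough⟩ := exists_rough_decay a b ℓ
  -- The value `1/20` provides the strict bound `< 1/10` needed to differentiate `endLog`.
  obtain ⟨K₁, hK₁⟩ := exists_norm_endError_le a b (δ := 1 / 20) (by norm_num) 10
  set K := max (max K₁ K₂) (Real.log 50) with hK
  have hK1 : K₁ ≤ K := (le_max_left _ _).trans (le_max_left _ _)
  have hK2 : K₂ ≤ K := (le_max_right _ _).trans (le_max_left _ _)
  have hKexp : 50 ≤ Real.exp K := by
    rw [← Real.log_le_iff_le_exp (by positivity)]; exact le_max_right _ _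
  have hM : 0 < Real.log 3 / 2 := by
    have : 0 < Real.log 3 := Real.log_pos (by norm_num)
    linarith
  set M := Real.log 3 / 2
  set R := 11 / 10 * Real.exp K with hR
  have hR0 : 0 < R := by positivity
  -- The two summands serve the two kinds of edge: the first makes the barrier exceed `M` on `Re x =
  -- K`, the second makes it exceed the rough bound on the sides of the sector. Each factor `2` is
  -- partly lost, to the `1/2` of `le_rayBarrier` and to `1 + r ≤ 2 r`.
  set C := 2 * M * Real.exp (rate * R + Real.log R / 2) + 2 * C₁ with hC
  have hCpos : 0 < C := by positivity
  have hk := rate_pos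
  refine ⟨K, C, hCpos, fun V hV ξ₀ hξ₀ him => ?_⟩
  have hpi := Real.pi_lt_d2
  set L := endLog a b with hL
  set P := endMap a b with hP
  have herr₀ : ‖endError a b ξ₀‖ ≤ 1 / 10 :=
    (hK₁ ξ₀ (hK1.trans hξ₀) (by linarith)).trans (by norm_num)
  set θ := (L ξ₀).im with hθ
  have hθξ : |θ - ξ₀.im| ≤ 1 / 5 := by
    have := (Complex.abs_im_le_norm (L ξ₀ - ξ₀)).trans (norm_endLog_sub_le herr₀)
    simpa using this
  have hexp0 : decay (-1 / 2) (L ξ₀).re = Real.exp (-(rate * ‖P ξ₀‖)) / Real.sqrt ‖P ξ₀‖ := by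
    rw [hP, ← exp_endLog_re herr₀, ← Real.exp_half, ← Real.exp_sub, decay]
    congr 1; ring
  rw [← hexp0]
  -- The extra `δ` controls the outer edge `Re x = T`, where the rough bound is already below `δ`;
  -- it is then sent to `0`.
  refine le_of_forall_pos_le_add fun δ hδ => ?_
  obtain ⟨r₁, hr₁⟩ := eventually_atTop.1
    ((tendsto_one_add_mul_exp_neg.const_mul C₁).eventually
      (ge_mem_nhds (show C₁ * 0 < δ by simpa using hδ)))
  set T := max (Real.log (2 * (|r₁| + 1))) (ξ₀.re + 1) with hT
  have hTexp : 2 * (|r₁| + 1) ≤ Real.exp T := by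
    rw [← Real.log_le_iff_le_exp (by positivity)]
    exact le_max_left _ _
  set S₀ := {x : ℂ | K ≤ x.re ∧ x.re ≤ T ∧ |x.im - θ| ≤ 2} with hS₀
  have hS₀c : IsCompact S₀ := by
    refine Metric.isCompact_of_isClosed_isBounded ?_ ?_
    · exact (isClosed_le continuous_const Complex.continuous_re).inter
        ((isClosed_le Complex.continuous_re continuous_const).inter
        (isClosed_le (f := fun x : ℂ => |x.im - θ|)
          (continuous_abs.comp (Complex.continuous_im.sub continuous_const)) continuous_const))
    · refine (Metric.isBounded_Icc K T |>.reProdIm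
        (Metric.isBounded_Icc (θ - 2) (θ + 2))).subset fun x hx => ?_
      have h3 := abs_le.1 hx.2.2
      exact ⟨⟨hx.1, hx.2.1⟩, ⟨by linarith, by linarith⟩⟩
  have him4 := abs_le.1 him
  have hθ4 := abs_le.1 hθξ
  -- Here `4 + 1/5 + 2 < 13/2`: the height of `ξ₀`, the shift between `ξ₀` and its `endLog`, and the
  -- half-width of `S₀`.
  have himS : ∀ x ∈ S₀, |x.im| ≤ 13 / 2 := fun x hx => by
    have h3 := abs_le.1 hx.2.2
    exact abs_le.2 ⟨by linarith, by linarith⟩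
  have herr' : ∀ x ∈ S₀, ‖endError a b x‖ < 1 / 10 := fun x hx =>
    (hK₁ x (hK1.trans hx.1) ((himS x hx).trans (by norm_num))).trans_lt (by norm_num)
  have herr : ∀ x ∈ S₀, ‖endError a b x‖ ≤ 1 / 10 := fun x hx => (herr' x hx).le
  have hLan : ∀ x ∈ S₀, AnalyticAt ℂ L x := fun x hx => analyticAt_endLog (herr x hx)
  have hLc : ContinuousOn L S₀ := fun x hx => (hLan x hx).continuousAt.continuousWithinAt
  set S := S₀ ∩ {x | |(L x).im - θ| ≤ 1} with hS
  have hSc : IsCompact S := by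
    refine hS₀c.of_isClosed_subset ?_ inter_subset_left
    have : ContinuousOn (fun x => |(L x).im - θ|) S₀ :=
      continuous_abs.comp_continuousOn
        ((Complex.continuous_im.comp_continuousOn hLc).sub continuousOn_const)
    exact this.preimage_isClosed_of_isClosed hS₀c.isClosed isClosed_Iic
  set B : ℂ → ℝ := fun x => C * rayBarrier θ (L x) + δ with hB
  have hBcd : ∀ x ∈ S₀, ContDiffAt ℝ 2 B x := fun x hx =>
    (contDiffAt_const.mul ((contDiff_rayBarrier θ).contDiffAt.comp x
      ((hLan x hx).contDiffAt.restrict_scalars ℝ))).add contDiffAt_const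
  have hVcd : ∀ x ∈ S₀, ContDiffAt ℝ 2 V x := fun x hx => hV.contDiffAt x (by linarith [hx.1])
  have hmem : ξ₀ ∈ S := by
    refine ⟨⟨hξ₀, ?_, ?_⟩, ?_⟩
    · linarith [le_max_right (Real.log (2 * (|r₁| + 1))) (ξ₀.re + 1)]
    · rw [abs_sub_comm]; linarith
    · simp [hθ]
  have hexp40 : ∀ x ∈ S₀, 40 ≤ Real.exp (L x).re := fun x hx => by
    rw [exp_endLog_re (herr x hx)]
    have := (norm_endMap_bounds (herr x hx)).1
    linarith [Real.exp_le_exp.2 hx.1]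
  have hray : ∀ x ∈ S₀, 1 / 2 * decay (-1 / 2) (L x).re +
      decay 1 (L x).re * ((L x).im - θ) ^ 6 ≤ rayBarrier θ (L x) :=
    fun x hx => le_rayBarrier θ (hexp40 x hx)
  have hmain := le_of_laplacian_lt hSc
    (fun x hx => (hVcd x hx.1).continuousAt.continuousWithinAt)
    (fun x hx => (hBcd x hx.1).continuousAt.continuousWithinAt) (B := B) ?_ ξ₀ hmem
  · refine hmain.trans ?_
    have := mul_le_mul_of_nonneg_left (rayBarrier_self_le (L ξ₀)) hCpos.le
    simp only [hB]
    rw [← hθ] at this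
    linarith
  rintro x ⟨hx, hxL⟩ hlt
  have hd1 := decay_pos (-1 / 2) (L x).re
  have hd2 := decay_pos 1 (L x).re
  have hpow : 0 ≤ decay 1 (L x).re * ((L x).im - θ) ^ 6 :=
    mul_nonneg hd2.le (by positivity)
  have hrx := hray x hx
  have hraypos : 0 < rayBarrier θ (L x) := by linarith
  have hVx := (hrough V hV x (hK2.trans hx.1)).1
  have hVx' := (hrough V hV x (hK2.trans hx.1)).2 (himS x hx)
  have hr40 := hexp40 x hx
  rw [exp_endLog_re (herr x hx)] at hr40
  -- On the sides of the sector the sixth power is `1`, so the middle term of the barrier is `r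
  -- e^{-κ r}`, comparable to the rough bound.
  have hLim : |(L x).im - θ| < 1 := by
    refine lt_of_le_of_ne hxL fun heq => ?_
    have h6 : ((L x).im - θ) ^ 6 = 1 := by
      rw [← Even.pow_abs (by decide : Even 6), heq, one_pow]
    rw [h6] at hrx
    have h7 : decay 1 (L x).re = ‖P x‖ * Real.exp (-(rate * ‖P x‖)) := by
      rw [decay, Real.exp_add, one_mul, exp_endLog_re (herr x hx), mul_comm]
    have h8 : 2 * C₁ * rayBarrier θ (L x) ≤ C * rayBarrier θ (L x) := by
      gcongr
      have : 0 < 2 * M * Real.exp (rate * R + Real.log R / 2) := by positivity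
      linarith
    have h9 : 2 * C₁ * decay 1 (L x).re ≤ 2 * C₁ * rayBarrier θ (L x) := by
      gcongr; linarith
    have h10 : C₁ * (1 + ‖P x‖) * Real.exp (-(rate * ‖P x‖)) ≤ 2 * C₁ * decay 1 (L x).re := by
      rw [h7]
      calc _ ≤ C₁ * (‖P x‖ + ‖P x‖) * Real.exp (-(rate * ‖P x‖)) := by gcongr; linarith
        _ = _ := by ring
    simp only [hB] at hlt
    linarith
  have hre : K < x.re := by
    refine lt_of_le_of_ne hx.1 fun heq => ?_
    have h1 := (norm_endMap_bounds (herr x hx)).2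
    rw [← heq] at h1
    have h2 : Real.exp (-(rate * R + Real.log R / 2)) ≤ decay (-1 / 2) (L x).re := by
      rw [decay, exp_endLog_re (herr x hx)]
      apply Real.exp_le_exp.2
      have h3 : (L x).re ≤ Real.log R := by
        rw [Real.le_log_iff_exp_le hR0, exp_endLog_re (herr x hx)]; exact h1
      have h4 : rate * ‖P x‖ ≤ rate * R := by gcongr
      linarith
    have h5 : 2 * M * Real.exp (rate * R + Real.log R / 2) * rayBarrier θ (L x) ≤
        C * rayBarrier θ (L x) := by
      gcongr; linarith
    have h6 : 2 * M * Real.exp (rate * R + Real.log R / 2) *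
        (1 / 2 * Real.exp (-(rate * R + Real.log R / 2))) ≤
        2 * M * Real.exp (rate * R + Real.log R / 2) * rayBarrier θ (L x) := by
      gcongr; linarith
    have h7 : 2 * M * Real.exp (rate * R + Real.log R / 2) *
        (1 / 2 * Real.exp (-(rate * R + Real.log R / 2))) = M := by
      rw [Real.exp_neg]
      have := (Real.exp_pos (rate * R + Real.log R / 2)).ne'
      field_simp
    simp only [hB] at hlt
    linarith
  have hreT : x.re < T := by
    refine lt_of_le_of_ne hx.2.1 fun heq => ?_
    have h1 := (norm_endMap_bounds (herr x hx)).1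
    rw [heq] at h1
    have h2 := hr₁ ‖P x‖ (by linarith [le_abs_self r₁, abs_nonneg r₁])
    have h3 : 0 < C * rayBarrier θ (L x) := mul_pos hCpos hraypos
    simp only [hB] at hlt
    linarith
  -- The argument of `endMap` differs from `x.im` by at most `1/5`, so the sector of half-width `1`
  -- stays inside the strip of half-width `2`.
  have him2 : |x.im - θ| < 2 := by
    have h1 := (Complex.abs_im_le_norm (L x - x)).trans (norm_endLog_sub_le (herr x hx))
    rw [Complex.sub_im] at h1
    have h2 := abs_le.1 h1
    have h3 := abs_lt.1 hLim
    exact abs_lt.2 ⟨by linarith, by linarith⟩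
  have hBx : 0 < B x := by have := mul_pos hCpos hraypos; simp only [hB]; linarith
  refine ⟨?_, hVcd x hx, hBcd x hx, ?_⟩
  · have o1 : ∀ᶠ y : ℂ in 𝓝 x, K < y.re :=
      continuousAt_const.eventually_lt Complex.continuous_re.continuousAt hre
    have o2 : ∀ᶠ y : ℂ in 𝓝 x, y.re < T :=
      Complex.continuous_re.continuousAt.eventually_lt continuousAt_const hreT
    have o3 : ∀ᶠ y : ℂ in 𝓝 x, |y.im - θ| < 2 :=
      (continuous_abs.comp (Complex.continuous_im.sub continuous_const)).continuousAt.eventually_lt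
        continuousAt_const him2
    have hc : ContinuousAt (fun y => |(L y).im - θ|) x :=
      continuous_abs.continuousAt.comp
        ((Complex.continuous_im.continuousAt.comp (hLan x hx).continuousAt).sub continuousAt_const)
    have o4 : ∀ᶠ y : ℂ in 𝓝 x, |(L y).im - θ| < 1 := hc.eventually_lt continuousAt_const hLim
    filter_upwards [o1, o2, o3, o4] with y h1 h2 h3 h4
    exact ⟨⟨h1.le, h2.le, h3.le⟩, h4.le⟩
  · refine lt_of_le_of_lt ?_ (hV.lt_laplacian (by linarith [hx.1]) ?_ hBx.le hlt)
    · have h1 := laplacian_mul_comp_holomorphic_add C δ (hLan x hx)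
        (contDiff_rayBarrier θ).contDiffAt
      have h2 : Δ (rayBarrier θ) (L x) ≤ 8 * ‖P x‖ ^ 2 * rayBarrier θ (L x) := by
        rw [← exp_endLog_re (herr x hx)]
        refine laplacian_rayBarrier_le θ ?_
        rw [← Real.one_le_exp_iff]
        linarith [hexp40 x hx]
      have h3 := mul_le_mul_of_nonneg_left (mul_le_mul_of_nonneg_left h2
        (sq_nonneg ‖deriv L x‖)) hCpos.le
      have h4 := norm_deriv_endLog_mul (herr' x hx)
      rw [← h4]
      have h5 : 0 ≤ (‖deriv L x‖ * ‖P x‖) ^ 2 * (8 * δ) := by positivity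
      calc Δ B x = _ := h1
        _ ≤ _ := h3
        _ ≤ _ := by simp only [hB]; linarith
    · have := Real.exp_le_exp.2 (hK2.trans hx.1)
      linarith

/-- Sharp decay of solutions of the sinh-Gordon equation near infinity. -/
lemma exists_sharp_decay (a b : ℂ) (ℓ : ℝ) : ∃ K C : ℝ, 0 < C ∧ ∀ V : ℂ → ℝ,
    IsSinhGordon a ℓ V → ∀ ξ : ℂ, K ≤ ξ.re → |ξ.im| ≤ 4 →
    |V ξ| ≤ C * (Real.exp (-(rate * ‖endMap a b ξ‖)) / Real.sqrt ‖endMap a b ξ‖) := by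
  obtain ⟨K, C, hC, h⟩ := exists_sharp_decay_le a b ℓ
  exact ⟨K, C, hC, fun V hV ξ h1 h2 => abs_le'.2 ⟨h V hV ξ h1 h2, h (-V) hV.neg ξ h1 h2⟩⟩

end SharpDecay

/-! ### The Gauss equation -/

section Gauss

lemma adsForm_comm (x y : Fin 4 → ℝ) : adsForm x y = adsForm y x := by
  unfold adsForm; ring

lemma adsForm_add_left (x y z : Fin 4 → ℝ) : adsForm (x + y) z = adsForm x z + adsForm y z := by
  simp only [adsForm, Pi.add_apply]; ring

lemma adsForm_add_right (x y z : Fin 4 → ℝ) : adsForm x (y + z) = adsForm x y + adsForm x z := by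
  simp only [adsForm, Pi.add_apply]; ring

lemma adsForm_eq_matrix (x y : Fin 4 → ℝ) :
    adsForm x y = x ⬝ᵥ (Matrix.diagonal ![1, 1, -1, -1]).mulVec y := by
  simp [adsForm, dotProduct, Fin.sum_univ_four, Matrix.mulVec_diagonal]
  ring

/-- Expansion of the form in an orthogonal frame. -/
lemma adsForm_frame {e₁ e₂ e₃ e₄ : Fin 4 → ℝ} {E : ℝ} (hE : E ≠ 0)
    (h11 : adsForm e₁ e₁ = E) (h22 : adsForm e₂ e₂ = E) (h33 : adsForm e₃ e₃ = -1)
    (h44 : adsForm e₄ e₄ = -1) (h12 : adsForm e₁ e₂ = 0) (h13 : adsForm e₁ e₃ = 0)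
    (h14 : adsForm e₁ e₄ = 0) (h23 : adsForm e₂ e₃ = 0) (h24 : adsForm e₂ e₄ = 0)
    (h34 : adsForm e₃ e₄ = 0) (a b : Fin 4 → ℝ) :
    adsForm a b = (adsForm a e₁ * adsForm b e₁ + adsForm a e₂ * adsForm b e₂) / E
      - adsForm a e₃ * adsForm b e₃ - adsForm a e₄ * adsForm b e₄ := by
  set G : Matrix (Fin 4) (Fin 4) ℝ := Matrix.diagonal ![1, 1, -1, -1] with hG
  set M : Matrix (Fin 4) (Fin 4) ℝ := Matrix.of ![e₁, e₂, e₃, e₄] with hM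
  set D : Matrix (Fin 4) (Fin 4) ℝ := Matrix.diagonal ![1 / E, 1 / E, -1, -1] with hD
  have m0 : M 0 = e₁ := rfl
  have m1 : M 1 = e₂ := rfl
  have m2 : M 2 = e₃ := rfl
  have m3 : M 3 = e₄ := rfl
  have h1 : M * (G * M.transpose * D) = 1 := by
    have h21 := adsForm_comm e₂ e₁
    have h31 := adsForm_comm e₃ e₁
    have h41 := adsForm_comm e₄ e₁
    have h32 := adsForm_comm e₃ e₂
    have h42 := adsForm_comm e₄ e₂
    have h43 := adsForm_comm e₄ e₃
    have h2 : ∀ i j, (M * (G * M.transpose * D)) i j =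
        adsForm (M i) (M j) * ![1 / E, 1 / E, -1, -1] j := by
      intro i j
      rw [← Matrix.mul_assoc, hD, Matrix.mul_diagonal, adsForm_eq_matrix]
      rfl
    ext i j
    rw [h2]
    fin_cases i <;> fin_cases j <;>
      simp [m0, m1, m2, m3, h11, h12, h13, h14, h21, h22, h23, h24, h31, h32, h33, h34, h41, h42,
        h43, h44, hE]
  -- For square matrices a right inverse is a left inverse; this turns orthogonality of the frame
  -- into its completeness.
  have h3 : G * M.transpose * D * M = 1 := mul_eq_one_comm.1 h1
  have h4 : adsForm a b = a ⬝ᵥ (G * M.transpose * D * M).mulVec (G.mulVec b) := by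
    rw [h3, Matrix.one_mulVec, adsForm_eq_matrix]
  have h5 : a ⬝ᵥ (G * M.transpose * D * M).mulVec (G.mulVec b) =
      (M.mulVec (G.mulVec a)) ⬝ᵥ (D.mulVec (M.mulVec (G.mulVec b))) := by
    rw [← Matrix.mulVec_mulVec, ← Matrix.mulVec_mulVec, ← Matrix.mulVec_mulVec,
      Matrix.dotProduct_mulVec, ← Matrix.mulVec_transpose, Matrix.dotProduct_mulVec,
      ← Matrix.mulVec_transpose, Matrix.transpose_transpose, hG, Matrix.diagonal_transpose]
  have h6 : ∀ c i, M.mulVec (G.mulVec c) i = adsForm c (M i) := fun c i => by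
    rw [adsForm_comm, adsForm_eq_matrix]; rfl
  rw [h4, h5, dotProduct, Fin.sum_univ_four]
  simp only [hD, Matrix.mulVec_diagonal, h6]
  simp [m0, m1, m2, m3]
  ring

variable {F : Type*} [NormedAddCommGroup F] [NormedSpace ℝ F] {U : Set ℂ}

/-- The derivative in the direction `v`. -/
def dirDeriv (v : ℂ) (f : ℂ → F) (z : ℂ) : F := fderiv ℝ f z v

lemma contDiffOn_dirDeriv (hU : IsOpen U) {f : ℂ → F} (hf : ContDiffOn ℝ ∞ f U) (v : ℂ) :
    ContDiffOn ℝ ∞ (dirDeriv v f) U :=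
  (hf.fderiv_of_isOpen hU (m := ∞) (by simp)).clm_apply contDiffOn_const

lemma differentiableAt_of_contDiffOn (hU : IsOpen U) {f : ℂ → F} (hf : ContDiffOn ℝ ∞ f U) {z : ℂ}
    (hz : z ∈ U) : DifferentiableAt ℝ f z :=
  (hf.contDiffAt (hU.mem_nhds hz)).differentiableAt (by simp)

lemma dirDeriv_dirDeriv (hU : IsOpen U) {f : ℂ → F} (hf : ContDiffOn ℝ ∞ f U) {z : ℂ}
    (hz : z ∈ U) (v w : ℂ) : dirDeriv v (dirDeriv w f) z = fderiv ℝ (fderiv ℝ f) z v w := by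
  have h1 : DifferentiableAt ℝ (fderiv ℝ f) z :=
    ((hf.fderiv_of_isOpen hU (m := ∞) (by simp)).contDiffAt (hU.mem_nhds hz)).differentiableAt
      (by simp)
  have h2 := (h1.hasFDerivAt.clm_apply (hasFDerivAt_const w z)).fderiv
  change fderiv ℝ (fun z => fderiv ℝ f z w) z v = _
  rw [h2]
  simp

lemma dirDeriv_comm (hU : IsOpen U) {f : ℂ → F} (hf : ContDiffOn ℝ ∞ f U) {z : ℂ}
    (hz : z ∈ U) (v w : ℂ) : dirDeriv v (dirDeriv w f) z = dirDeriv w (dirDeriv v f) z := by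
  rw [dirDeriv_dirDeriv hU hf hz, dirDeriv_dirDeriv hU hf hz]
  refine ((hf.contDiffAt (hU.mem_nhds hz)).isSymmSndFDerivAt ?_).eq v w
  simp only [minSmoothness_of_isRCLikeNormedField]
  norm_cast

lemma dirDeriv_congr (hU : IsOpen U) {f g : ℂ → F} (h : EqOn f g U) {z : ℂ} (hz : z ∈ U) (v : ℂ) :
    dirDeriv v f z = dirDeriv v g z := by
  rw [dirDeriv, dirDeriv, (h.eventuallyEq_of_mem (hU.mem_nhds hz)).fderiv_eq]

lemma hasFDerivAt_adsForm {f g : ℂ → Fin 4 → ℝ} {z : ℂ} (hf : DifferentiableAt ℝ f z)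
    (hg : DifferentiableAt ℝ g z) (v : ℂ) :
    dirDeriv v (fun z => adsForm (f z) (g z)) z =
      adsForm (dirDeriv v f z) (g z) + adsForm (f z) (dirDeriv v g z) := by
  have hf' := fun i => hasFDerivAt_pi'.1 hf.hasFDerivAt i
  have hg' := fun i => hasFDerivAt_pi'.1 hg.hasFDerivAt i
  have h := (((((hf' 0).fun_mul (hg' 0)).fun_add ((hf' 1).fun_mul (hg' 1))).fun_sub
    ((hf' 2).fun_mul (hg' 2))).fun_sub ((hf' 3).fun_mul (hg' 3))).fderiv
  simp only [dirDeriv, adsForm]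
  rw [h]
  simp
  ring

lemma contDiffOn_adsForm {f g : ℂ → Fin 4 → ℝ} (hf : ContDiffOn ℝ ∞ f U)
    (hg : ContDiffOn ℝ ∞ g U) : ContDiffOn ℝ ∞ (fun z => adsForm (f z) (g z)) U := by
  have hf' := fun i => contDiffOn_pi.1 hf i
  have hg' := fun i => contDiffOn_pi.1 hg i
  exact ((((hf' 0).mul (hg' 0)).add ((hf' 1).mul (hg' 1))).sub
    ((hf' 2).mul (hg' 2))).sub ((hf' 3).mul (hg' 3))

lemma laplacian_eq_dirDeriv (hU : IsOpen U) {f : ℂ → ℝ} (hf : ContDiffOn ℝ ∞ f U) {z : ℂ}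
    (hz : z ∈ U) : Δ f z = dirDeriv 1 (dirDeriv 1 f) z +
      dirDeriv Complex.I (dirDeriv Complex.I f) z := by
  rw [laplacian_eq_fderiv_fderiv, dirDeriv_dirDeriv hU hf hz, dirDeriv_dirDeriv hU hf hz]

lemma laplacian_log (hU : IsOpen U) {f : ℂ → ℝ} (hf : ContDiffOn ℝ ∞ f U)
    (hpos : ∀ z ∈ U, 0 < f z) {z : ℂ} (hz : z ∈ U) :
    Δ (fun z => Real.log (f z)) z = (f z * Δ f z -
      (dirDeriv 1 f z ^ 2 + dirDeriv Complex.I f z ^ 2)) / f z ^ 2 := by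
  have hlog : ContDiffOn ℝ ∞ (fun z => Real.log (f z)) U := hf.log fun z hz => (hpos z hz).ne'
  have h1 : ∀ v, EqOn (dirDeriv v fun z => Real.log (f z)) (fun z => dirDeriv v f z / f z) U := by
    intro v w hw
    have := ((differentiableAt_of_contDiffOn hU hf hw).hasFDerivAt.log (hpos w hw).ne').fderiv
    simp only [dirDeriv]
    rw [this]
    simp [div_eq_inv_mul]
  have h2 : ∀ v, dirDeriv v (dirDeriv v fun z => Real.log (f z)) z =
      (f z * dirDeriv v (dirDeriv v f) z - dirDeriv v f z ^ 2) / f z ^ 2 := by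
    intro v
    rw [dirDeriv_congr hU (h1 v) hz]
    have e1 := (differentiableAt_of_contDiffOn hU (contDiffOn_dirDeriv hU hf v) hz).hasFDerivAt
    have e2 := (differentiableAt_of_contDiffOn hU hf hz).hasFDerivAt
    have e3 := (e1.fun_mul ((hasDerivAt_inv (hpos z hz).ne').comp_hasFDerivAt z e2)).fderiv
    have e4 : dirDeriv v (fun z => dirDeriv v f z / f z) z =
        fderiv ℝ (fun z => dirDeriv v f z * (Inv.inv ∘ f) z) z v := rfl
    rw [e4, e3]
    have := (hpos z hz).ne'
    simp only [dirDeriv, smul_apply, add_apply, smul_eq_mul, Function.comp_apply]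
    field_simp
    ring
  rw [laplacian_eq_dirDeriv hU hlog hz, laplacian_eq_dirDeriv hU hf hz, h2, h2]
  ring

/-- The Gauss equation for a space-like maximal conformal immersion into the quadric, with
second fundamental form `Re (2 φ dz²)`. -/
lemma gauss_equation (hU : IsOpen U) {σ ν : ℂ → Fin 4 → ℝ} (hσ : ContDiffOn ℝ ∞ σ U)
    (hν : ContDiffOn ℝ ∞ ν U) {E : ℂ → ℝ} {φ : ℂ → ℂ} (hE : ∀ z ∈ U, 0 < E z)
    (hσσ : ∀ z ∈ U, adsForm (σ z) (σ z) = -1) (hνν : ∀ z ∈ U, adsForm (ν z) (ν z) = -1)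
    (hνσ : ∀ z ∈ U, adsForm (ν z) (σ z) = 0)
    (hνD : ∀ z ∈ U, ∀ v, adsForm (ν z) (dirDeriv v σ z) = 0)
    (hmet : ∀ z ∈ U, ∀ v : ℂ,
      adsForm (dirDeriv v σ z) (dirDeriv v σ z) = ‖v‖ ^ 2 * E z)
    (hII : ∀ z ∈ U, ∀ v : ℂ,
      adsForm (dirDeriv v ν z) (dirDeriv v σ z) = (2 * (φ z * v ^ 2)).re) {z : ℂ} (hz : z ∈ U) :
    ContDiffAt ℝ 2 (fun z => Real.log (E z)) z ∧
    Δ (fun z => Real.log (E z)) z = 2 * E z - 8 * ‖φ z‖ ^ 2 / E z := by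
  set X := dirDeriv 1 σ with hX
  set Y := dirDeriv Complex.I σ with hY
  have cX : ContDiffOn ℝ ∞ X U := contDiffOn_dirDeriv hU hσ 1
  have cY : ContDiffOn ℝ ∞ Y U := contDiffOn_dirDeriv hU hσ Complex.I
  set XX := dirDeriv 1 X
  set XY := dirDeriv Complex.I X
  set YY := dirDeriv Complex.I Y
  have cXX : ContDiffOn ℝ ∞ XX U := contDiffOn_dirDeriv hU cX 1
  have cXY : ContDiffOn ℝ ∞ XY U := contDiffOn_dirDeriv hU cX Complex.I
  have hYX : EqOn (dirDeriv 1 Y) XY U := fun w hw => dirDeriv_comm hU hσ hw _ _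
  have dσ : ∀ w ∈ U, DifferentiableAt ℝ σ w := fun w => differentiableAt_of_contDiffOn hU hσ
  have dν : ∀ w ∈ U, DifferentiableAt ℝ ν w := fun w => differentiableAt_of_contDiffOn hU hν
  have dX : ∀ w ∈ U, DifferentiableAt ℝ X w := fun w => differentiableAt_of_contDiffOn hU cX
  have dY : ∀ w ∈ U, DifferentiableAt ℝ Y w := fun w => differentiableAt_of_contDiffOn hU cY
  have dXX : ∀ w ∈ U, DifferentiableAt ℝ XX w := fun w => differentiableAt_of_contDiffOn hU cXX
  have dXY : ∀ w ∈ U, DifferentiableAt ℝ XY w := fun w => differentiableAt_of_contDiffOn hU cXY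
  have dconst : ∀ (f : ℂ → ℝ) (c : ℝ), (∀ w ∈ U, f w = c) → ∀ w ∈ U, ∀ v, dirDeriv v f w = 0 := by
    intro f c h w hw v
    rw [dirDeriv_congr hU (g := fun _ => c) h hw, dirDeriv, fderiv_fun_const]
    rfl
  have hXXE : ∀ w ∈ U, adsForm (X w) (X w) = E w := fun w hw => by simpa using hmet w hw 1
  have hYYE : ∀ w ∈ U, adsForm (Y w) (Y w) = E w := fun w hw => by simpa using hmet w hw Complex.I
  have dir_add : ∀ (f : ℂ → Fin 4 → ℝ) (w : ℂ), dirDeriv (1 + Complex.I) f w =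
      dirDeriv 1 f w + dirDeriv Complex.I f w := fun f w => by simp [dirDeriv]
  have hn : ‖(1 + Complex.I : ℂ)‖ ^ 2 = 2 := by
    rw [← Complex.normSq_eq_norm_sq, Complex.normSq_apply]; norm_num
  have hXYE : ∀ w ∈ U, adsForm (X w) (Y w) = 0 := fun w hw => by
    have h1 := hmet w hw (1 + Complex.I)
    rw [dir_add, hn, adsForm_add_left, adsForm_add_right, adsForm_add_right] at h1
    have h2 := adsForm_comm (dirDeriv Complex.I σ w) (dirDeriv 1 σ w)
    linarith [hXXE w hw, hYYE w hw]
  have hσX : ∀ w ∈ U, adsForm (X w) (σ w) = 0 := fun w hw => by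
    have h1 := dconst _ _ hσσ w hw 1
    rw [hasFDerivAt_adsForm (dσ w hw) (dσ w hw), adsForm_comm (σ w)] at h1
    linarith
  have hσY : ∀ w ∈ U, adsForm (Y w) (σ w) = 0 := fun w hw => by
    have h1 := dconst _ _ hσσ w hw Complex.I
    rw [hasFDerivAt_adsForm (dσ w hw) (dσ w hw), adsForm_comm (σ w)] at h1
    linarith
  -- position components
  have p1 := dconst _ _ hσX z hz 1
  rw [hasFDerivAt_adsForm (dX z hz) (dσ z hz)] at p1
  have p2 := dconst _ _ hσX z hz Complex.I
  rw [hasFDerivAt_adsForm (dX z hz) (dσ z hz)] at p2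
  have p3 := dconst _ _ hσY z hz Complex.I
  rw [hasFDerivAt_adsForm (dY z hz) (dσ z hz)] at p3
  -- normal components
  have n1 := dconst _ _ (fun w hw => hνD w hw 1) z hz 1
  rw [hasFDerivAt_adsForm (dν z hz) (dX z hz)] at n1
  have n2 := dconst _ _ (fun w hw => hνD w hw 1) z hz Complex.I
  rw [hasFDerivAt_adsForm (dν z hz) (dX z hz)] at n2
  have n3 := dconst _ _ (fun w hw => hνD w hw Complex.I) z hz 1
  rw [hasFDerivAt_adsForm (dν z hz) (dY z hz), hYX hz] at n3
  have n4 := dconst _ _ (fun w hw => hνD w hw Complex.I) z hz Complex.I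
  rw [hasFDerivAt_adsForm (dν z hz) (dY z hz)] at n4
  have i1 := hII z hz 1
  have i2 := hII z hz Complex.I
  -- Polarisation: the value at `1 + I` supplies the mixed component, both mixed entries being `-⟨ν,
  -- XY⟩` by `n2` and `n3`.
  have i3 := hII z hz (1 + Complex.I)
  rw [dir_add, dir_add, adsForm_add_left, adsForm_add_right, adsForm_add_right] at i3
  have s1 : ((1 + Complex.I) ^ 2 : ℂ) = 2 * Complex.I := by
    linear_combination Complex.I_sq
  rw [s1] at i3
  simp at i1 i2 i3
  -- tangential components
  have eE : ∀ v, ∀ w ∈ U, dirDeriv v E w = 2 * adsForm (dirDeriv v X w) (X w) := fun v w hw => by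
    have h1 := hasFDerivAt_adsForm (dX w hw) (dX w hw) v
    rw [dirDeriv_congr hU (g := E) hXXE hw, adsForm_comm (X w)] at h1
    linarith
  have eE' : ∀ v, ∀ w ∈ U, dirDeriv v E w = 2 * adsForm (dirDeriv v Y w) (Y w) := fun v w hw => by
    have h1 := hasFDerivAt_adsForm (dY w hw) (dY w hw) v
    rw [dirDeriv_congr hU (g := E) hYYE hw, adsForm_comm (Y w)] at h1
    linarith
  have t1 : ∀ w ∈ U, adsForm (XX w) (Y w) + adsForm (X w) (XY w) = 0 := fun w hw => by
    have h1 := dconst _ _ hXYE w hw 1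
    rwa [hasFDerivAt_adsForm (dX w hw) (dY w hw), hYX hw] at h1
  have t2 : ∀ w ∈ U, adsForm (XY w) (Y w) + adsForm (X w) (YY w) = 0 := fun w hw => by
    have h1 := dconst _ _ hXYE w hw Complex.I
    rwa [hasFDerivAt_adsForm (dX w hw) (dY w hw)] at h1
  -- Differentiating `⟨X, Y⟩ = 0` twice expresses the sum of third-derivative terms through second
  -- derivatives. Computing `∂₁²E` from `⟨Y, Y⟩` and `∂_I²E` from `⟨X, X⟩` in `q1`, `q2` produces
  -- exactly that sum, so `Δ E = 2 (⟨XY, XY⟩ - ⟨XX, YY⟩)`, which the frame expansion evaluates.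
  have t3 := dconst _ _ t1 z hz Complex.I
  have dA1 : DifferentiableAt ℝ (fun w => adsForm (XX w) (Y w)) z :=
    differentiableAt_of_contDiffOn hU (contDiffOn_adsForm cXX cY) hz
  have dA2 : DifferentiableAt ℝ (fun w => adsForm (X w) (XY w)) z :=
    differentiableAt_of_contDiffOn hU (contDiffOn_adsForm cX cXY) hz
  have t3' : dirDeriv Complex.I (fun w => adsForm (XX w) (Y w) + adsForm (X w) (XY w)) z =
      dirDeriv Complex.I (fun w => adsForm (XX w) (Y w)) z +
      dirDeriv Complex.I (fun w => adsForm (X w) (XY w)) z := by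
    simp only [dirDeriv]
    rw [(dA1.hasFDerivAt.fun_add dA2.hasFDerivAt).fderiv]
    rfl
  rw [t3', hasFDerivAt_adsForm (dXX z hz) (dY z hz), hasFDerivAt_adsForm (dX z hz) (dXY z hz),
    dirDeriv_comm hU cX hz] at t3
  have cE : ContDiffOn ℝ ∞ E U := (contDiffOn_adsForm cX cX).congr fun w hw => (hXXE w hw).symm
  have two_mul_dir : ∀ (f : ℂ → ℝ) (v : ℂ), DifferentiableAt ℝ f z →
      dirDeriv v (fun w => 2 * f w) z = 2 * dirDeriv v f z := fun f v hf => by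
    simp only [dirDeriv]
    rw [(hf.hasFDerivAt.const_mul 2).fderiv]
    rfl
  have q1 : dirDeriv 1 (dirDeriv 1 E) z =
      2 * (adsForm (dirDeriv 1 XY z) (Y z) + adsForm (XY z) (XY z)) := by
    have h1 : EqOn (dirDeriv 1 E) (fun w => 2 * adsForm (XY w) (Y w)) U := fun w hw => by
      rw [eE' 1 w hw, hYX hw]
    rw [dirDeriv_congr hU h1 hz, two_mul_dir _ _ (differentiableAt_of_contDiffOn hU
      (contDiffOn_adsForm cXY cY) hz), hasFDerivAt_adsForm (dXY z hz) (dY z hz), hYX hz]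
  have q2 : dirDeriv Complex.I (dirDeriv Complex.I E) z =
      2 * (adsForm (dirDeriv Complex.I XY z) (X z) + adsForm (XY z) (XY z)) := by
    have h1 : EqOn (dirDeriv Complex.I E) (fun w => 2 * adsForm (XY w) (X w)) U :=
      fun w hw => eE Complex.I w hw
    rw [dirDeriv_congr hU h1 hz, two_mul_dir _ _ (differentiableAt_of_contDiffOn hU
      (contDiffOn_adsForm cXY cX) hz), hasFDerivAt_adsForm (dXY z hz) (dX z hz)]
  have hEz := (hE z hz).ne'
  have frame := adsForm_frame hEz (hXXE z hz) (hYYE z hz) (hσσ z hz) (hνν z hz) (hXYE z hz)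
    (hσX z hz) (by rw [adsForm_comm]; exact hνD z hz 1) (hσY z hz)
    (by rw [adsForm_comm]; exact hνD z hz Complex.I) (by rw [adsForm_comm]; exact hνσ z hz)
  have f1 := frame (XX z) (YY z)
  have f2 := frame (XY z) (XY z)
  have ex1 := eE 1 z hz
  have ex2 := eE' 1 z hz
  have ey1 := eE Complex.I z hz
  have ey2 := eE' Complex.I z hz
  rw [hYX hz] at ex2
  have t1z := t1 z hz
  have t2z := t2 z hz
  rw [adsForm_comm (X z)] at t1z t2z
  refine ⟨((cE.contDiffAt (hU.mem_nhds hz)).log hEz).of_le (by norm_cast), ?_⟩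
  rw [laplacian_log hU cE hE hz, laplacian_eq_dirDeriv hU cE hz, q1, q2]
  have hφ : ‖φ z‖ ^ 2 = (φ z).re ^ 2 + (φ z).im ^ 2 := by
    rw [← Complex.normSq_eq_norm_sq, Complex.normSq_apply]; ring
  rw [hφ]
  have a1 : adsForm (XX z) (X z) = dirDeriv 1 E z / 2 := by linarith
  have a2 : adsForm (XX z) (Y z) = -(dirDeriv Complex.I E z / 2) := by linarith
  have a3 : adsForm (YY z) (X z) = -(dirDeriv 1 E z / 2) := by linarith
  have a4 : adsForm (YY z) (Y z) = dirDeriv Complex.I E z / 2 := by linarith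
  have a5 : adsForm (XY z) (X z) = dirDeriv Complex.I E z / 2 := by linarith
  have a6 : adsForm (XY z) (Y z) = dirDeriv 1 E z / 2 := by linarith
  have b1 : adsForm (XX z) (σ z) = -E z := by linarith [hXXE z hz]
  have b2 : adsForm (YY z) (σ z) = -E z := by linarith [hYYE z hz]
  have b3 : adsForm (XY z) (σ z) = 0 := by
    linarith [hXYE z hz, adsForm_comm (X z) (Y z)]
  have c1 : adsForm (XX z) (ν z) = -(2 * (φ z).re) := by
    rw [adsForm_comm]; linarith
  have c2 : adsForm (YY z) (ν z) = 2 * (φ z).re := by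
    rw [adsForm_comm]; linarith
  have c3 : adsForm (XY z) (ν z) = 2 * (φ z).im := by
    rw [adsForm_comm]; linarith
  rw [a1, a2, a3, a4, b1, b2, c1, c2] at f1
  rw [a5, a6, b3, c3] at f2
  have hA : adsForm (dirDeriv 1 XY z) (Y z) = -adsForm (XX z) (YY z) - adsForm (XY z) (XY z)
      - adsForm (dirDeriv Complex.I XY z) (X z) := by
    rw [adsForm_comm (X z)] at t3
    linarith
  rw [hA, f1, f2]
  field_simp
  ring

end Gauss

/-! ### Lifting and natural coordinates -/

section Lifting

lemma exists_lift {A B : Type*} [TopologicalSpace A] [TopologicalSpace B] {p : A → B} {s : Set B}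
    (hp : IsCoveringMapOn p s) {U : Set ℂ} (hU : IsOpen U) (hconv : Convex ℝ U) {f : ℂ → B}
    (hf : ContinuousOn f U) (hfs : ∀ z ∈ U, f z ∈ s) {z₀ : ℂ} (hz₀ : z₀ ∈ U) {e₀ : A}
    (he₀ : p e₀ = f z₀) :
    ∃ F : ℂ → A, ContinuousOn F U ∧ F z₀ = e₀ ∧ ∀ z ∈ U, p (F z) = f z := by
  classical
  have : ContractibleSpace U := hconv.contractibleSpace ⟨z₀, hz₀⟩
  have : LocallyPathConnectedSpace U := hU.locallyPathConnectedSpace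
  obtain ⟨F, ⟨hF1, hF2⟩, -⟩ := hp.existsUnique_continuousMap_lifts
    ⟨U.domRestrict f, hf.domRestrict⟩ (a₀ := ⟨z₀, hz₀⟩) he₀ fun a => hfs a a.2
  -- Outside `U` the lift takes the arbitrary value `e₀`.
  refine ⟨fun z => if h : z ∈ U then F ⟨z, h⟩ else e₀, ?_, ?_, ?_⟩
  · rw [continuousOn_iff_continuous_domRestrict]
    convert F.continuous using 1
    ext z
    simp
  · simp [hz₀, hF1]
  · intro z hz
    simp only [hz, dite_true]
    exact congrFun hF2 ⟨z, hz⟩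

lemma eqOn_of_lift {A B : Type*} [TopologicalSpace A] [TopologicalSpace B] {p : A → B} {s : Set B}
    (hp : IsCoveringMapOn p s) {U : Set ℂ} (hU : IsOpen U) (hconv : Convex ℝ U) {f : ℂ → B}
    (hfs : ∀ z ∈ U, f z ∈ s) (hf : ContinuousOn f U) {z₀ : ℂ} (hz₀ : z₀ ∈ U) {F G : ℂ → A}
    (hF : ContinuousOn F U) (hG : ContinuousOn G U) (hpF : ∀ z ∈ U, p (F z) = f z)
    (hpG : ∀ z ∈ U, p (G z) = f z) (h₀ : F z₀ = G z₀) : EqOn F G U := by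
  have : ContractibleSpace U := hconv.contractibleSpace ⟨z₀, hz₀⟩
  have : LocallyPathConnectedSpace U := hU.locallyPathConnectedSpace
  obtain ⟨L, -, hL⟩ := hp.existsUnique_continuousMap_lifts
    ⟨U.domRestrict f, hf.domRestrict⟩ (a₀ := ⟨z₀, hz₀⟩) (hpF z₀ hz₀) fun a => hfs a a.2
  have h1 := hL ⟨U.domRestrict F, hF.domRestrict⟩ ⟨rfl, funext fun z => hpF z z.2⟩
  have h2 := hL ⟨U.domRestrict G, hG.domRestrict⟩ ⟨h₀.symm, funext fun z => hpG z z.2⟩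
  intro z hz
  exact congrArg (fun K : C(U, A) => K ⟨z, hz⟩) (h1.trans h2.symm)

/-- By continuity `h` is near `ζ` the local inverse of `p` composed with `k`. -/
lemma hasDerivAt_of_comp_eq {p h k : ℂ → ℂ} {ζ : ℂ} {p' k' : ℂ} (hp : HasStrictDerivAt p p' (h ζ))
    (hp' : p' ≠ 0) (hh : ContinuousAt h ζ) (hk : HasDerivAt k k' ζ)
    (hpk : ∀ᶠ w in 𝓝 ζ, p (h w) = k w) : HasDerivAt h (p'⁻¹ * k') ζ := by
  have h1 : ∀ᶠ w in 𝓝 ζ, hp.localInverse p p' (h ζ) hp' (k w) = h w := by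
    filter_upwards [hpk, hh.eventually (hp.eventually_left_inverse hp')] with w hw1 hw2
    rw [← hw1, hw2]
  have h2 : HasDerivAt (hp.localInverse p p' (h ζ) hp') p'⁻¹ (k ζ) := by
    rw [← hpk.self_of_nhds]
    exact (hp.to_localInverse hp').hasDerivAt
  exact (h2.comp ζ hk).congr_of_eventuallyEq (h1.mono fun w hw => hw.symm)

/-- A continuous lift of a holomorphic immersion through a holomorphic function is holomorphic. -/
lemma differentiableAt_of_comp_eq {p h k : ℂ → ℂ} {ζ : ℂ} (hp : AnalyticAt ℂ p (h ζ))
    (hh : ∀ᶠ w in 𝓝 ζ, ContinuousAt h w) (hk : ∀ᶠ w in 𝓝 ζ, DifferentiableAt ℂ k w)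
    (hk' : deriv k ζ ≠ 0) (hpk : ∀ᶠ w in 𝓝 ζ, p (h w) = k w) : DifferentiableAt ℂ h ζ := by
  have hkd := hk.self_of_nhds.hasDerivAt
  have hhc := hh.self_of_nhds
  have hne : ∀ᶠ w in 𝓝[≠] ζ, k w ≠ k ζ := hkd.eventually_ne hk'
  -- The derivative of `p` might vanish at `h ζ`, but only as an isolated zero: otherwise `p`, and
  -- with it `k`, would be locally constant. Away from `ζ` the local inverse applies, and continuity
  -- makes the singularity at `ζ` removable.
  have hp' : ∀ᶠ z in 𝓝[≠] (h ζ), deriv p z ≠ 0 := by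
    refine hp.deriv.eventually_eq_zero_or_eventually_ne_zero.resolve_left fun h0 => ?_
    obtain ⟨ε, hε, hball⟩ := Metric.eventually_nhds_iff_ball.1 (h0.and hp.eventually_analyticAt)
    have hconst : ∀ z ∈ Metric.ball (h ζ) ε, p z = p (h ζ) := fun z hz => by
      refine Metric.isOpen_ball.is_const_of_deriv_eq_zero
        (convex_ball (h ζ) ε).isPreconnected (fun w hw =>
          (hball w hw).2.differentiableAt.differentiableWithinAt) (fun w hw => (hball w hw).1) hz
        (Metric.mem_ball_self hε)
    have h1 : ∀ᶠ w in 𝓝 ζ, k w = k ζ := by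
      filter_upwards [hpk, hhc.eventually (Metric.ball_mem_nhds (h ζ) hε)] with w hw1 hw2
      rw [← hw1, hconst _ hw2, hpk.self_of_nhds]
    obtain ⟨w, hw1, hw2⟩ := (hne.and (h1.filter_mono nhdsWithin_le_nhds)).exists
    exact hw1 hw2
  have hdiff : ∀ᶠ w in 𝓝[≠] ζ, DifferentiableAt ℂ h w := by
    have h2 : ∀ᶠ w in 𝓝 ζ, h w ≠ h ζ → deriv p (h w) ≠ 0 ∧ AnalyticAt ℂ p (h w) := by
      have := hhc.eventually ((eventually_nhdsWithin_iff.1 hp').and hp.eventually_analyticAt)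
      filter_upwards [this] with w hw hne using ⟨hw.1 hne, hw.2⟩
    have h3 := (h2.and (hh.and (hk.and (eventually_eventually_nhds.2 hpk)))).filter_mono
      (nhdsWithin_le_nhds (s := {ζ}ᶜ))
    filter_upwards [hne, h3] with w hw1 ⟨hw2, hw3, hw4, hw5⟩
    have h4 : h w ≠ h ζ := fun h5 => hw1 (by
      rw [← hw5.self_of_nhds, h5, hpk.self_of_nhds])
    exact (hasDerivAt_of_comp_eq (hw2 h4).2.hasStrictDerivAt (hw2 h4).1 hw3 hw4.hasDerivAt
      hw5).differentiableAt
  obtain ⟨ε, hε, hball⟩ := Metric.eventually_nhds_iff_ball.1 (eventually_nhdsWithin_iff.1 hdiff)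
  have h5 := (Complex.differentiableOn_compl_singleton_and_continuousAt_iff
    (Metric.ball_mem_nhds ζ hε)).1
    ⟨fun w hw => (hball w hw.1 hw.2).differentiableWithinAt, hhc⟩
  exact h5.differentiableAt (Metric.ball_mem_nhds ζ hε)

end Lifting

/-! ### Growth estimates on the half-plane. -/

section NaturalCoordinate

lemma isOpen_upperHalf : IsOpen upperHalf := isOpen_lt continuous_const Complex.continuous_im

lemma convex_upperHalf : Convex ℝ upperHalf := convex_halfSpace_im_gt 0

/-- Inversion `z ↦ 1 / (1 + z)` sends the closed unit disc without `-1` onto the half-plane `Re ≥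
1/2`. -/
lemma half_le_re_inv {z : ℂ} (hz : ‖z‖ ≤ 1) (h : 1 + z ≠ 0) : 1 / 2 ≤ ((1 + z)⁻¹).re := by
  have h1 : 0 < Complex.normSq (1 + z) := Complex.normSq_pos.2 h
  rw [Complex.inv_re, le_div_iff₀ h1, Complex.normSq_apply]
  have h2 : z.re ^ 2 + z.im ^ 2 ≤ 1 := by
    have : ‖z‖ ^ 2 ≤ 1 := by nlinarith [norm_nonneg z]
    rw [← Complex.normSq_eq_norm_sq, Complex.normSq_apply] at this
    nlinarith
  simp only [Complex.add_re, Complex.add_im, Complex.one_re, Complex.one_im]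
  nlinarith

/-- A holomorphic function on a convex set whose derivative has real part at least `1/2` expands
distances by `1/2`. -/
lemma half_norm_sub_le {U : Set ℂ} (hU : Convex ℝ U) {T T' : ℂ → ℂ}
    (hT : ∀ z ∈ U, HasDerivAt T (T' z) z) (h : ∀ z ∈ U, 1 / 2 ≤ (T' z).re) {x y : ℂ} (hx : x ∈ U)
    (hy : y ∈ U) : 1 / 2 * ‖y - x‖ ≤ ‖T y - T x‖ := by
  set w := y - x with hw
  have hl : ∀ t ∈ Icc (0 : ℝ) 1, x + t * w ∈ U := fun t ht => by
    have := hU.add_smul_sub_mem hx hy ht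
    simpa [hw] using this
  set g : ℝ → ℝ := fun t => (T (x + t * w) * (starRingEnd ℂ) w).re with hg
  have hgd : ∀ t ∈ Icc (0 : ℝ) 1, HasDerivAt g ((T' (x + t * w)).re * ‖w‖ ^ 2) t := by
    intro t ht
    have h1 : HasDerivAt (fun t : ℝ => x + t * w) w t := by
      have := ((Complex.ofRealCLM.hasDerivAt (x := t)).mul_const w).const_add x
      simpa using this
    have h2 := ((hT _ (hl t ht)).comp_of_eq t h1 rfl).mul_const ((starRingEnd ℂ) w)
    have h3 := Complex.reCLM.hasFDerivAt.comp_hasDerivAt t h2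
    refine h3.congr_deriv ?_
    rw [mul_assoc, Complex.mul_conj, Complex.normSq_eq_norm_sq]
    rw [Complex.reCLM_apply, Complex.re_mul_ofReal]
  have hmv : 1 / 2 * ‖w‖ ^ 2 * (1 - 0) ≤ g 1 - g 0 := by
    refine (convex_Icc (0 : ℝ) 1).mul_sub_le_image_sub_of_le_deriv
      (fun t ht => (hgd t ht).continuousAt.continuousWithinAt)
      (fun t ht => (hgd t (interior_subset ht)).differentiableAt.differentiableWithinAt)
      (fun t ht => ?_) 0 (by simp) 1 (by simp) zero_le_one
    rw [(hgd t (interior_subset ht)).deriv]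
    have := h _ (hl t (interior_subset ht))
    gcongr
  have hg1 : g 1 - g 0 = ((T y - T x) * (starRingEnd ℂ) w).re := by
    simp [hg, hw]; ring
  have h4 : ((T y - T x) * (starRingEnd ℂ) w).re ≤ ‖T y - T x‖ * ‖w‖ := by
    refine (Complex.re_le_norm _).trans ?_
    rw [norm_mul, Complex.norm_conj]
  rcases (norm_nonneg w).eq_or_lt with h0 | h0
  · rw [← h0]; simp
  · rw [hg1] at hmv
    have : 1 / 2 * ‖w‖ * ‖w‖ ≤ ‖T y - T x‖ * ‖w‖ := by linarith [sq ‖w‖]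
    exact le_of_mul_le_mul_right this h0

/-- The part of the upper half-plane outside a square. -/
def farHalf (R : ℝ) : Set ℂ :=
  ({z : ℂ | R < z.re} ∩ upperHalf) ∪ ({z : ℂ | R < z.im} ∪ ({z : ℂ | z.re < -R} ∩ upperHalf))

lemma farHalf_subset {R : ℝ} (hR : 0 < R) : farHalf R ⊆ upperHalf ∩ {z | R < ‖z‖} := by
  rintro z (⟨h1, h2⟩ | h1 | ⟨h1, h2⟩)
  · exact ⟨h2, lt_of_lt_of_le h1 (Complex.re_le_norm z)⟩
  · exact ⟨hR.trans h1, lt_of_lt_of_le h1 (Complex.im_le_norm z)⟩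
  · refine ⟨h2, lt_of_lt_of_le ?_ (Complex.abs_re_le_norm z)⟩
    exact lt_of_lt_of_le (lt_neg_of_lt_neg h1) (neg_le_abs _)

lemma mem_farHalf {R : ℝ} {z : ℂ} (hz : z ∈ upperHalf) (h : 2 * R < ‖z‖) : z ∈ farHalf R := by
  by_contra hn
  simp only [farHalf, mem_union, mem_inter_iff, mem_ofPred_eq, not_or, not_and_or, not_lt] at hn
  obtain ⟨h1, h2, h3⟩ := hn
  have h4 := h1.resolve_right (not_not.2 hz)
  have h5 := h3.resolve_right (not_not.2 hz)
  have h6 := Complex.norm_le_abs_re_add_abs_im z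
  have h7 : |z.re| ≤ R := abs_le.2 ⟨h5, h4⟩
  have h8 : |z.im| ≤ R := by rw [abs_of_pos hz]; exact h2
  linarith

lemma isPreconnected_farHalf {R : ℝ} (hR : 0 < R) : IsPreconnected (farHalf R) := by
  have c1 : IsPreconnected ({z : ℂ | R < z.re} ∩ upperHalf) :=
    ((convex_halfSpace_re_gt R).inter convex_upperHalf).isPreconnected
  have c2 : IsPreconnected {z : ℂ | R < z.im} := (convex_halfSpace_im_gt R).isPreconnected
  have c3 : IsPreconnected ({z : ℂ | z.re < -R} ∩ upperHalf) :=
    ((convex_halfSpace_re_lt (-R)).inter convex_upperHalf).isPreconnected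
  refine c1.union (⟨R + 1, R + 1⟩ : ℂ) ⟨by simp, by simp [upperHalf]; linarith⟩
    (Or.inl (by simp)) (c2.union (⟨-(R + 1), R + 1⟩ : ℂ) (by simp)
    ⟨by simp, by simp [upperHalf]; linarith⟩ c3)

/-- A function with small derivative far out grows slowly. -/
lemma exists_norm_le_of_deriv_le {g g' : ℂ → ℂ} {R δ : ℝ} (hδ : 0 ≤ δ)
    (hg : ∀ z ∈ farHalf R, HasDerivAt g (g' z) z) (h : ∀ z ∈ farHalf R, ‖g' z‖ ≤ δ) :
    ∃ C : ℝ, ∀ z ∈ farHalf R, ‖g z‖ ≤ C + δ * ‖z‖ := by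
  have key : ∀ S : Set ℂ, S ⊆ farHalf R → Convex ℝ S →
      ∃ C : ℝ, ∀ z ∈ S, ‖g z‖ ≤ C + δ * ‖z‖ := by
    intro S hS hconv
    rcases S.eq_empty_or_nonempty with rfl | ⟨x, hx⟩
    · exact ⟨0, fun z hz => hz.elim⟩
    refine ⟨‖g x‖ + δ * ‖x‖, fun z hz => ?_⟩
    have h1 := hconv.norm_image_sub_le_of_norm_hasDerivWithin_le
      (fun w hw => (hg w (hS hw)).hasDerivWithinAt) (fun w hw => h w (hS hw)) hx hz
    have h2 : ‖g z‖ ≤ ‖g z - g x‖ + ‖g x‖ := by simpa using norm_add_le (g z - g x) (g x)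
    have h3 : δ * ‖z - x‖ ≤ δ * (‖z‖ + ‖x‖) := by gcongr; exact norm_sub_le _ _
    linarith
  obtain ⟨C₁, h1⟩ := key _ (fun z hz => Or.inl hz)
    ((convex_halfSpace_re_gt R).inter convex_upperHalf)
  obtain ⟨C₂, h2⟩ := key _ (fun z hz => Or.inr (Or.inl hz)) (convex_halfSpace_im_gt R)
  obtain ⟨C₃, h3⟩ := key _ (fun z hz => Or.inr (Or.inr hz))
    ((convex_halfSpace_re_lt (-R)).inter convex_upperHalf)
  refine ⟨max C₁ (max C₂ C₃), ?_⟩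
  rintro z (hz | hz | hz)
  · exact (h1 z hz).trans (by gcongr; exact le_max_left _ _)
  · exact (h2 z hz).trans (by gcongr; exact (le_max_left _ _).trans (le_max_right _ _))
  · exact (h3 z hz).trans (by gcongr; exact (le_max_right _ _).trans (le_max_right _ _))

end NaturalCoordinate

/-! ### Integrating `√q`: the natural coordinate as `exp ξ + a ξ + b`. -/

section Normalization

lemma farHalf_anti {R R' : ℝ} (h : R ≤ R') : farHalf R' ⊆ farHalf R := by
  rintro z (⟨h1, h2⟩ | h1 | ⟨h1, h2⟩)
  · exact Or.inl ⟨h.trans_lt h1, h2⟩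
  · exact Or.inr (Or.inl (h.trans_lt h1))
  · exact Or.inr (Or.inr ⟨lt_of_lt_of_le h1 (neg_le_neg h), h2⟩)

lemma I_mem_upperHalf : Complex.I ∈ upperHalf := by simp [upperHalf]

/-- A logarithm of an almost linear function on the half-plane is, up to a period, the principal
logarithm far out. -/
lemma exists_log_period {a : ℂ} {T Ξ : ℂ → ℂ}
    (hT : ∀ z ∈ upperHalf, HasDerivAt T ((1 + a / T z)⁻¹) z)
    (ha : ∀ z ∈ upperHalf, ‖a / T z‖ ≤ 1) (hne : ∀ z ∈ upperHalf, 1 + a / T z ≠ 0)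
    (hΞ : ContinuousOn Ξ upperHalf) (hexp : ∀ z ∈ upperHalf, Complex.exp (Ξ z) = T z) :
    ∃ n : ℤ, ∀ K : ℝ, ∃ R : ℝ, ∀ z ∈ upperHalf, R ≤ ‖z‖ →
      K ≤ (Ξ z - n * (2 * Real.pi * Complex.I)).re ∧
        |(Ξ z - n * (2 * Real.pi * Complex.I)).im| ≤ 4 := by
  have hgrow : ∀ z ∈ upperHalf, 1 / 2 * ‖z‖ - (1 + ‖T Complex.I‖) ≤ ‖T z‖ := fun z hz => by
    have h1 := half_norm_sub_le convex_upperHalf hT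
      (fun w hw => half_le_re_inv (ha w hw) (hne w hw)) I_mem_upperHalf hz
    have h2 := norm_sub_norm_le z Complex.I
    have h3 := norm_sub_le (T z) (T Complex.I)
    rw [Complex.norm_I] at h2
    linarith
  set C₀ := 1 + ‖T Complex.I‖ with hC₀
  set R₀ := 2 * (C₀ + 9 * ‖a‖ + 1) with hR₀
  have hC₀pos : 0 < C₀ := by positivity
  have hR₀pos : 0 < R₀ := by positivity
  have hsmall : ∀ z ∈ farHalf R₀, ‖a / T z‖ ≤ 1 / 9 := fun z hz => by
    obtain ⟨h1, h2⟩ := farHalf_subset hR₀pos hz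
    have h3 := hgrow z h1
    have h4 : R₀ < ‖z‖ := h2
    have h5 : 9 * ‖a‖ + 1 ≤ ‖T z‖ := by linarith
    have h6 : 0 < ‖T z‖ := by linarith [norm_nonneg a]
    rw [norm_div, div_le_iff₀ h6]
    linarith
  -- From `‖a / T‖ ≤ 1/9` the derivative of `T z - z` is at most `(1/9) / (8/9) = 1/8`.
  obtain ⟨C, hC⟩ := exists_norm_le_of_deriv_le (g := fun z => T z - z)
    (g' := fun z => (1 + a / T z)⁻¹ - 1) (R := R₀) (δ := 1 / 8) (by norm_num)
    (fun z hz => (hT z (farHalf_subset hR₀pos hz).1).sub (hasDerivAt_id z)) (fun z hz => by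
      have h1 := hsmall z hz
      have h2 := hne z (farHalf_subset hR₀pos hz).1
      have h3 : (1 + a / T z)⁻¹ - 1 = -(a / T z) / (1 + a / T z) := by
        rw [eq_div_iff h2, sub_mul, inv_mul_cancel₀ h2]; ring
      have h4 : 8 / 9 ≤ ‖1 + a / T z‖ := by
        have := norm_sub_norm_le (1 : ℂ) (-(a / T z))
        rw [sub_neg_eq_add, norm_neg, norm_one] at this
        linarith
      rw [h3, norm_div, norm_neg, div_le_iff₀ (by linarith)]
      linarith)
  -- Beyond this radius `‖T z / z - 1‖ ≤ 1/3 + 1/8 < 1/2`, so `T z / z` has a principal logarithm.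
  set R₁ := max R₀ (3 * |C|) with hR₁
  have hR₁pos : 0 < R₁ := hR₀pos.trans_le (le_max_left _ _)
  have hz0 : ∀ z ∈ upperHalf, z ≠ 0 := by
    rintro z hz rfl
    simp [upperHalf] at hz
  have hquot : ∀ z ∈ farHalf R₁, ‖T z / z - 1‖ ≤ 1 / 2 := fun z hz => by
    obtain ⟨h1, h2⟩ := farHalf_subset hR₁pos hz
    have h2' : R₁ < ‖z‖ := h2
    have h3 := hC z (farHalf_anti (le_max_left _ _) hz)
    have h4 : 3 * |C| ≤ ‖z‖ := (le_max_right _ _).trans h2'.le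
    have h5 := le_abs_self C
    rw [div_sub_one (hz0 z h1), norm_div, div_le_iff₀ (norm_pos_iff.2 (hz0 z h1))]
    linarith [norm_nonneg z]
  have hslit : ∀ z ∈ farHalf R₁, T z / z ∈ Complex.slitPlane := fun z hz => by
    refine Or.inl ?_
    have h1 := (Complex.abs_re_le_norm _).trans (hquot z hz)
    rw [Complex.sub_re, Complex.one_re] at h1
    linarith [(abs_le.1 h1).1]
  have hTc : ContinuousOn T upperHalf := fun z hz => (hT z hz).continuousAt.continuousWithinAt
  have hsub : farHalf R₁ ⊆ upperHalf := fun z hz => (farHalf_subset hR₁pos hz).1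
  -- The two logarithms of `T` differ by a continuous function with values in `2 π i ℤ`, constant
  -- because the far region is connected.
  set D : ℂ → ℂ := fun z => Ξ z - (Complex.log z + Complex.log (T z / z)) with hD
  have hDc : ContinuousOn D (farHalf R₁) := by
    refine (hΞ.mono hsub).sub ((continuousOn_id.clog fun z hz => Or.inr (ne_of_gt (hsub hz))).add
      (ContinuousOn.clog ?_ hslit))
    exact (hTc.mono hsub).div continuousOn_id fun z hz => hz0 z (hsub hz)
  have hlog : ∀ z ∈ farHalf R₁,
      Complex.exp (Complex.log z + Complex.log (T z / z)) = T z := fun z hz => by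
    have h1 := hz0 z (hsub hz)
    rw [Complex.exp_add, Complex.exp_log h1,
      Complex.exp_log (Complex.slitPlane_ne_zero (hslit z hz)), mul_div_cancel₀ _ h1]
  have hD1 : ∀ z ∈ farHalf R₁, Complex.exp (D z) = 1 := fun z hz => by
    simp only [hD]
    rw [Complex.exp_sub, hlog z hz, hexp z (hsub hz), div_self]
    rw [← hexp z (hsub hz)]
    exact Complex.exp_ne_zero _
  have hx : (2 * R₁ + 1) * Complex.I ∈ farHalf R₁ := by
    refine Or.inr (Or.inl ?_)
    simp
    linarith
  have hDconst : ∀ z ∈ farHalf R₁, D z = D ((2 * R₁ + 1) * Complex.I) := fun z hz =>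
    Complex.isCoveringMap_exp.constOn_of_comp (isPreconnected_farHalf hR₁pos) hDc
      (fun x hx y hy => Subtype.ext ((hD1 x hx).trans (hD1 y hy).symm)) hz hx
  obtain ⟨n, hn⟩ := Complex.exp_eq_one_iff.1 (hD1 _ hx)
  have hmain : ∀ z ∈ farHalf R₁, Ξ z - n * (2 * Real.pi * Complex.I) =
      Complex.log z + Complex.log (T z / z) := fun z hz => by
    rw [← hn, ← hDconst z hz]
    simp only [hD]
    ring
  refine ⟨n, fun K => ⟨max (2 * R₁ + 1) (2 * (Real.exp K + C₀)), fun z hz hR => ?_⟩⟩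
  have hzf : z ∈ farHalf R₁ := mem_farHalf hz (by linarith [(le_max_left _ _).trans hR])
  rw [hmain z hzf]
  constructor
  · have h1 : Real.exp (Complex.log z + Complex.log (T z / z)).re = ‖T z‖ := by
      rw [← Complex.norm_exp, hlog z hzf]
    have h2 := hgrow z hz
    have h3 := (le_max_right _ _).trans hR
    rw [← Real.exp_le_exp, h1]
    linarith
  -- The bound `4` on the height comes from `π + 3/4`.
  · have h1 : |(Complex.log z).im| ≤ Real.pi := by
      rw [Complex.log_im]
      exact Complex.abs_arg_le_pi z
    have h2 : |(Complex.log (T z / z)).im| ≤ 3 / 4 := by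
      have h3 := Complex.norm_log_one_add_half_le_self (hquot z hzf)
      rw [add_sub_cancel] at h3
      exact (Complex.abs_im_le_norm _).trans (h3.trans (by linarith [hquot z hzf]))
    rw [Complex.add_im]
    linarith [abs_add_le (Complex.log z).im (Complex.log (T z / z)).im, Real.pi_lt_d2]

/-- The natural coordinate on a standard half-plane is inverse to a branch of `endMap`. -/
lemma exists_normalized {m : ℝ} (hm : 0 < m) {A : ℂ} {Z : ℂ → ℂ}
    (hZ : DifferentiableOn ℂ Z upperHalf)
    (hsq : ∀ z ∈ upperHalf, ((Complex.exp (-(m * Z z)) + A) * deriv Z z) ^ 2 = 1)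
    (hA : ∀ z ∈ upperHalf, ‖A‖ ≤ ‖Complex.exp (-(m * Z z))‖) :
    ∃ a b μ : ℂ,
      (∀ ξ : ℂ, (Complex.exp (-(m * (μ - ξ / m))) + A) ^ 2 / m ^ 2 = (Complex.exp ξ + a) ^ 2) ∧
      (∀ z ∈ upperHalf, endMap a b (m * (μ - Z z)) = z) ∧
      ∀ K : ℝ, ∃ R : ℝ, ∀ z ∈ upperHalf, R ≤ ‖z‖ →
        K ≤ (m * (μ - Z z)).re ∧ |(m * (μ - Z z)).im| ≤ 4 := by
  have hm0 : (m : ℂ) ≠ 0 := by exact_mod_cast hm.ne'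
  have hZd : ∀ z ∈ upperHalf, HasDerivAt Z (deriv Z z) z := fun z hz =>
    (hZ.differentiableAt (isOpen_upperHalf.mem_nhds hz)).hasDerivAt
  have hed : ∀ z ∈ upperHalf, HasDerivAt (fun w => Complex.exp (-(m * Z w)))
      (Complex.exp (-(m * Z z)) * -(m * deriv Z z)) z := fun z hz =>
    ((hZd z hz).const_mul (m : ℂ)).neg.cexp
  -- The equation determines `√q` only up to a sign `ε`, constant by connectedness.
  obtain ⟨ε, hε, hεZ⟩ : ∃ ε : ℂ, ε ^ 2 = 1 ∧ ∀ z ∈ upperHalf,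
      (Complex.exp (-(m * Z z)) + A) * deriv Z z = ε := by
    have hc : ContinuousOn (fun z => (Complex.exp (-(m * Z z)) + A) * deriv Z z) upperHalf := by
      refine ContinuousOn.mul (ContinuousOn.add (fun z hz =>
        (hed z hz).continuousAt.continuousWithinAt) continuousOn_const) ?_
      exact (hZ.deriv isOpen_upperHalf).continuousOn
    rcases convex_upperHalf.isPreconnected.eq_or_eq_neg_of_sq_eq hc
      (continuousOn_const (c := (1 : ℂ))) (fun z hz => by simpa using hsq z hz)
      (fun _ => one_ne_zero) with h | h
    · exact ⟨1, by norm_num, fun z hz => h hz⟩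
    · exact ⟨-1, by norm_num, fun z hz => by simpa using h hz⟩
  have hε0 : ε ≠ 0 := by rintro rfl; norm_num at hε
  have hεm : -ε / m ≠ 0 := div_ne_zero (neg_ne_zero.2 hε0) hm0
  -- This is the leading part of the primitive of `ε (exp (-m Z) + A) dZ = dω`, and will be `exp ξ`.
  -- It satisfies `T' = 1 / (1 + a / T)`.
  set T : ℂ → ℂ := fun z => -ε / m * Complex.exp (-(m * Z z)) with hTdef
  set a : ℂ := -(ε * A) / m with hadef
  have haT : ∀ z, a / T z = A / Complex.exp (-(m * Z z)) := fun z => by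
    have := Complex.exp_ne_zero (-(m * Z z))
    simp only [hTdef, hadef]
    field_simp
  have hf0 : ∀ z ∈ upperHalf, Complex.exp (-(m * Z z)) + A ≠ 0 := fun z hz h0 => by
    have := hsq z hz
    rw [h0] at this
    norm_num at this
  have h1a : ∀ z, 1 + a / T z = (Complex.exp (-(m * Z z)) + A) / Complex.exp (-(m * Z z)) :=
    fun z => by rw [haT, add_div, div_self (Complex.exp_ne_zero _)]
  have hT : ∀ z ∈ upperHalf, HasDerivAt T ((1 + a / T z)⁻¹) z := fun z hz => by
    refine ((hed z hz).const_mul (-ε / m)).congr_deriv ?_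
    rw [h1a, inv_div, eq_div_iff (hf0 z hz)]
    have h2 := hεZ z hz
    calc _ = ε * Complex.exp (-(m * Z z)) * ((Complex.exp (-(m * Z z)) + A) * deriv Z z) := by
          field_simp
      _ = _ := by rw [h2]; linear_combination Complex.exp (-(m * Z z)) * hε
  set μ₀ : ℂ := Complex.log (-ε / m) / m with hμ₀
  have hexp0 : ∀ z, Complex.exp (m * (μ₀ - Z z)) = T z := fun z => by
    have h1 : m * (μ₀ - Z z) = Complex.log (-ε / m) + -(m * Z z) := by
      rw [hμ₀]; field_simp; ring
    rw [h1, Complex.exp_add, Complex.exp_log hεm]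
  obtain ⟨n, hn⟩ := exists_log_period (a := a) (T := T) (Ξ := fun z => m * (μ₀ - Z z)) hT
    (fun z hz => by
      rw [haT, norm_div, div_le_one (norm_pos_iff.2 (Complex.exp_ne_zero _))]
      exact hA z hz)
    (fun z hz => by
      rw [h1a]
      exact div_ne_zero (hf0 z hz) (Complex.exp_ne_zero _))
    (continuousOn_const.mul (continuousOn_const.sub hZ.continuousOn)) (fun z _ => hexp0 z)
  -- Shifting by a period leaves `exp ξ` unchanged and brings `Im ξ` into `[-4, 4]` far out.
  set μ : ℂ := μ₀ - n * (2 * Real.pi * Complex.I) / m with hμ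
  have hshift : ∀ z, m * (μ - Z z) = m * (μ₀ - Z z) - n * (2 * Real.pi * Complex.I) := fun z => by
    rw [hμ]; field_simp; ring
  have hexpμ : Complex.exp (m * μ) = -ε / m := by
    have h1 : m * μ = Complex.log (-ε / m) - n * (2 * Real.pi * Complex.I) := by
      rw [hμ, hμ₀]; field_simp
    rw [h1, Complex.exp_sub, Complex.exp_log hεm, Complex.exp_int_mul_two_pi_mul_I, div_one]
  -- This is the integrated form of `ε (exp (-m Z) + A) dZ = dω`; its constant determines `b`.
  have hconst : ∀ z ∈ upperHalf, T z + ε * A * Z z - z =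
      T Complex.I + ε * A * Z Complex.I - Complex.I := by
    have hd : ∀ z ∈ upperHalf, HasDerivAt (fun w => T w + ε * A * Z w - w) 0 z := fun z hz => by
      refine (((hT z hz).add ((hZd z hz).const_mul (ε * A))).sub (hasDerivAt_id z)).congr_deriv ?_
      have h2 := hεZ z hz
      rw [h1a, inv_div, div_add' _ _ _ (hf0 z hz), div_sub_one (hf0 z hz),
        div_eq_zero_iff]
      left
      linear_combination ε * A * h2 + A * hε
    intro z hz
    exact isOpen_upperHalf.is_const_of_deriv_eq_zero convex_upperHalf.isPreconnected
      (fun w hw => (hd w hw).differentiableAt.differentiableWithinAt) (fun w hw => (hd w hw).deriv)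
      hz I_mem_upperHalf
  refine ⟨a, ε * A * μ - (T Complex.I + ε * A * Z Complex.I - Complex.I), μ, fun ξ => ?_,
    fun z hz => ?_, fun K => ?_⟩
  · have h1 : -(m * (μ - ξ / m)) = ξ - m * μ := by field_simp; ring
    rw [h1, Complex.exp_sub, hexpμ, hadef]
    have h2 : Complex.exp ξ / (-ε / m) = -(ε * m) * Complex.exp ξ := by
      rw [div_div_eq_mul_div, div_eq_iff (neg_ne_zero.2 hε0)]
      linear_combination -(m * Complex.exp ξ) * hε
    rw [h2, div_eq_iff (pow_ne_zero 2 hm0), ← mul_pow]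
    have h3 : (Complex.exp ξ + -(ε * A) / m) * m = m * Complex.exp ξ - ε * A := by
      field_simp; ring
    rw [h3]
    linear_combination (m ^ 2 * Complex.exp ξ ^ 2 - A ^ 2) * hε
  · rw [← hconst z hz, endMap, hshift, Complex.exp_sub, Complex.exp_int_mul_two_pi_mul_I, div_one,
      hexp0, ← hshift, hadef]
    field_simp
    ring
  · obtain ⟨R, hR⟩ := hn K
    exact ⟨R, fun z hz hzR => by rw [hshift]; exact hR z hz hzR⟩

end Normalization

/-! ### From the Gauss equation to the sinh-Gordon equation. -/

section GaussToSinhGordon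

/-- The Gauss equation for a conformal factor `E` turns into the sinh-Gordon equation for
`E = 2 e^{2V} |d (endMap a b)|²`. -/
lemma isSinhGordon_of_gauss {a : ℂ} {ℓ : ℝ} {E : ℂ → ℝ}
    (hne : ∀ z : ℂ, ℓ < z.re → Complex.exp z + a ≠ 0)
    (hE : ∀ z : ℂ, ℓ < z.re → 0 < E z)
    (hG : ∀ z : ℂ, ℓ < z.re → ContDiffAt ℝ 2 (fun w => Real.log (E w)) z ∧
      Δ (fun w => Real.log (E w)) z =
        2 * E z - 8 * ‖(Complex.exp z + a) ^ 2‖ ^ 2 / E z) :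
    IsSinhGordon a ℓ fun z =>
      (1 / 2 : ℝ) • Real.log (E z) - (Real.log 2 / 2 + Real.log ‖Complex.exp z + a‖) := by
  have hharm : ∀ z : ℂ, ℓ < z.re →
      InnerProductSpace.HarmonicAt (fun w => Real.log ‖Complex.exp w + a‖) z := fun z hz => by
    have h1 : AnalyticAt ℂ (fun w => Complex.exp w + a) z := by fun_prop
    exact h1.harmonicAt_log_norm (hne z hz)
  have hc : ∀ z : ℂ, InnerProductSpace.HarmonicAt (fun _ : ℂ => Real.log 2 / 2) z := fun z =>
    ⟨contDiffAt_const, by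
      filter_upwards with w
      simp [laplacian_eq_fderiv_fderiv]⟩
  have hsum : ∀ z : ℂ, ℓ < z.re → InnerProductSpace.HarmonicAt
      (fun w => Real.log 2 / 2 + Real.log ‖Complex.exp w + a‖) z := fun z hz =>
    (hc z).add (hharm z hz)
  have hhalf : ∀ z : ℂ, ℓ < z.re →
      ContDiffAt ℝ 2 (fun w => (1 / 2 : ℝ) • Real.log (E w)) z := fun z hz =>
    (hG z hz).1.const_smul (1 / 2 : ℝ)
  refine ⟨fun z hz => (hhalf z hz).sub (hsum z hz).1, fun z hz => ?_⟩
  have h1 := (hhalf z hz).laplacian_sub (hsum z hz).1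
  have h2 : Δ (fun w => (1 / 2 : ℝ) • Real.log (E w)) z =
      (1 / 2 : ℝ) • Δ (fun w => Real.log (E w)) z := by
    exact InnerProductSpace.laplacian_smul (1 / 2 : ℝ) (hG z hz).1
  have h3 : Δ (fun w => Real.log 2 / 2 + Real.log ‖Complex.exp w + a‖) z = 0 :=
    (hsum z hz).2.self_of_nhds
  have hEz := hE z hz
  have hn : 0 < ‖Complex.exp z + a‖ := norm_pos_iff.2 (hne z hz)
  have h4 : Real.exp (2 * ((1 / 2 : ℝ) • Real.log (E z) -
      (Real.log 2 / 2 + Real.log ‖Complex.exp z + a‖))) =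
      E z / (2 * ‖Complex.exp z + a‖ ^ 2) := by
    have h5 : 2 * ((1 / 2 : ℝ) • Real.log (E z) -
        (Real.log 2 / 2 + Real.log ‖Complex.exp z + a‖)) =
        Real.log (E z) - (Real.log 2 + (Real.log ‖Complex.exp z + a‖ +
          Real.log ‖Complex.exp z + a‖)) := by
      rw [smul_eq_mul]; ring
    rw [h5, Real.exp_sub, Real.exp_add, Real.exp_add, Real.exp_log hEz, Real.exp_log two_pos,
      Real.exp_log hn, sq]
  have h6 : Δ (fun w => (1 / 2 : ℝ) • Real.log (E w) -
      (Real.log 2 / 2 + Real.log ‖Complex.exp w + a‖)) z =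
      (1 / 2 : ℝ) • Δ (fun w => Real.log (E w)) z - 0 := by
    rw [← h2, ← h3]
    exact h1
  rw [h6, (hG z hz).2, Real.sinh_eq, Real.exp_neg, h4, norm_pow, smul_eq_mul]
  field_simp
  ring

end GaussToSinhGordon

/-! ### Holomorphic curves in Riemann surfaces -/

section Curves

variable {X : Type*} [TopologicalSpace X] [ChartedSpace ℂ X]
  {Y : Type*} [TopologicalSpace Y] [ChartedSpace ℂ Y]

lemma isManifold_one (X : Type*) [TopologicalSpace X] [ChartedSpace ℂ X] [IsManifold 𝓘(ℂ) ω X] :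
    IsManifold 𝓘(ℂ) 1 X := IsManifold.of_le (n := ω) le_top

lemma mdifferentiableAt_curve_iff {f : ℂ → Y} {z : ℂ} :
    MDifferentiableAt 𝓘(ℂ) 𝓘(ℂ) f z ↔
      ContinuousAt f z ∧ DifferentiableAt ℂ (chartAt ℂ (f z) ∘ f) z := by
  rw [mdifferentiableAt_iff]
  simp [writtenInExtChartAt, differentiableWithinAt_univ, Function.comp_def, chartAt_self_eq]

lemma mfderiv_curve {f : ℂ → Y} {z : ℂ} (hf : MDifferentiableAt 𝓘(ℂ) 𝓘(ℂ) f z) (v : ℂ) :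
    (mfderiv 𝓘(ℂ) 𝓘(ℂ) f z v : ℂ) = deriv (chartAt ℂ (f z) ∘ f) z * v := by
  have h1 : HasFDerivAt (chartAt ℂ (f z) ∘ f)
      (ContinuousLinearMap.toSpanSingleton ℂ (deriv (chartAt ℂ (f z) ∘ f) z)) z :=
    (mdifferentiableAt_curve_iff.1 hf).2.hasDerivAt.hasFDerivAt
  have h2 : HasMFDerivAt 𝓘(ℂ) 𝓘(ℂ) f z
      (ContinuousLinearMap.toSpanSingleton ℂ (deriv (chartAt ℂ (f z) ∘ f) z) : ℂ →L[ℂ] ℂ) := by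
    refine ⟨hf.continuousAt, ?_⟩
    have h0 : HasFDerivWithinAt (writtenInExtChartAt 𝓘(ℂ) 𝓘(ℂ) z f)
        (ContinuousLinearMap.toSpanSingleton ℂ (deriv (chartAt ℂ (f z) ∘ f) z)) (range 𝓘(ℂ))
        (extChartAt 𝓘(ℂ) z z) := by
      simpa [writtenInExtChartAt, Function.comp_def, chartAt_self_eq] using h1
    exact h0
  refine (congrArg (fun L : ℂ →L[ℂ] ℂ => L v) h2.mfderiv).trans ?_
  simp [mul_comm]

lemma QuadDiff.map_zero' (q : QuadDiff X) (x : X) : q.toFun x 0 = 0 := by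
  have := q.map_smul x 0 0
  simpa using this

lemma QuadDiff.toFun_mfderiv (q : QuadDiff X) (κ : ℂ → X) (z v : ℂ) :
    q.toFun (κ z) (mfderiv 𝓘(ℂ) 𝓘(ℂ) κ z v) = q.pullback κ z * v ^ 2 := by
  have h1 : mfderiv 𝓘(ℂ) 𝓘(ℂ) κ z v = v • mfderiv 𝓘(ℂ) 𝓘(ℂ) κ z (1 : ℂ) := by
    have h2 := (mfderiv 𝓘(ℂ) 𝓘(ℂ) κ z).map_smul v (1 : ℂ)
    have h3 : v • (1 : ℂ) = v := by simp
    exact (congrArg (mfderiv 𝓘(ℂ) 𝓘(ℂ) κ z) h3).symm.trans h2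
  rw [h1, q.map_smul, QuadDiff.pullback, mul_comm]

lemma QuadDiff.pullback_comp (q : QuadDiff X) {k : ℂ → X} {f : ℂ → ℂ} {z f' : ℂ}
    (hk : MDifferentiableAt 𝓘(ℂ) 𝓘(ℂ) k (f z)) (hf : HasDerivAt f f' z) :
    q.pullback (fun w => k (f w)) z = q.pullback k (f z) * f' ^ 2 := by
  have h1 := mfderiv_comp_apply z hk hf.differentiableAt.mdifferentiableAt (1 : ℂ)
  rw [mfderiv_eq_fderiv] at h1
  have h2 : fderiv ℂ f z (1 : ℂ) = f' := by rw [hf.hasFDerivAt.fderiv]; simp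
  rw [← QuadDiff.toFun_mfderiv, ← h2]
  exact congrArg (q.toFun (k (f z))) h1

lemma QuadDiff.pullback_congr (q : QuadDiff X) {k k' : ℂ → X} {z : ℂ} (h : k =ᶠ[𝓝 z] k') :
    q.pullback k z = q.pullback k' z := by
  have h1 : mfderiv 𝓘(ℂ) 𝓘(ℂ) k z (1 : ℂ) = (mfderiv 𝓘(ℂ) 𝓘(ℂ) k' z (1 : ℂ) : ℂ) := by
    rw [h.mfderiv_eq]; rfl
  unfold QuadDiff.pullback
  rw [h1, h.self_of_nhds]

/-- A continuous lift of a holomorphic immersed curve through a holomorphic map is holomorphic. -/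
lemma mdifferentiableOn_lift [IsManifold 𝓘(ℂ) ω X] [IsManifold 𝓘(ℂ) ω Y] {π : Y → X}
    (hπ : MDifferentiable 𝓘(ℂ) 𝓘(ℂ) π) {U : Set ℂ} (hU : IsOpen U) {κ : ℂ → X}
    (hκ : MDifferentiableOn 𝓘(ℂ) 𝓘(ℂ) κ U) {Ψ : ℂ → Y} (hΨ : ContinuousOn Ψ U)
    (hΨκ : ∀ z ∈ U, π (Ψ z) = κ z) {z : ℂ} (hz : z ∈ U)
    (hne : mfderiv 𝓘(ℂ) 𝓘(ℂ) κ z (1 : ℂ) ≠ 0) : MDifferentiableAt 𝓘(ℂ) 𝓘(ℂ) Ψ z := by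
  have := isManifold_one X
  have := isManifold_one Y
  have hκz : ∀ w ∈ U, MDifferentiableAt 𝓘(ℂ) 𝓘(ℂ) κ w := fun w hw =>
    (hκ w hw).mdifferentiableAt (hU.mem_nhds hw)
  have hΨz : ∀ w ∈ U, ContinuousAt Ψ w := fun w hw => hΨ.continuousAt (hU.mem_nhds hw)
  set cY := chartAt ℂ (Ψ z) with hcY
  set cX := chartAt ℂ (κ z) with hcX
  have hsrcY : ∀ᶠ w in 𝓝 z, Ψ w ∈ cY.source :=
    (hΨz z hz).eventually (cY.open_source.mem_nhds (mem_chart_source ℂ (Ψ z)))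
  have hsrcX : ∀ᶠ w in 𝓝 z, κ w ∈ cX.source :=
    (hκz z hz).continuousAt.eventually (cX.open_source.mem_nhds (mem_chart_source ℂ (κ z)))
  have hUz : ∀ᶠ w in 𝓝 z, w ∈ U := hU.mem_nhds hz
  rw [mdifferentiableAt_curve_iff]
  refine ⟨hΨz z hz, differentiableAt_of_comp_eq (p := cX ∘ π ∘ cY.symm) (k := cX ∘ κ) ?_ ?_ ?_ ?_ ?_⟩
  · have ho : IsOpen (cY.target ∩ cY.symm ⁻¹' (π ⁻¹' cX.source)) :=
      cY.isOpen_inter_preimage_symm (cX.open_source.preimage hπ.continuous)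
    have hd : DifferentiableOn ℂ (cX ∘ π ∘ cY.symm)
        (cY.target ∩ cY.symm ⁻¹' (π ⁻¹' cX.source)) := by
      rintro w ⟨hw1, hw2⟩
      have h1 : MDifferentiableAt 𝓘(ℂ) 𝓘(ℂ) cY.symm w :=
        mdifferentiableAt_atlas_symm (chart_mem_atlas ℂ _) hw1
      have h2 : MDifferentiableAt 𝓘(ℂ) 𝓘(ℂ) cX (π (cY.symm w)) :=
        mdifferentiableAt_atlas (chart_mem_atlas ℂ _) hw2
      have h3 := h2.comp w ((hπ _).comp w h1)
      exact (mdifferentiableAt_iff_differentiableAt.1 h3).differentiableWithinAt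
    refine hd.analyticAt (ho.mem_nhds ⟨cY.map_source (mem_chart_source ℂ _), ?_⟩)
    have h4 : cY.symm (cY (Ψ z)) = Ψ z := cY.left_inv (mem_chart_source ℂ _)
    rw [mem_preimage, mem_preimage, Function.comp_apply, h4, hΨκ z hz]
    exact mem_chart_source ℂ _
  · filter_upwards [hsrcY, hUz] with w hw hwU
    exact (cY.continuousAt hw).comp (hΨz w hwU)
  · filter_upwards [hsrcX, hUz] with w hw hwU
    have h2 : MDifferentiableAt 𝓘(ℂ) 𝓘(ℂ) cX (κ w) :=
      mdifferentiableAt_atlas (chart_mem_atlas ℂ _) hw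
    exact mdifferentiableAt_iff_differentiableAt.1 (h2.comp w (hκz w hwU))
  · intro h0
    apply hne
    have := mfderiv_curve (hκz z hz) 1
    rw [h0, zero_mul] at this
    exact this
  · filter_upwards [hsrcY, hUz] with w hw hwU
    simp only [Function.comp_apply]
    rw [cY.left_inv hw, hΨκ w hwU]

/-- A holomorphic curve is smooth in the real sense. -/
lemma contMDiffAt_real_of_mdifferentiableOn [IsManifold 𝓘(ℂ) ω Y] {U : Set ℂ} (hU : IsOpen U)
    {Ψ : ℂ → Y} (hΨ : MDifferentiableOn 𝓘(ℂ) 𝓘(ℂ) Ψ U) {z : ℂ} (hz : z ∈ U) :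
    ContMDiffAt 𝓘(ℝ, ℂ) 𝓘(ℝ, ℂ) ∞ Ψ z := by
  have := isManifold_one Y
  have hΨz : ∀ w ∈ U, MDifferentiableAt 𝓘(ℂ) 𝓘(ℂ) Ψ w := fun w hw =>
    (hΨ w hw).mdifferentiableAt (hU.mem_nhds hw)
  have ho : IsOpen (U ∩ Ψ ⁻¹' (chartAt ℂ (Ψ z)).source) :=
    hΨ.continuousOn.isOpen_inter_preimage hU (chartAt ℂ (Ψ z)).open_source
  have hd : DifferentiableOn ℂ (chartAt ℂ (Ψ z) ∘ Ψ) (U ∩ Ψ ⁻¹' (chartAt ℂ (Ψ z)).source) := by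
    rintro w ⟨hw1, hw2⟩
    have h2 : MDifferentiableAt 𝓘(ℂ) 𝓘(ℂ) (chartAt ℂ (Ψ z)) (Ψ w) :=
      mdifferentiableAt_atlas (chart_mem_atlas ℂ _) hw2
    exact (mdifferentiableAt_iff_differentiableAt.1
      (h2.comp w (hΨz w hw1))).differentiableWithinAt
  have ha : AnalyticAt ℂ (chartAt ℂ (Ψ z) ∘ Ψ) z :=
    hd.analyticAt (ho.mem_nhds ⟨hz, mem_chart_source ℂ _⟩)
  have hc : ContDiffAt ℝ ∞ (chartAt ℂ (Ψ z) ∘ Ψ) z := (ha.contDiffAt (n := ∞)).restrict_scalars ℝ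
  rw [contMDiffAt_iff]
  refine ⟨(hΨz z hz).continuousAt, ?_⟩
  simpa [contDiffWithinAt_univ, Function.comp_def, chartAt_self_eq] using hc

/-- Both derivatives are computed in the same preferred chart, where a complex derivative acts as
multiplication, an `ℝ`-linear map. -/
lemma mfderiv_real_eq_mfderiv {Ψ : ℂ → Y} {z : ℂ} (hc : MDifferentiableAt 𝓘(ℂ) 𝓘(ℂ) Ψ z)
    (hr : MDifferentiableAt 𝓘(ℝ, ℂ) 𝓘(ℝ, ℂ) Ψ z) (v : ℂ) :
    (mfderiv 𝓘(ℝ, ℂ) 𝓘(ℝ, ℂ) Ψ z v : ℂ) = mfderiv 𝓘(ℂ) 𝓘(ℂ) Ψ z v := by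
  have h1 : HasDerivAt (chartAt ℂ (Ψ z) ∘ Ψ) (deriv (chartAt ℂ (Ψ z) ∘ Ψ) z) z :=
    (mdifferentiableAt_curve_iff.1 hc).2.hasDerivAt
  have h2 := hasFDerivAt_real_of_hasDerivAt h1
  have h3 : HasMFDerivAt 𝓘(ℝ, ℂ) 𝓘(ℝ, ℂ) Ψ z
      (ContinuousLinearMap.mul ℝ ℂ (deriv (chartAt ℂ (Ψ z) ∘ Ψ) z) : ℂ →L[ℝ] ℂ) := by
    refine ⟨hr.continuousAt, ?_⟩
    have h0 : HasFDerivWithinAt (writtenInExtChartAt 𝓘(ℝ, ℂ) 𝓘(ℝ, ℂ) z Ψ)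
        (ContinuousLinearMap.mul ℝ ℂ (deriv (chartAt ℂ (Ψ z) ∘ Ψ) z)) (range 𝓘(ℝ, ℂ))
        (extChartAt 𝓘(ℝ, ℂ) z z) := by
      simpa [writtenInExtChartAt, Function.comp_def, chartAt_self_eq] using h2
    exact h0
  rw [mfderiv_curve hc]
  exact congrArg (fun L : ℂ →L[ℝ] ℂ => L v) h3.mfderiv

lemma fderiv_comp_curve [IsManifold 𝓘(ℂ) ω Y] {U : Set ℂ} (hU : IsOpen U)
    {Ψ : ℂ → Y} (hΨ : MDifferentiableOn 𝓘(ℂ) 𝓘(ℂ) Ψ U) {s : Y → Fin 4 → ℝ}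
    (hs : ContMDiff 𝓘(ℝ, ℂ) 𝓘(ℝ, Fin 4 → ℝ) ∞ s) {z : ℂ} (hz : z ∈ U) (v : ℂ) :
    fderiv ℝ (s ∘ Ψ) z v = surfaceDeriv s (Ψ z) (mfderiv 𝓘(ℂ) 𝓘(ℂ) Ψ z v) := by
  have hr := (contMDiffAt_real_of_mdifferentiableOn hU hΨ hz).mdifferentiableAt (by simp)
  have h1 := mfderiv_comp_apply z ((hs (Ψ z)).mdifferentiableAt (by simp)) hr v
  rw [mfderiv_eq_fderiv] at h1
  rw [← mfderiv_real_eq_mfderiv ((hΨ z hz).mdifferentiableAt (hU.mem_nhds hz)) hr]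
  exact h1

lemma contDiffOn_comp_curve [IsManifold 𝓘(ℂ) ω Y] {U : Set ℂ} (hU : IsOpen U)
    {Ψ : ℂ → Y} (hΨ : MDifferentiableOn 𝓘(ℂ) 𝓘(ℂ) Ψ U) {s : Y → Fin 4 → ℝ}
    (hs : ContMDiff 𝓘(ℝ, ℂ) 𝓘(ℝ, Fin 4 → ℝ) ∞ s) : ContDiffOn ℝ ∞ (s ∘ Ψ) U := fun z hz =>
  (contMDiffAt_iff_contDiffAt.1 ((hs (Ψ z)).comp z
    (contMDiffAt_real_of_mdifferentiableOn hU hΨ hz))).contDiffWithinAt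

end Curves

/-! ### The conformal factor of a maximal surface near a puncture -/

section LogCoefficient

/-- The coefficient of `q` in the logarithm of an adapted coordinate. -/
lemma exists_log_coeff {X : Type*} [TopologicalSpace X] [ChartedSpace ℂ X]
    {q : QuadDiff X} {P : Finset X} {p : X} {n : ℕ} {e : OpenPartialHomeomorph X ℂ} {r : ℝ} (he : IsAdaptedCoordinate q P p n e r) :
    ∃ A : ℂ, ∀ ζ : ℂ, ‖Complex.exp ζ‖ < r →
      q.pullback e.symm (Complex.exp ζ) * Complex.exp ζ ^ 2 =
        (Complex.exp (-((((n : ℝ) - 2) / 2 : ℝ) * ζ)) + A) ^ 2 := by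
  have hpos : ∀ ζ : ℂ, 0 < ‖Complex.exp ζ‖ := fun ζ => norm_pos_iff.2 (Complex.exp_ne_zero ζ)
  rcases Nat.even_or_odd n with hn | hn
  · obtain ⟨A, hA⟩ := he.normal_form_even hn
    refine ⟨A, fun ζ hζ => ?_⟩
    obtain ⟨k, rfl⟩ := hn
    have h1 : (k + k) / 2 = k := by omega
    have h2 : Complex.exp (-(((((k + k : ℕ) : ℝ) - 2) / 2 : ℝ) * ζ)) =
        Complex.exp ζ / Complex.exp ζ ^ k := by
      rw [← Complex.exp_nat_mul, ← Complex.exp_sub]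
      congr 1
      push_cast
      ring
    rw [hA _ (hpos ζ) hζ, h1, h2, ← mul_pow]
    congr 1
    have := Complex.exp_ne_zero ζ
    field_simp
  · refine ⟨0, fun ζ hζ => ?_⟩
    -- For odd `n` the exponent `(n - 2) / 2` is a half-integer, so the square root of `q` is
    -- single-valued only in the logarithmic variable.
    have h2 : Complex.exp (-((((n : ℝ) - 2) / 2 : ℝ) * ζ)) ^ 2 =
        Complex.exp ζ ^ 2 / Complex.exp ζ ^ n := by
      rw [← Complex.exp_nat_mul, ← Complex.exp_nat_mul, ← Complex.exp_nat_mul, ← Complex.exp_sub]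
      congr 1
      push_cast
      ring
    rw [he.normal_form_odd hn _ (hpos ζ) hζ, add_zero, h2]
    ring

/-- A nonvanishing exponential polynomial on a left half-plane has its leading term dominant. -/
lemma norm_le_norm_exp {m : ℝ} (hm : 0 < m) {A : ℂ} {r : ℝ}
    (h : ∀ ζ : ℂ, ‖Complex.exp ζ‖ < r → Complex.exp (-(m * ζ)) + A ≠ 0) {ζ : ℂ}
    (hζ : ‖Complex.exp ζ‖ < r) : ‖A‖ ≤ ‖Complex.exp (-(m * ζ))‖ := by
  by_contra! hlt
  have hm0 : (m : ℂ) ≠ 0 := by exact_mod_cast hm.ne'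
  have hA : -A ≠ 0 := by
    rw [neg_ne_zero, ← norm_pos_iff]
    exact (norm_nonneg _).trans_lt hlt
  have h1 : Complex.exp (-(m * (-Complex.log (-A) / m))) = -A := by
    rw [mul_div_cancel₀ _ hm0, neg_neg, Complex.exp_log hA]
  -- If `‖A‖` dominated at `ζ`, this zero of the exponential polynomial would lie to the left of
  -- `ζ`, hence inside the half-plane.
  refine h (-Complex.log (-A) / m) (lt_trans ?_ hζ) (by rw [h1]; ring)
  rw [← norm_neg A, ← h1, Complex.norm_exp, Complex.norm_exp, Real.exp_lt_exp] at hlt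
  rw [Complex.norm_exp, Complex.norm_exp, Real.exp_lt_exp]
  simp only [Complex.neg_re, Complex.re_ofReal_mul] at hlt
  exact lt_of_mul_lt_mul_left (neg_lt_neg_iff.1 hlt) hm.le

end LogCoefficient

/-! ### The Gauss equation along a lifted curve. -/

section Puncture

variable {X : Type*} [TopologicalSpace X] [ChartedSpace ℂ X] [IsManifold 𝓘(ℂ) ω X]
  {Y : Type*} [TopologicalSpace Y] [ChartedSpace ℂ Y] [IsManifold 𝓘(ℂ) ω Y]

/-- The conformal factor of `S` along a curve in the cover. -/
def conformalFactor (σ : ℂ → Fin 4 → ℝ) (z : ℂ) : ℝ :=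
  adsForm (fderiv ℝ σ z 1) (fderiv ℝ σ z 1)

/-- The Gauss equation of a maximal surface, read in a lift of a curve `κ` on which `q` does not
vanish. -/
lemma gauss_along_lift {π : Y → X} (hπ : MDifferentiable 𝓘(ℂ) 𝓘(ℂ) π) {q : QuadDiff X}
    (S : EquivariantMaximalEmbedding π q) {U : Set ℂ} (hU : IsOpen U) {κ : ℂ → X}
    (hκ : MDifferentiableOn 𝓘(ℂ) 𝓘(ℂ) κ U) (hne : ∀ z ∈ U, q.pullback κ z ≠ 0) {Ψ : ℂ → Y}
    (hΨ : ContinuousOn Ψ U) (hΨκ : ∀ z ∈ U, π (Ψ z) = κ z) {z : ℂ} (hz : z ∈ U) :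
    DifferentiableAt ℝ (S.s ∘ Ψ) z ∧ 0 < conformalFactor (S.s ∘ Ψ) z ∧
      (∀ v : ℂ, adsForm (fderiv ℝ (S.s ∘ Ψ) z v) (fderiv ℝ (S.s ∘ Ψ) z v) =
        ‖v‖ ^ 2 * conformalFactor (S.s ∘ Ψ) z) ∧
      ContDiffAt ℝ 2 (fun w => Real.log (conformalFactor (S.s ∘ Ψ) w)) z ∧
      Δ (fun w => Real.log (conformalFactor (S.s ∘ Ψ) w)) z =
        2 * conformalFactor (S.s ∘ Ψ) z -
          8 * ‖q.pullback κ z‖ ^ 2 / conformalFactor (S.s ∘ Ψ) z := by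
  have hκ0 : ∀ w ∈ U, mfderiv 𝓘(ℂ) 𝓘(ℂ) κ w (1 : ℂ) ≠ 0 := fun w hw h0 => by
    apply hne w hw
    unfold QuadDiff.pullback
    exact (congrArg (q.toFun (κ w)) h0).trans (QuadDiff.map_zero' q _)
  have hΨm : MDifferentiableOn 𝓘(ℂ) 𝓘(ℂ) Ψ U := fun w hw =>
    (mdifferentiableOn_lift hπ hU hκ hΨ hΨκ hw (hκ0 w hw)).mdifferentiableWithinAt
  have hΨa : ∀ w ∈ U, MDifferentiableAt 𝓘(ℂ) 𝓘(ℂ) Ψ w := fun w hw =>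
    (hΨm w hw).mdifferentiableAt (hU.mem_nhds hw)
  have hsD := fun w hw v => fderiv_comp_curve hU hΨm S.smooth_s (z := w) hw v
  have hND := fun w hw v => fderiv_comp_curve hU hΨm S.smooth_N (z := w) hw v
  have hπΨ : ∀ w ∈ U, ∀ v : ℂ, (mfderiv 𝓘(ℂ) 𝓘(ℂ) π (Ψ w) (mfderiv 𝓘(ℂ) 𝓘(ℂ) Ψ w v) : ℂ) =
      mfderiv 𝓘(ℂ) 𝓘(ℂ) κ w v := fun w hw v => by
    have h1 := mfderiv_comp_apply w (hπ (Ψ w)) (hΨa w hw) v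
    have h2 : (π ∘ Ψ) =ᶠ[𝓝 w] κ := by
      filter_upwards [hU.mem_nhds hw] with x hx using hΨκ x hx
    have h3 : (mfderiv 𝓘(ℂ) 𝓘(ℂ) (π ∘ Ψ) w v : ℂ) = mfderiv 𝓘(ℂ) 𝓘(ℂ) κ w v := by
      rw [h2.mfderiv_eq]; rfl
    exact h1.symm.trans h3
  have hΨ0 : ∀ w ∈ U, (mfderiv 𝓘(ℂ) 𝓘(ℂ) Ψ w (1 : ℂ) : ℂ) ≠ 0 := fun w hw h0 => by
    apply hκ0 w hw
    rw [← hπΨ w hw 1]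
    exact (congrArg (mfderiv 𝓘(ℂ) 𝓘(ℂ) π (Ψ w)) h0).trans (map_zero _)
  have hE : ∀ w ∈ U, 0 < conformalFactor (S.s ∘ Ψ) w := fun w hw => by
    rw [conformalFactor, hsD w hw]
    exact S.spacelike _ _ (hΨ0 w hw)
  have hmet : ∀ w ∈ U, ∀ v : ℂ,
      adsForm (fderiv ℝ (S.s ∘ Ψ) w v) (fderiv ℝ (S.s ∘ Ψ) w v) =
        ‖v‖ ^ 2 * conformalFactor (S.s ∘ Ψ) w := fun w hw v => by
    have h1 := mfderiv_curve (hΨa w hw) v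
    have h2 := mfderiv_curve (hΨa w hw) 1
    rw [mul_one] at h2
    rw [mul_comm, ← h2] at h1
    rw [conformalFactor, hsD w hw, hsD w hw, h1]
    exact S.conformal _ _ _
  have hsm := contDiffOn_comp_curve hU hΨm S.smooth_s
  have hGauss := gauss_equation hU hsm
    (contDiffOn_comp_curve hU hΨm S.smooth_N) (E := conformalFactor (S.s ∘ Ψ))
    (φ := q.pullback κ) hE (fun w _ => S.mem_quadric _) (fun w _ => S.normal_unit _)
    (fun w _ => S.normal_position _)
    (fun w hw v => by
      rw [dirDeriv, hsD w hw]
      exact S.normal_tangent _ _)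
    hmet
    (fun w hw v => by
      rw [dirDeriv, dirDeriv, hsD w hw, hND w hw]
      refine (S.secondForm_eq (Ψ w) (mfderiv 𝓘(ℂ) 𝓘(ℂ) Ψ w v)).trans ?_
      rw [← QuadDiff.toFun_mfderiv, ← hΨκ w hw]
      have h1 := hπΨ w hw v
      exact congrArg (fun t : ℂ => (2 * q.toFun (π (Ψ w)) t).re) h1) hz
  exact ⟨(hsm.contDiffAt (hU.mem_nhds hz)).differentiableAt (by simp), hE z hz, hmet z hz, hGauss⟩

end Puncture

/-! ### The coordinate of the end, and the final estimate. -/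

section Decay

variable {X : Type*} [TopologicalSpace X] [ChartedSpace ℂ X]

lemma mdifferentiableAt_symm_of_adapted {q : QuadDiff X} {P : Finset X} {p : X} {n : ℕ}
    {e : OpenPartialHomeomorph X ℂ} {r : ℝ} (he : IsAdaptedCoordinate q P p n e r) {w : ℂ}
    (hw : ‖w‖ < r) : MDifferentiableAt 𝓘(ℂ) 𝓘(ℂ) e.symm w := by
  have := (contMDiffOn_symm_of_mem_maximalAtlas he.holomorphic).contMDiffAt
    (e.open_target.mem_nhds (he.ball_subset (mem_ball_zero_iff.2 hw)))
  exact this.mdifferentiableAt (by simp)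

/-- A natural coordinate on a standard half-plane, written in the logarithm of an adapted
coordinate. -/
lemma exists_log_coordinate {q : QuadDiff X} {P : Finset X} {p : X} {n : ℕ}
    {e : OpenPartialHomeomorph X ℂ} {r : ℝ} (he : IsAdaptedCoordinate q P p n e r) {Φ : ℂ → X}
    (hΦ : MDifferentiableOn 𝓘(ℂ) 𝓘(ℂ) Φ upperHalf)
    (hmap : ∀ z ∈ upperHalf, Φ z ∈ e.source ∧ 0 < ‖e (Φ z)‖ ∧ ‖e (Φ z)‖ < r) :
    ∃ Z : ℂ → ℂ, DifferentiableOn ℂ Z upperHalf ∧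
      ∀ z ∈ upperHalf, ‖Complex.exp (Z z)‖ < r ∧ e.symm (Complex.exp (Z z)) = Φ z := by
  have hWd : ∀ z ∈ upperHalf, DifferentiableAt ℂ (fun w => e (Φ w)) z := fun z hz => by
    have h1 : MDifferentiableAt 𝓘(ℂ) 𝓘(ℂ) e (Φ z) :=
      ((contMDiffOn_of_mem_maximalAtlas he.holomorphic).contMDiffAt
        (e.open_source.mem_nhds (hmap z hz).1)).mdifferentiableAt (by simp)
    exact mdifferentiableAt_iff_differentiableAt.1
      (h1.comp z ((hΦ z hz).mdifferentiableAt (isOpen_upperHalf.mem_nhds hz)))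
  have hW0 : ∀ z ∈ upperHalf, e (Φ z) ≠ 0 := fun z hz => norm_pos_iff.1 (hmap z hz).2.1
  obtain ⟨Z, hZc, -, hZ⟩ := exists_lift Complex.isCoveringMapOn_exp isOpen_upperHalf
    convex_upperHalf (f := fun w => e (Φ w))
    (fun z hz => (hWd z hz).continuousAt.continuousWithinAt) (fun z hz => hW0 z hz)
    I_mem_upperHalf (Complex.exp_log (hW0 _ I_mem_upperHalf))
  refine ⟨Z, fun z hz => ?_, fun z hz => ?_⟩
  · refine (hasDerivAt_of_comp_eq (Complex.hasStrictDerivAt_exp (Z z)) (Complex.exp_ne_zero _)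
      (hZc.continuousAt (isOpen_upperHalf.mem_nhds hz)) (hWd z hz).hasDerivAt
      ?_).differentiableAt.differentiableWithinAt
    filter_upwards [isOpen_upperHalf.mem_nhds hz] with w hw using hZ w hw
  · rw [hZ z hz]
    exact ⟨(hmap z hz).2.2, e.left_inv (hmap z hz).1⟩

/-- Near a puncture, a standard half-plane lies in a half-plane with coordinate `ξ` in which the
natural coordinate is `endMap a b`. -/
lemma exists_end_coordinate {q : QuadDiff X} {P : Finset X} {p : X} {Φ : ℂ → X}
    (hΦ : IsStandardHalfPlane q P p Φ) :
    ∃ (a b : ℂ) (ℓ : ℝ) (κ : ℂ → X) (Ξ : ℂ → ℂ),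
      MDifferentiableOn 𝓘(ℂ) 𝓘(ℂ) κ {ξ | ℓ < ξ.re} ∧
      (∀ ξ : ℂ, ℓ < ξ.re → κ ξ ∉ P) ∧
      (∀ ξ : ℂ, ℓ < ξ.re → q.pullback κ ξ = (Complex.exp ξ + a) ^ 2 ∧ Complex.exp ξ + a ≠ 0) ∧
      DifferentiableOn ℂ Ξ upperHalf ∧
      (∀ z ∈ upperHalf, ℓ < (Ξ z).re ∧ κ (Ξ z) = Φ z ∧ endMap a b (Ξ z) = z) ∧
      ∀ K : ℝ, ∃ R : ℝ, ∀ z ∈ upperHalf, R ≤ ‖z‖ → K ≤ (Ξ z).re ∧ |(Ξ z).im| ≤ 4 := by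
  obtain ⟨n, e, r, he, hmap⟩ := hΦ.maps_to
  obtain ⟨Z, hZd, hZ⟩ := exists_log_coordinate he hΦ.holomorphic hmap
  obtain ⟨A, hA⟩ := exists_log_coeff he
  set m : ℝ := ((n : ℝ) - 2) / 2 with hm
  have hmpos : 0 < m := by
    have : (3 : ℝ) ≤ n := by exact_mod_cast he.three_le
    rw [hm]
    linarith
  have hm0 : (m : ℂ) ≠ 0 := by exact_mod_cast hmpos.ne'
  have hexp0 : ∀ ζ : ℂ, 0 < ‖Complex.exp ζ‖ := fun ζ => norm_pos_iff.2 (Complex.exp_ne_zero ζ)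
  have hA0 : ∀ ζ : ℂ, ‖Complex.exp ζ‖ < r → Complex.exp (-(m * ζ)) + A ≠ 0 := fun ζ hζ h0 => by
    have h1 := hA ζ hζ
    rw [h0, zero_pow two_ne_zero] at h1
    exact mul_ne_zero (he.ne_zero _ (hexp0 ζ) hζ) (pow_ne_zero 2 (Complex.exp_ne_zero ζ)) h1
  obtain ⟨a, b, μ, h1, h2, h3⟩ := exists_normalized hmpos (A := A) hZd (fun z hz => by
      have hzn := isOpen_upperHalf.mem_nhds hz
      have h4 := (hZd.differentiableAt hzn).hasDerivAt.cexp
      have h5 := QuadDiff.pullback_comp q (k := e.symm) (f := fun w => Complex.exp (Z w))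
        (mdifferentiableAt_symm_of_adapted he (hZ z hz).1) h4
      have h6 : (fun w => e.symm (Complex.exp (Z w))) =ᶠ[𝓝 z] Φ := by
        filter_upwards [hzn] with w hw using (hZ w hw).2
      rw [QuadDiff.pullback_congr q h6, hΦ.pullback_eq z hz] at h5
      rw [mul_pow, ← hA _ (hZ z hz).1, h5]
      ring)
    (fun z hz => norm_le_norm_exp hmpos hA0 (hZ z hz).1)
  have hr := he.r_pos
  have hbound : ∀ ξ : ℂ, m * (μ.re - Real.log r) < ξ.re → ‖Complex.exp (μ - ξ / m)‖ < r :=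
    fun ξ hξ => by
      rw [Complex.norm_exp, ← Real.lt_log_iff_exp_lt hr, Complex.sub_re, Complex.div_ofReal_re,
        sub_lt_comm, lt_div_iff₀ hmpos]
      linarith
  have hderiv : ∀ ξ : ℂ, HasDerivAt (fun ξ => Complex.exp (μ - ξ / m))
      (Complex.exp (μ - ξ / m) * -(1 / m)) ξ := fun ξ =>
    (((hasDerivAt_id ξ).div_const (m : ℂ)).const_sub μ).cexp
  -- The half-plane `m (Re μ - log r) < Re ξ` is the universal cover of the punctured disc `0 < |w|
  -- < r` under `w = exp (μ - ξ / m)`.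
  refine ⟨a, b, m * (μ.re - Real.log r), fun ξ => e.symm (Complex.exp (μ - ξ / m)),
    fun z => m * (μ - Z z), fun ξ hξ => ?_, fun ξ hξ => ?_, fun ξ hξ => ?_,
    (hZd.const_sub μ).const_mul _, fun z hz => ⟨?_, ?_, h2 z hz⟩, h3⟩
  · exact ((mdifferentiableAt_symm_of_adapted he (hbound ξ hξ)).comp ξ
      (hderiv ξ).differentiableAt.mdifferentiableAt).mdifferentiableWithinAt
  · exact he.not_puncture _ (hexp0 _) (hbound ξ hξ)
  · have h4 : q.pullback (fun ξ => e.symm (Complex.exp (μ - ξ / m))) ξ =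
        (Complex.exp ξ + a) ^ 2 := by
      rw [QuadDiff.pullback_comp q (k := e.symm) (f := fun ξ => Complex.exp (μ - ξ / m))
        (mdifferentiableAt_symm_of_adapted he (hbound ξ hξ)) (hderiv ξ), ← h1, ← hA _ (hbound ξ hξ)]
      field_simp
    refine ⟨h4, fun h0 => ?_⟩
    have h5 := h1 ξ
    rw [h0, zero_pow two_ne_zero, div_eq_zero_iff] at h5
    rcases h5 with h5 | h5
    · exact hA0 _ (hbound ξ hξ) (pow_eq_zero_iff two_ne_zero |>.1 h5)
    · exact pow_ne_zero 2 hm0 h5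
  · have h4 := (hZ z hz).1
    rw [Complex.norm_exp, ← Real.lt_log_iff_exp_lt hr] at h4
    rw [Complex.re_ofReal_mul, Complex.sub_re]
    gcongr
  · have h4 : μ - m * (μ - Z z) / m = Z z := by
      rw [mul_div_cancel_left₀ _ hm0]; ring
    simp only [h4]
    exact (hZ z hz).2

/-- The conformal factor of a maximal surface decays on a standard half-plane. -/
lemma exists_conformalFactor_bound [IsManifold 𝓘(ℂ) ω X] {Y : Type*} [TopologicalSpace Y]
    [ChartedSpace ℂ Y] [IsManifold 𝓘(ℂ) ω Y] {π : Y → X} (hπ : MDifferentiable 𝓘(ℂ) 𝓘(ℂ) π)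
    {q : QuadDiff X}
    {P : Finset X} (hcov : IsCoveringMapOn π {x : X | x ∉ P})
    (S : EquivariantMaximalEmbedding π q) {p : X} {Φ : ℂ → X}
    (hΦ : IsStandardHalfPlane q P p Φ) {Ψ : ℂ → Y} (hΨ : ContinuousOn Ψ upperHalf)
    (hΨΦ : ∀ z ∈ upperHalf, π (Ψ z) = Φ z) {v : ℂ → ℝ}
    (hv : ∀ z ∈ upperHalf, ∀ c : ℂ,
      adsForm (fderiv ℝ (S.s ∘ Ψ) z c) (fderiv ℝ (S.s ∘ Ψ) z c) =
        2 * Real.exp (2 * v z) * ‖c‖ ^ 2) :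
    ∃ C R : ℝ, ∀ z ∈ upperHalf, R ≤ ‖z‖ →
      |v z| ≤ C * (Real.exp (-(rate * ‖z‖)) / Real.sqrt ‖z‖) := by
  obtain ⟨a, b, ℓ, κ, Ξ, hκ, hκP, hκq, hΞ, hΞΦ, hΞfar⟩ := exists_end_coordinate hΦ
  have hU : IsOpen {ξ : ℂ | ℓ < ξ.re} := isOpen_lt continuous_const Complex.continuous_re
  have hI := I_mem_upperHalf
  -- The lift over the larger half-plane is chosen to agree with `Ψ` at one point; uniqueness of
  -- lifts then makes it extend `Ψ`.
  obtain ⟨Ψ', hΨ'c, hΨ'0, hΨ'⟩ := exists_lift hcov hU (convex_halfSpace_re_gt ℓ)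
    hκ.continuousOn hκP (hΞΦ _ hI).1 (e₀ := Ψ Complex.I)
    (by rw [hΨΦ _ hI, (hΞΦ _ hI).2.1])
  have hmaps : MapsTo Ξ upperHalf {ξ : ℂ | ℓ < ξ.re} := fun z hz => (hΞΦ z hz).1
  have hΨeq : EqOn (Ψ' ∘ Ξ) Ψ upperHalf := by
    refine eqOn_of_lift hcov isOpen_upperHalf convex_upperHalf (f := Φ) (fun z hz => ?_)
      hΦ.holomorphic.continuousOn hI (hΨ'c.comp hΞ.continuousOn hmaps) hΨ (fun z hz => ?_) hΨΦ hΨ'0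
    · rw [← (hΞΦ z hz).2.1]
      exact hκP _ (hmaps hz)
    · exact (hΨ' _ (hmaps hz)).trans (hΞΦ z hz).2.1
  have hG := fun (ξ : ℂ) (hξ : ℓ < ξ.re) => gauss_along_lift hπ S hU hκ
    (fun w hw => by
      rw [(hκq w hw).1]
      exact pow_ne_zero 2 (hκq w hw).2) hΨ'c hΨ' hξ
  have hSG := isSinhGordon_of_gauss (a := a) (ℓ := ℓ) (E := conformalFactor (S.s ∘ Ψ'))
    (fun w hw => (hκq w hw).2) (fun w hw => (hG w hw).2.1) (fun w hw => by
      rw [← (hκq w hw).1]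
      exact (hG w hw).2.2.2)
  obtain ⟨K, C, -, hKC⟩ := exists_sharp_decay a b ℓ
  obtain ⟨R, hR⟩ := hΞfar K
  refine ⟨C, R, fun z hz hRz => ?_⟩
  have hzn := isOpen_upperHalf.mem_nhds hz
  have hΞd := (hΞ.differentiableAt hzn).hasDerivAt
  have hone : (Complex.exp (Ξ z) + a) * deriv Ξ z = 1 := by
    have h1 := (hasDerivAt_endMap a b (Ξ z)).comp z hΞd
    have h2 : (endMap a b ∘ Ξ) =ᶠ[𝓝 z] id := by
      filter_upwards [hzn] with w hw using (hΞΦ w hw).2.2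
    exact (h1.congr_of_eventuallyEq h2.symm).unique (hasDerivAt_id z)
  have hconf : ‖deriv Ξ z‖ ^ 2 * conformalFactor (S.s ∘ Ψ') (Ξ z) = 2 * Real.exp (2 * v z) := by
    obtain ⟨h1, -, h2, -⟩ := hG _ (hmaps hz)
    have h3 : (S.s ∘ Ψ) =ᶠ[𝓝 z] ((S.s ∘ Ψ') ∘ Ξ) := by
      filter_upwards [hzn] with w hw
      exact congrArg S.s (hΨeq hw).symm
    have h4 : HasFDerivAt (S.s ∘ Ψ) _ z :=
      (h1.hasFDerivAt.comp z (hasFDerivAt_real_of_hasDerivAt hΞd)).congr_of_eventuallyEq h3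
    have h5 := hv z hz 1
    rw [h4.fderiv] at h5
    simp only [ContinuousLinearMap.comp_apply, ContinuousLinearMap.mul_apply', mul_one, norm_one,
      one_pow] at h5
    rw [← h5, h2]
  have hn : 0 < ‖Complex.exp (Ξ z) + a‖ := norm_pos_iff.2 (hκq _ (hmaps hz)).2
  have hE : conformalFactor (S.s ∘ Ψ') (Ξ z) =
      2 * Real.exp (2 * v z) * ‖Complex.exp (Ξ z) + a‖ ^ 2 := by
    have h1 : ‖Complex.exp (Ξ z) + a‖ * ‖deriv Ξ z‖ = 1 := by rw [← norm_mul, hone, norm_one]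
    have h2 : (‖Complex.exp (Ξ z) + a‖ * ‖deriv Ξ z‖) ^ 2 = 1 := by rw [h1, one_pow]
    rw [← hconf]
    linear_combination -conformalFactor (S.s ∘ Ψ') (Ξ z) * h2
  have hfin := hKC _ hSG (Ξ z) (hR z hz hRz).1 (hR z hz hRz).2
  -- Since `‖exp ξ + a‖ |dξ| = |dω|`, the solution built from the conformal factor takes at `Ξ z`
  -- the value `v z`.
  rw [(hΞΦ z hz).2.2, hE, Real.log_mul (by positivity) (by positivity),
    Real.log_mul two_ne_zero (Real.exp_ne_zero _), Real.log_exp, Real.log_pow] at hfin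
  convert hfin using 2
  push_cast
  rw [smul_eq_mul]
  ring

end Decay

end MaximalSurface

end

theorem mainTheorem5
    -- the closed Riemann surface, its punctures and the quadratic differential
    {X : Type*} [TopologicalSpace X] [T2Space X] [CompactSpace X] [ConnectedSpace X]
    [ChartedSpace ℂ X] [IsManifold 𝓘(ℂ) ω X]
    (P : Finset X) (q : QuadDiff X) (hq : q.IsMeromorphicWithPoles P)
    -- the universal cover of the punctured surface
    {Y : Type*} [TopologicalSpace Y] [T2Space Y] [SimplyConnectedSpace Y]
    [ChartedSpace ℂ Y] [IsManifold 𝓘(ℂ) ω Y]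
    (π : Y → X) (hπ : MDifferentiable 𝓘(ℂ) 𝓘(ℂ) π) (hπP : ∀ y, π y ∉ P)
    (hcov : IsCoveringMapOn π {x : X | x ∉ P})
    -- the maximal surface
    (S : EquivariantMaximalEmbedding π q)
    -- a natural coordinate on a standard half-plane at a puncture, and a lift of it
    (p : X) (hp : p ∈ P) (Φ : ℂ → X) (hΦ : IsStandardHalfPlane q P p Φ)
    (Ψ : ℂ → Y) (hΨ : ContinuousOn Ψ upperHalf) (hΨΦ : ∀ z ∈ upperHalf, π (Ψ z) = Φ z)
    -- the induced metric is `2 e^{2v} |dω|²` in this coordinate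
    (v : ℂ → ℝ)
    (hv : ∀ z ∈ upperHalf, ∀ c : ℂ,
      adsForm (fderiv ℝ (S.s ∘ Ψ) z c) (fderiv ℝ (S.s ∘ Ψ) z c) =
        2 * Real.exp (2 * v z) * ‖c‖ ^ 2) :
    v =O[Bornology.cobounded ℂ ⊓ 𝓟 upperHalf]
      fun z => Real.exp (-(2 * Real.sqrt 2 * ‖z‖)) / Real.sqrt ‖z‖ := by
  obtain ⟨C, R, hC⟩ := MaximalSurface.exists_conformalFactor_bound hπ hcov S hΦ hΨ hΨΦ hv
  refine IsBigO.of_bound C ?_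
  rw [eventually_inf_principal]
  filter_upwards [eventually_cobounded_le_norm R] with z hz hzH
  rw [Real.norm_eq_abs, Real.norm_of_nonneg (by positivity)]
  exact hC z hzH hz
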